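/- Let $n\in\mathbb N$, let $A_1,\dots,A_{2n}$ and $V$ be real-valued $C^\infty$ functions on $\mathbb R^{2n}$, and for $\hbar>0$ let $$H_\hbar=\sum_{j=1}^{2n}\Big(\frac{\hbar}{i}\frac{\partial}{\partial x_j}-A_j(x)\Big)^2+\hbar V(x).$$ Let $B(x)=(B_{jk}(x))$, $B_{jk}=\partial A_k/\partial x_j-\partial A_j/\partial x_k$, be the matrix of the magnetic field. Assume that all $B_{jk}$ and $V$ are bounded on $\mathbb R^{2n}$ together with all their derivatives of any order, and that $B(x)$ has full rank $2n$ at each point $x$. Let $\pm i a_1(x),\dots,\pm i a_n(x)$, $a_j(x)>0$, be the eigenvalues of $B(x)$, counted with multiplicity, and put $$\Sigma_x=\Big\{\sum_{j=1}^n(2k_j+1)a_j(x)+V(x) : (k_1,\dots,k_n)\in\mathbb Z_+^n\Big\},\qquad \Sigma=\bigcup_{x\in\mathbb R^{2n}}\Sigma_x .$$ Let $[a,b]\subset\mathbb R$ be a bounded interval and $\Omega_{[a,b]}=\{x\in\mathbb R^{2n} : \Sigma_x\cap[a,b]=\emptyset\}$. Then there exist $C>0$ and $\hbar_0>0$ such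 that, for any $\lambda\in(a,b)$, any $\hbar\in(0,\hbar_0]$ and any complex-valued $u\in C^\infty(\mathbb R^{2n})$ with compact support contained in $\Omega_{[a,b]}$, $$\|(H_\hbar/\hbar-\lambda)u\|\ \ge\ \big(d(\lambda,\Sigma)-C\hbar^{1/4}\big)\|u\|,$$ where $\|\cdot\|$ is the norm of $L^2(\mathbb R^{2n})$ and $d(\lambda,\Sigma)$ is the distance from $\lambda$ to $\Sigma$. -/

import Mathlib

open MeasureTheory
open scoped ContDiff

noncomputable section

namespace MagneticSchrodinger

/-- The partial derivative `∂f/∂x_j` of a function on Euclidean space `ℝ^d`. -/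
def partialDeriv {d : ℕ} {F : Type*} [NormedAddCommGroup F] [NormedSpace ℝ F]
    (j : Fin d) (f : EuclideanSpace ℝ (Fin d) → F) (x : EuclideanSpace ℝ (Fin d)) : F :=
  fderiv ℝ f x (EuclideanSpace.single j 1)

/-- `f ∈ C^∞_b(ℝ^d)`: `f` is smooth and all its derivatives, of every order, are bounded. -/
def IsSmoothBounded {d : ℕ} (f : EuclideanSpace ℝ (Fin d) → ℝ) : Prop :=
  ContDiff ℝ ∞ f ∧ ∀ m : ℕ, ∃ C : ℝ, ∀ x, ‖iteratedFDeriv ℝ m f x‖ ≤ C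

/-- The matrix of the magnetic field, `B_{jk} = ∂A_k/∂x_j - ∂A_j/∂x_k`. -/
def magneticField {d : ℕ} (A : Fin d → EuclideanSpace ℝ (Fin d) → ℝ)
    (x : EuclideanSpace ℝ (Fin d)) : Matrix (Fin d) (Fin d) ℝ :=
  Matrix.of fun j k => partialDeriv j (A k) x - partialDeriv k (A j) x

/-- The magnetic momentum `(ħ/i) ∂/∂x_j - A_j`. -/
def momentum {d : ℕ} (ħ : ℝ) (A : Fin d → EuclideanSpace ℝ (Fin d) → ℝ) (j : Fin d)
    (u : EuclideanSpace ℝ (Fin d) → ℂ) (x : EuclideanSpace ℝ (Fin d)) : ℂ :=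
  ((ħ : ℂ) / Complex.I) * partialDeriv j u x - (A j x : ℂ) * u x

/-- The semiclassical magnetic Schrödinger operator
`H_ħ = ∑_j ((ħ/i) ∂/∂x_j - A_j)^2 + ħ V`, as a differential operator. -/
def hamiltonian {d : ℕ} (ħ : ℝ) (A : Fin d → EuclideanSpace ℝ (Fin d) → ℝ)
    (V : EuclideanSpace ℝ (Fin d) → ℝ) (u : EuclideanSpace ℝ (Fin d) → ℂ)
    (x : EuclideanSpace ℝ (Fin d)) : ℂ :=
  (∑ j, momentum ħ A j (momentum ħ A j u) x) + (ħ : ℂ) * (V x : ℂ) * u x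

/-- The norm of `L²(ℝ^d)`. -/
def l2Norm {d : ℕ} (u : EuclideanSpace ℝ (Fin d) → ℂ) : ℝ :=
  (eLpNorm u 2 volume).toReal

/-- `a_1, …, a_n > 0` are the numbers such that the eigenvalues of the real `2n × 2n` matrix `B`,
counted with multiplicity, are `± i a_1, …, ± i a_n`. For an invertible antisymmetric `B` they exist
and are unique up to their order. -/
def IsFrequencies {n : ℕ} (B : Matrix (Fin (2 * n)) (Fin (2 * n)) ℝ) (a : Fin n → ℝ) : Prop :=
  (∀ j, 0 < a j) ∧
    (B.map (fun t : ℝ => (t : ℂ))).charpoly.roots =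
      (Finset.univ.val.map fun j => Complex.I * (a j : ℂ)) +
        (Finset.univ.val.map fun j => -(Complex.I * (a j : ℂ)))

/-- The set `Σ_x` of the Landau levels `Λ_k(x) = ∑_j (2 k_j + 1) a_j(x) + V(x)`, `k ∈ ℤ_+^n`,
at the point `x`. It does not depend on the order in which the `a_j(x)` are listed. -/
def landauLevels {n : ℕ}
    (A : Fin (2 * n) → EuclideanSpace ℝ (Fin (2 * n)) → ℝ)
    (V : EuclideanSpace ℝ (Fin (2 * n)) → ℝ) (x : EuclideanSpace ℝ (Fin (2 * n))) : Set ℝ :=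
  {Λ | ∃ a : Fin n → ℝ, IsFrequencies (magneticField A x) a ∧
    ∃ k : Fin n → ℕ, Λ = (∑ j, (2 * (k j : ℝ) + 1) * a j) + V x}

/-- `Σ`, the union of the sets `Σ_x` over all points `x`. -/
def allLandauLevels {n : ℕ}
    (A : Fin (2 * n) → EuclideanSpace ℝ (Fin (2 * n)) → ℝ)
    (V : EuclideanSpace ℝ (Fin (2 * n)) → ℝ) : Set ℝ :=
  ⋃ x, landauLevels A V x

/-- `Ω_{[a,b]}`, the set of points whose Landau levels avoid `[a, b]`. -/
def gapRegion {n : ℕ}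
    (A : Fin (2 * n) → EuclideanSpace ℝ (Fin (2 * n)) → ℝ)
    (V : EuclideanSpace ℝ (Fin (2 * n)) → ℝ) (a b : ℝ) :
    Set (EuclideanSpace ℝ (Fin (2 * n))) :=
  {x | landauLevels A V x ∩ Set.Icc a b = ∅}

end MagneticSchrodinger

end

/-! The spectral parameter is first frozen. Let `S` be the union of the Landau levels over the
points of the gap region. Then `[a, b]` lies in an interval with centre `μ` and half length `D`
whose interior avoids `S`, and it can be chosen so that `d(lam, Σ) ≤ D - |lam - μ|` for all `lam` in
`(a, b)` (`exists_gap_centre`). By the triangle inequality it suffices to bound `‖(H_ħ/ħ - μ)u‖`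
from below by `(D - C ħ^(1/4)) ‖u‖`. Since `μ` and `D` do not depend on `lam`, neither does `C`.

For this fixed `μ` the operator is compared with constant-field models. Multiply `u` by translates
`ρ(· - y)` of a cutoff of radius `r`, normalized by `∫ ρ² = 1`. If the product does not vanish,
choose a point `x₀` where it is nonzero. This point lies in the support of `u`, hence in the gap
region. The Poincaré gauge (`exists_gauge`) replaces the potential near `x₀` by the symmetric gauge
of the constant field `B(x₀)`, up to an error `O(r²)` whose relevant derivatives are `O(r)`.
Freezing `V` costs `O(r)`. The model has its spectral gap by `landau_spectral_gap`, which yields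
`exists_local_estimate`.

The local estimates are squared and integrated over `y` (`estimate_of_localized_estimates`). The
energy estimate gives momenta of size `ħ^(1/2)`, so the squared model error is of order `r⁴/ħ`, and
the squared first order commutator is of order `ħ/r²`. The cross term with that commutator, which
would be only `O(ħ^(1/2)/r)`, integrates to zero because `∫ ρ ∂_j ρ = 0`. With `r = ħ^(3/8)` and
Young weight `δ = ħ^(1/4)`, every contribution is `O(ħ^(1/4))`.

The gap of the model is obtained algebraically. With `S = ½|B|`, the momenta preserve the space of
polynomials times `exp(-⟨x, Sx⟩/2ħ)`. The momentum along an eigenvector of `B` for `i t`, with `t >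
0`, is there a pure derivative, so it lowers the degree, while its commutator with the operator
lowers the eigenvalue by `2ħt`. Hence the operator preserves each space of polynomials of bounded
degree, and descending the ladder shows that its eigenvalues there are Landau levels
(`GaugeData.exists_level_of_eigenvector`). These functions are dense in `L²`, so expanding in
eigenvectors on the finite-dimensional pieces and applying Bessel's inequality gives the lower bound
without any discussion of self-adjoint extensions (`mul_norm_le_of_invariant_subspaces`). -/

noncomputable section

namespace MagneticSchrodinger

/-! ### Frequencies and eigenvectors of an antisymmetric matrix -/

section

/-- A multiset of nonzero reals which is symmetric about `0` consists of its positive part and the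
opposite of its positive part. -/
lemma multiset_eq_pos_add_neg {m : Multiset ℝ} (hneg : m.map (fun t => -t) = m)
    (h0 : (0 : ℝ) ∉ m) :
    m = m.filter (fun t => 0 < t) + (m.filter (fun t => 0 < t)).map (fun t => -t) := by
  conv_lhs => rw [← Multiset.filter_add_not (fun t : ℝ => 0 < t) m]
  congr 1
  conv_lhs => rw [← hneg, Multiset.filter_map]
  congr 1
  apply Multiset.filter_congr
  intro x hx
  have : x ≠ 0 := fun h => h0 (h ▸ hx)
  simp only [Function.comp, not_lt, Left.neg_nonpos_iff]
  exact ⟨fun h => lt_of_le_of_ne h this.symm, le_of_lt⟩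

/-- A multiset with `n` elements is listed by a function on `Fin n`. -/
lemma exists_fin_map_eq_multiset {α : Type*} {n : ℕ} (m : Multiset α) (hm : m.card = n) :
    ∃ a : Fin n → α, Finset.univ.val.map a = m := by
  subst hm
  refine ⟨fun i => m.toList.get (i.cast (by simp)), ?_⟩
  rw [Fin.univ_val_map]
  have : List.ofFn (fun i : Fin m.card => m.toList.get (i.cast (by simp))) = m.toList := by
    apply List.ext_get
    · simp
    · intro i h1 h2
      simp
  rw [this, Multiset.coe_toList]

/-- The spectral data of a real antisymmetric matrix `B`: an orthonormal eigenbasis `w` of the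
Hermitian matrix `-i B`, with eigenvalues `θ`. -/
structure SpectralData {d : ℕ} (B : Matrix (Fin d) (Fin d) ℝ) (θ : Fin d → ℝ)
    (w : Fin d → Fin d → ℂ) : Prop where
  ne_zero : ∀ l, θ l ≠ 0
  eigen : ∀ l j, ∑ k, (B j k : ℂ) * w l k = Complex.I * θ l * w l j
  unit : ∀ l, ∑ j, w l j * starRingEnd ℂ (w l j) = 1
  complete : ∀ j k, ∑ l, w l j * starRingEnd ℂ (w l k) = if j = k then 1 else 0

/-- An invertible real antisymmetric matrix of size `2n` has frequencies `a_1, …, a_n`, and the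
eigenvalues of `-i B` are the numbers `± a_j`. -/
lemma exists_frequencies {n : ℕ} {B : Matrix (Fin (2 * n)) (Fin (2 * n)) ℝ}
    (hanti : B.transpose = -B) (hrank : B.rank = 2 * n) :
    ∃ (a : Fin n → ℝ) (θ : Fin (2 * n) → ℝ) (w : Fin (2 * n) → Fin (2 * n) → ℂ),
      IsFrequencies B a ∧ SpectralData B θ w ∧ (∀ l, ∃ j, |θ l| = a j) ∧
        ∑ l, max (-θ l) 0 = ∑ j, a j := by
  set Bc : Matrix (Fin (2 * n)) (Fin (2 * n)) ℂ := B.map (fun t : ℝ => (t : ℂ)) with hBc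
  have hBct : Bc.transpose = -Bc := by
    ext i j
    have := congrFun (congrFun hanti i) j
    simp only [Matrix.transpose_apply, Matrix.neg_apply] at this
    simp [hBc, this]
  set M : Matrix (Fin (2 * n)) (Fin (2 * n)) ℂ := (-Complex.I) • Bc with hM
  have hherm : M.IsHermitian := by
    ext i j
    have := congrFun (congrFun hBct i) j
    simp only [Matrix.transpose_apply, Matrix.neg_apply] at this
    have hreal : starRingEnd ℂ (Bc j i) = Bc j i := by simp [hBc]
    simp only [hM, Matrix.conjTranspose_apply, Matrix.smul_apply, smul_eq_mul]
    rw [star_mul', Complex.star_def, hreal, this]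
    simp
  have hBM : Bc = Complex.I • M := by
    rw [hM, smul_smul]; simp
  set θ := hherm.eigenvalues with hθ
  set U := hherm.eigenvectorUnitary with hU
  have hUU : (U : Matrix (Fin (2 * n)) (Fin (2 * n)) ℂ) * star (U : Matrix (Fin (2 * n)) (Fin (2 * n)) ℂ) = 1 :=
    Unitary.coe_mul_star_self U
  have hUU' : star (U : Matrix (Fin (2 * n)) (Fin (2 * n)) ℂ) * (U : Matrix (Fin (2 * n)) (Fin (2 * n)) ℂ) = 1 :=
    Unitary.coe_star_mul_self U
  -- A general scalar `c` is allowed because both `B = i M` and its transpose `-i M` are needed.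
  have hroots : ∀ c : ℂ, (c • M).charpoly.roots = Finset.univ.val.map fun l => c * (θ l : ℂ) := by
    intro c
    have h1 : c • M = (U : Matrix (Fin (2 * n)) (Fin (2 * n)) ℂ) * Matrix.diagonal (fun l => c * (θ l : ℂ)) *
        star (U : Matrix (Fin (2 * n)) (Fin (2 * n)) ℂ) := by
      conv_lhs => rw [hherm.spectral_theorem]
      rw [Unitary.conjStarAlgAut_apply, ← Matrix.smul_mul, ← Matrix.mul_smul]
      congr 2
      ext i j
      by_cases hij : i = j
      · subst hij; simp [hθ]
      · simp [hij]
    rw [h1, mul_assoc, Matrix.charpoly_mul_comm, mul_assoc, hUU', mul_one,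
      Matrix.charpoly_diagonal]
    have h2 := Polynomial.roots_multiset_prod_X_sub_C
      (Finset.univ.val.map fun l => c * (θ l : ℂ))
    rwa [Multiset.map_map] at h2
  have hrootsB : Bc.charpoly.roots = Finset.univ.val.map fun l => Complex.I * (θ l : ℂ) := by
    rw [hBM]; exact hroots _
  have hrootsB' : Bc.charpoly.roots = Finset.univ.val.map fun l => -Complex.I * (θ l : ℂ) := by
    rw [← Matrix.charpoly_transpose, hBct, hBM, ← neg_smul]; exact hroots _
  set m : Multiset ℝ := Finset.univ.val.map θ with hm
  have hinj : Function.Injective (fun t : ℝ => Complex.I * (t : ℂ)) := by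
    intro s t hst
    simpa [Complex.I_ne_zero] using hst
  -- A matrix and its transpose have the same characteristic polynomial, and the transpose of `B` is
  -- `-B`, so the spectrum is symmetric about zero.
  have hneg : m.map (fun t => -t) = m := by
    apply Multiset.map_injective hinj
    rw [hm, Multiset.map_map, Multiset.map_map, Multiset.map_map]
    have := hrootsB'.symm.trans hrootsB
    simpa [Function.comp_def] using this
  have heig : ∀ l, M.mulVec (fun i => (U : Matrix (Fin (2 * n)) (Fin (2 * n)) ℂ) i l) =
      (θ l : ℂ) • fun i => (U : Matrix (Fin (2 * n)) (Fin (2 * n)) ℂ) i l := by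
    intro l
    have := hherm.mulVec_eigenvectorBasis l
    have h2 : (hherm.eigenvectorBasis l).ofLp = fun i => (U : Matrix (Fin (2 * n)) (Fin (2 * n)) ℂ) i l := by
      ext i; simp [hU, Matrix.IsHermitian.eigenvectorUnitary_apply]
    rw [h2] at this
    rw [this]; ext i; simp [hθ]
  have hunit : ∀ l, ∑ j, (U : Matrix (Fin (2 * n)) (Fin (2 * n)) ℂ) j l * starRingEnd ℂ ((U : Matrix (Fin (2 * n)) (Fin (2 * n)) ℂ) j l) = 1 := by
    intro l
    have := congrFun (congrFun hUU' l) l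
    rw [Matrix.mul_apply] at this
    simpa [mul_comm] using this
  have hB_eig : ∀ l j, ∑ k, (B j k : ℂ) * (U : Matrix (Fin (2 * n)) (Fin (2 * n)) ℂ) k l =
      Complex.I * θ l * (U : Matrix (Fin (2 * n)) (Fin (2 * n)) ℂ) j l := by
    intro l j
    have h1 : Bc.mulVec (fun i => (U : Matrix (Fin (2 * n)) (Fin (2 * n)) ℂ) i l) j =
        Complex.I * θ l * (U : Matrix (Fin (2 * n)) (Fin (2 * n)) ℂ) j l := by
      rw [hBM, Matrix.smul_mulVec, heig]
      simp [mul_assoc]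
    rw [← h1]
    simp [Matrix.mulVec, dotProduct, hBc]
  have hinjB : Function.Injective Bc.mulVec := by
    have hunitB : IsUnit B := by
      rw [← Matrix.mulVec_surjective_iff_isUnit]
      have h1 : LinearMap.range B.mulVecLin = ⊤ := by
        apply Submodule.eq_top_of_finrank_eq
        rw [← Matrix.rank, hrank]; simp
      exact LinearMap.range_eq_top.mp h1
    have : IsUnit Bc := by
      have := hunitB.map (Complex.ofRealHom.mapMatrix (m := Fin (2 * n)))
      exact this
    exact Matrix.mulVec_injective_iff_isUnit.mpr this
  have hne : ∀ l, θ l ≠ 0 := by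
    intro l hl
    have h0 : Bc.mulVec (fun i => (U : Matrix (Fin (2 * n)) (Fin (2 * n)) ℂ) i l) = Bc.mulVec 0 := by
      rw [hBM, Matrix.smul_mulVec, heig, hl]; simp
    have h1 := hinjB h0
    have h2 := hunit l
    have h3 : ∀ j, (U : Matrix (Fin (2 * n)) (Fin (2 * n)) ℂ) j l = 0 := fun j => congrFun h1 j
    simp [h3] at h2
  have h0m : (0 : ℝ) ∉ m := by
    simp only [hm, Multiset.mem_map, not_exists, not_and]
    intro l _; exact hne l
  have hdecomp := multiset_eq_pos_add_neg hneg h0m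
  set p := m.filter (fun t => 0 < t) with hp
  have hcard : p.card = n := by
    have h1 : m.card = p.card + p.card := by
      conv_lhs => rw [hdecomp, Multiset.card_add, Multiset.card_map]
    have h2 : m.card = 2 * n := by simp [hm]
    omega
  obtain ⟨a, ha⟩ := exists_fin_map_eq_multiset p hcard
  have hmem : ∀ t ∈ p, ∃ j, t = a j := by
    intro t ht
    rw [← ha, Multiset.mem_map] at ht
    obtain ⟨j, _, hj⟩ := ht
    exact ⟨j, hj.symm⟩
  refine ⟨a, θ, fun l j => (U : Matrix (Fin (2 * n)) (Fin (2 * n)) ℂ) j l, ⟨?_, ?_⟩, ⟨hne, hB_eig, hunit, ?_⟩, ?_, ?_⟩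
  · intro j
    have : a j ∈ p := by rw [← ha]; exact Multiset.mem_map_of_mem _ (Finset.mem_univ j)
    exact (Multiset.mem_filter.mp this).2
  · change Bc.charpoly.roots = _
    have h1 : Bc.charpoly.roots = m.map (fun t : ℝ => Complex.I * (t : ℂ)) := by
      rw [hrootsB, hm, Multiset.map_map]; rfl
    rw [h1, hdecomp, Multiset.map_add, ← ha]
    simp [Function.comp_def]
  · intro j k
    have := congrFun (congrFun hUU j) k
    rw [Matrix.mul_apply] at this
    simpa [Matrix.one_apply] using this
  · intro l
    rcases lt_or_gt_of_ne (hne l) with h | h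
    · rw [abs_of_neg h]
      apply hmem
      refine Multiset.mem_filter.mpr ⟨?_, by linarith⟩
      rw [← hneg, hm]
      exact Multiset.mem_map_of_mem (fun t : ℝ => -t)
        (Multiset.mem_map_of_mem _ (Finset.mem_univ l))
    · rw [abs_of_pos h]
      exact hmem _ (Multiset.mem_filter.mpr
        ⟨Multiset.mem_map_of_mem _ (Finset.mem_univ l), h⟩)
  -- Only the negative eigenvalues contribute to the left side, and by the symmetry these are the
  -- numbers `-a j`.
  · have h1 : ∑ l, max (-θ l) 0 = (m.map (fun t => max (-t) 0)).sum := by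
      rw [hm, Multiset.map_map]; rfl
    have h2 : ∑ j, a j = p.sum := by rw [← ha]; rfl
    rw [h1, h2, hdecomp, Multiset.map_add, Multiset.sum_add, Multiset.map_map]
    have h3 : p.map (fun t => max (-t) 0) = p.map (fun _ => (0 : ℝ)) := by
      apply Multiset.map_congr rfl
      intro t ht
      have := (Multiset.mem_filter.mp ht).2
      exact max_eq_right (by linarith)
    have h4 : p.map ((fun t => max (-t) 0) ∘ fun t : ℝ => -t) = p.map id := by
      apply Multiset.map_congr rfl
      intro t ht
      have := (Multiset.mem_filter.mp ht).2
      simp only [Function.comp, neg_neg, id]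
      exact max_eq_left this.le
    rw [h3, h4]; simp

end

/-! ### The absolute value of an antisymmetric matrix -/

section

open scoped MatrixOrder in
/-- The matrix `S = ½ (Bᵀ B)^{1/2}` attached to an invertible real antisymmetric matrix `B`. -/
lemma exists_half_abs {d : ℕ} {B : Matrix (Fin d) (Fin d) ℝ}
    (hanti : B.transpose = -B) (hunit : IsUnit B) :
    ∃ S : Matrix (Fin d) (Fin d) ℝ, (∀ j k, S j k = S k j) ∧
      (∃ c > 0, ∀ x : EuclideanSpace ℝ (Fin d), c * ‖x‖ ^ 2 ≤ ∑ j, x j * ∑ k, S j k * x k) ∧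
      ∀ (t : ℝ) (v : Fin d → ℂ), 0 < t → (∀ j, ∑ k, (B j k : ℂ) * v k = Complex.I * t * v j) →
        ∀ j, ∑ k, (S j k : ℂ) * v k = t / 2 * v j := by
  have hR : (B.conjTranspose * B).PosSemidef := Matrix.posSemidef_conjTranspose_mul_self B
  set S₀ := CFC.sqrt (B.conjTranspose * B) with hS₀
  have hsq : S₀ * S₀ = B.conjTranspose * B :=
    CFC.sqrt_mul_sqrt_self _ (Matrix.nonneg_iff_posSemidef.mpr hR)
  have hpsd : S₀.PosSemidef := Matrix.nonneg_iff_posSemidef.mp (CFC.sqrt_nonneg _)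
  have hBt : B.conjTranspose = -B := by
    rw [← hanti]; ext i j; simp
  have hS₀unit : IsUnit S₀ := by
    have h1 : IsUnit (S₀ * S₀) := by
      rw [hsq, hBt]; exact hunit.neg.mul hunit
    rw [Matrix.isUnit_iff_isUnit_det] at h1 ⊢
    rw [Matrix.det_mul] at h1
    exact isUnit_of_mul_isUnit_left h1
  have hpd : S₀.PosDef := hpsd.posDef_iff_isUnit.mpr hS₀unit
  have hsymm : ∀ j k, S₀ j k = S₀ k j := fun j k => by
    have := congrFun (congrFun hpd.isHermitian k) j
    simpa using this
  have hquad : ∀ x : EuclideanSpace ℝ (Fin d), x ≠ 0 → 0 < ∑ j, x j * ∑ k, S₀ j k * x k := by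
    intro x hx
    have := hpd.dotProduct_mulVec_pos (x := x.ofLp) (by simpa using hx)
    simpa [dotProduct, Matrix.mulVec] using this
  have hlower : ∃ c > 0, ∀ x : EuclideanSpace ℝ (Fin d),
      c * ‖x‖ ^ 2 ≤ ∑ j, x j * ∑ k, S₀ j k * x k := by
    have hcont : Continuous fun x : EuclideanSpace ℝ (Fin d) => ∑ j, x j * ∑ k, S₀ j k * x k := by
      fun_prop
    -- The constant is the minimum of the quadratic form on the unit sphere. In dimension zero the
    -- sphere is empty and any constant works.
    rcases (Metric.sphere (0 : EuclideanSpace ℝ (Fin d)) 1).eq_empty_or_nonempty with he | hne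
    · refine ⟨1, one_pos, fun x => ?_⟩
      have hx : x = 0 := by
        by_contra hx
        have : ‖x‖⁻¹ • x ∈ Metric.sphere (0 : EuclideanSpace ℝ (Fin d)) 1 := by
          simp [norm_smul, norm_ne_zero_iff.mpr hx]
        simp [he] at this
      simp [hx]
    · obtain ⟨z, hz, hmin⟩ := (isCompact_sphere (0 : EuclideanSpace ℝ (Fin d)) 1).exists_isMinOn
        hne hcont.continuousOn
      have hz1 : ‖z‖ = 1 := by simpa using hz
      refine ⟨_, hquad z (fun h => by simp [h] at hz1), fun x => ?_⟩
      by_cases hx : x = 0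
      · simp [hx]
      have hx0 : ‖x‖ ≠ 0 := norm_ne_zero_iff.mpr hx
      have h1 := hmin (show ‖x‖⁻¹ • x ∈ Metric.sphere (0 : EuclideanSpace ℝ (Fin d)) 1 by
        simp [norm_smul, hx0])
      simp only [Set.mem_ofPred_eq] at h1
      have h2 : ∑ j, (‖x‖⁻¹ • x) j * ∑ k, S₀ j k * (‖x‖⁻¹ • x) k =
          (‖x‖ ^ 2)⁻¹ * ∑ j, x j * ∑ k, S₀ j k * x k := by
        rw [Finset.mul_sum]
        refine Finset.sum_congr rfl fun j _ => ?_
        have : ∑ k, S₀ j k * (‖x‖⁻¹ • x) k = ‖x‖⁻¹ * ∑ k, S₀ j k * x k := by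
          rw [Finset.mul_sum]
          refine Finset.sum_congr rfl fun k _ => ?_
          simp only [PiLp.smul_apply, smul_eq_mul]; ring
        rw [this]
        simp only [PiLp.smul_apply, smul_eq_mul]
        field_simp
      rw [h2] at h1
      calc _ ≤ (‖x‖ ^ 2)⁻¹ * (∑ j, x j * ∑ k, S₀ j k * x k) * ‖x‖ ^ 2 := by gcongr
        _ = _ := by field_simp
  obtain ⟨c, hc, hcx⟩ := hlower
  refine ⟨(1 / 2 : ℝ) • S₀, fun j k => by simp [hsymm j k], ⟨c / 2, by positivity, fun x => ?_⟩, ?_⟩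
  · have h1 : ∑ j, x j * ∑ k, ((1 / 2 : ℝ) • S₀) j k * x k =
        1 / 2 * ∑ j, x j * ∑ k, S₀ j k * x k := by
      rw [Finset.mul_sum]
      refine Finset.sum_congr rfl fun j _ => ?_
      simp only [Matrix.smul_apply, smul_eq_mul, mul_assoc, ← Finset.mul_sum]
      ring
    rw [h1]
    have := hcx x
    linarith
  · intro t v ht hv
    let cm : Matrix (Fin d) (Fin d) ℝ →+* Matrix (Fin d) (Fin d) ℂ :=
      Complex.ofRealHom.mapMatrix
    have hBv : (cm B).mulVec v = (Complex.I * t) • v := by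
      ext j; simpa [cm, Matrix.mulVec, dotProduct] using hv j
    have hSS : (cm S₀).mulVec ((cm S₀).mulVec v) = ((t : ℂ) ^ 2) • v := by
      rw [Matrix.mulVec_mulVec, ← map_mul, hsq, hBt, map_mul, map_neg, ← Matrix.mulVec_mulVec, hBv,
        Matrix.mulVec_smul, Matrix.neg_mulVec, hBv, smul_neg, smul_smul, ← neg_smul]
      congr 1
      linear_combination (-(t : ℂ) ^ 2) * Complex.I_sq
    -- Since `S₀² v = -B² v = t² v`, the vector `(S₀ - t) v` is annihilated by `S₀ + t`, which is
    -- positive definite and hence injective.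
    have hpd' : (S₀ + t • (1 : Matrix (Fin d) (Fin d) ℝ)).PosDef :=
      Matrix.PosDef.posSemidef_add hpsd (Matrix.PosDef.one.smul ht)
    have hinj : Function.Injective (cm (S₀ + t • (1 : Matrix (Fin d) (Fin d) ℝ))).mulVec :=
      Matrix.mulVec_injective_iff_isUnit.mpr (hpd'.isUnit.map cm)
    have hcm : ∀ y : Fin d → ℂ, (cm (S₀ + t • (1 : Matrix (Fin d) (Fin d) ℝ))).mulVec y =
        (cm S₀).mulVec y + (t : ℂ) • y := by
      intro y
      have : cm (t • (1 : Matrix (Fin d) (Fin d) ℝ)) = (t : ℂ) • 1 := by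
        ext i j
        by_cases hij : i = j <;> simp [cm, hij]
      rw [map_add, Matrix.add_mulVec, this, Matrix.smul_mulVec, Matrix.one_mulVec]
    have hzero : (cm S₀).mulVec v - (t : ℂ) • v = 0 := by
      apply hinj
      rw [hcm, Matrix.mulVec_zero, Matrix.mulVec_sub, hSS, Matrix.mulVec_smul, smul_sub, smul_smul,
        ← sq]
      abel
    intro j
    have h1 := congrFun (sub_eq_zero.mp hzero) j
    simp only [cm, Matrix.mulVec, dotProduct, Pi.smul_apply, smul_eq_mul,
      RingHom.mapMatrix_apply, Matrix.map_apply, Complex.ofRealHom_eq_coe] at h1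
    simp only [Matrix.smul_apply, smul_eq_mul, Complex.ofReal_mul, mul_assoc, ← Finset.mul_sum, h1]
    push_cast; ring

end

/-! ### Magnetic momenta acting on polynomials -/

section

open MvPolynomial

/-- Partial derivatives of polynomials commute. -/
lemma pderiv_comm {σ : Type*} (i j : σ) (p : MvPolynomial σ ℂ) :
    pderiv i (pderiv j p) = pderiv j (pderiv i p) := by
  -- The commutator of two derivations is a derivation, so it is enough that it vanishes on the
  -- variables.
  have h : ⁅(pderiv i : Derivation ℂ (MvPolynomial σ ℂ) (MvPolynomial σ ℂ)),
      (pderiv j : Derivation ℂ (MvPolynomial σ ℂ) (MvPolynomial σ ℂ))⁆ = 0 := by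
    classical
    apply MvPolynomial.derivation_ext
    intro k
    rw [Derivation.commutator_apply]
    simp only [pderiv_X, Pi.single_apply, Derivation.coe_zero, Pi.zero_apply]
    split_ifs <;> simp
  have := DFunLike.congr_fun h p
  rw [Derivation.commutator_apply] at this
  exact sub_eq_zero.mp this

/-- The operator `(ħ/i) ∂_j + ∑_k N_{jk} x_k` on polynomials. -/
def polyMomentum {d : ℕ} (ħ : ℝ) (N : Matrix (Fin d) (Fin d) ℂ) (j : Fin d) :
    MvPolynomial (Fin d) ℂ →ₗ[ℂ] MvPolynomial (Fin d) ℂ :=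
  ((ħ : ℂ) / Complex.I) • (pderiv j : Derivation ℂ _ _).toLinearMap +
    LinearMap.mulLeft ℂ (∑ k, N j k • X k)

lemma polyMomentum_apply {d : ℕ} (ħ : ℝ) (N : Matrix (Fin d) (Fin d) ℂ) (j : Fin d)
    (p : MvPolynomial (Fin d) ℂ) :
    polyMomentum ħ N j p = ((ħ : ℂ) / Complex.I) • pderiv j p + (∑ k, N j k • X k) * p := rfl

/-- The operator `∑_j v_j ((ħ/i) ∂_j + ∑_k N_{jk} x_k)` on polynomials. -/
def polyMomentumDir {d : ℕ} (ħ : ℝ) (N : Matrix (Fin d) (Fin d) ℂ) (v : Fin d → ℂ) :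
    MvPolynomial (Fin d) ℂ →ₗ[ℂ] MvPolynomial (Fin d) ℂ :=
  ∑ j, v j • polyMomentum ħ N j

lemma polyMomentumDir_apply {d : ℕ} (ħ : ℝ) (N : Matrix (Fin d) (Fin d) ℂ) (v : Fin d → ℂ)
    (p : MvPolynomial (Fin d) ℂ) :
    polyMomentumDir ħ N v p = ∑ j, v j • polyMomentum ħ N j p := by
  simp [polyMomentumDir]

/-- The sum of the squares of the operators `(ħ/i) ∂_j + ∑_k N_{jk} x_k` on polynomials. -/
def polyHamiltonian {d : ℕ} (ħ : ℝ) (N : Matrix (Fin d) (Fin d) ℂ) :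
    MvPolynomial (Fin d) ℂ →ₗ[ℂ] MvPolynomial (Fin d) ℂ :=
  ∑ j, polyMomentum ħ N j ∘ₗ polyMomentum ħ N j

lemma polyHamiltonian_apply {d : ℕ} (ħ : ℝ) (N : Matrix (Fin d) (Fin d) ℂ)
    (p : MvPolynomial (Fin d) ℂ) :
    polyHamiltonian ħ N p = ∑ j, polyMomentum ħ N j (polyMomentum ħ N j p) := by
  simp [polyHamiltonian]

/-- Derivatives commute with each other, and so do multiplications. What remains is the derivatives
of the two linear forms, which are constants; the commutator is therefore a scalar. -/
lemma polyMomentum_comm {d : ℕ} (ħ : ℝ) (N : Matrix (Fin d) (Fin d) ℂ) (j k : Fin d)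
    (p : MvPolynomial (Fin d) ℂ) :
    polyMomentum ħ N j (polyMomentum ħ N k p) = polyMomentum ħ N k (polyMomentum ħ N j p) +
      ((ħ : ℂ) / Complex.I * (N k j - N j k)) • p := by
  have hder : ∀ i k : Fin d, pderiv i (∑ l, N k l • X l : MvPolynomial (Fin d) ℂ) = C (N k i) := by
    intro i k
    classical
    rw [map_sum, Finset.sum_eq_single i]
    · rw [Derivation.map_smul, pderiv_X_self, smul_eq_C_mul, mul_one]
    · intro l _ hl
      rw [Derivation.map_smul, pderiv_X_of_ne hl, smul_zero]
    · simp
  simp only [polyMomentum_apply, map_add, Derivation.leibniz, Derivation.map_smul, hder,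
    pderiv_comm k j p, smul_eq_mul]
  simp only [smul_eq_C_mul, map_sub, map_mul]
  ring

/-- Lowering along `v`: differentiation decreases the degree of polynomials. -/
lemma pderiv_mem_restrictTotalDegree {d : ℕ} (j : Fin d) {m : ℕ} {p : MvPolynomial (Fin d) ℂ}
    (hp : p ∈ restrictTotalDegree (Fin d) ℂ (m + 1)) :
    pderiv j p ∈ restrictTotalDegree (Fin d) ℂ m := by
  classical
  rw [mem_restrictTotalDegree] at hp
  rw [p.as_sum, map_sum]
  refine Submodule.sum_mem _ fun s hs => ?_
  rw [pderiv_monomial, mem_restrictTotalDegree]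
  by_cases h0 : s j = 0
  · simp [h0]
  refine (totalDegree_monomial_le _ _).trans ?_
  have h1 : s.sum (fun _ e => e) ≤ m + 1 := (le_totalDegree hs).trans hp
  have h2 : s = (s - Finsupp.single j 1) + Finsupp.single j 1 := by
    ext i
    by_cases hi : i = j
    · subst hi; simp; omega
    · simp [Ne.symm hi]
  rw [h2, Finsupp.sum_add_index' (fun _ => rfl) (fun _ _ _ => rfl),
    Finsupp.sum_single_index rfl] at h1
  change (s - Finsupp.single j 1).sum (fun _ e => e) ≤ m
  omega

lemma pderiv_eq_zero_of_mem_restrictTotalDegree_zero {d : ℕ} (j : Fin d)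
    {p : MvPolynomial (Fin d) ℂ} (hp : p ∈ restrictTotalDegree (Fin d) ℂ 0) :
    pderiv j p = 0 := by
  rw [mem_restrictTotalDegree, Nat.le_zero, totalDegree_eq_zero_iff_eq_C] at hp
  rw [hp, pderiv_C]

lemma polyMomentum_mem_restrictTotalDegree {d : ℕ} (ħ : ℝ) (N : Matrix (Fin d) (Fin d) ℂ)
    (j : Fin d) {m : ℕ} {p : MvPolynomial (Fin d) ℂ}
    (hp : p ∈ restrictTotalDegree (Fin d) ℂ m) :
    polyMomentum ħ N j p ∈ restrictTotalDegree (Fin d) ℂ (m + 1) := by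
  rw [polyMomentum_apply]
  refine Submodule.add_mem _ (Submodule.smul_mem _ _ ?_) ?_
  · apply pderiv_mem_restrictTotalDegree
    rw [mem_restrictTotalDegree] at hp ⊢
    omega
  · rw [Finset.sum_mul]
    refine Submodule.sum_mem _ fun k _ => ?_
    rw [smul_mul_assoc]
    refine Submodule.smul_mem _ _ ?_
    rw [mem_restrictTotalDegree] at hp ⊢
    refine (totalDegree_mul _ _).trans ?_
    rw [totalDegree_X]
    omega

/-- A direction `v` in which `∑_j v_j ((ħ/i) ∂_j + ∑_k N_{jk} x_k)` is `(ħ/i) ∂_v`. -/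
lemma polyMomentumDir_eq_pderiv {d : ℕ} (ħ : ℝ) {N : Matrix (Fin d) (Fin d) ℂ} {v : Fin d → ℂ}
    (hv : ∀ k, ∑ j, v j * N j k = 0) (p : MvPolynomial (Fin d) ℂ) :
    polyMomentumDir ħ N v p = ((ħ : ℂ) / Complex.I) • ∑ j, v j • pderiv j p := by
  have h1 : (∑ j, v j • ∑ k, N j k • X k : MvPolynomial (Fin d) ℂ) = 0 := by
    simp only [Finset.smul_sum, smul_smul]
    rw [Finset.sum_comm]
    simp only [← Finset.sum_smul, hv, zero_smul, Finset.sum_const_zero]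
  have h2 : (∑ j, v j • ((∑ k, N j k • X k) * p) : MvPolynomial (Fin d) ℂ) = 0 := by
    simp only [← smul_mul_assoc]
    rw [← Finset.sum_mul, h1, zero_mul]
  rw [polyMomentumDir_apply]
  simp only [polyMomentum_apply, smul_add, Finset.sum_add_distrib, h2, add_zero, Finset.smul_sum]
  exact Finset.sum_congr rfl fun j _ => smul_comm _ _ _

end

/-! ### Ladder operators and the eigenvalues of the polynomial model -/

section

open MvPolynomial

/-- This is the relation `[P_j, P_k] = i ħ B_{jk}`. It depends only on the antisymmetric part of
`N`; the symmetric part stays free and is fixed later by the choice of the Gaussian. -/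
lemma polyMomentum_comm_field {d : ℕ} (ħ : ℝ) {N : Matrix (Fin d) (Fin d) ℂ}
    {B : Matrix (Fin d) (Fin d) ℝ} (hN : ∀ j k, N k j - N j k = -(B j k : ℂ)) (j k : Fin d)
    (p : MvPolynomial (Fin d) ℂ) :
    polyMomentum ħ N j (polyMomentum ħ N k p) = polyMomentum ħ N k (polyMomentum ħ N j p) +
      (Complex.I * ħ * B j k) • p := by
  rw [polyMomentum_comm, hN]
  congr 2
  rw [div_eq_mul_inv, Complex.inv_I]
  ring

/-- The commutator of the operator with the momentum in the direction of an eigenvector of `B`. -/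
lemma polyHamiltonian_polyMomentumDir {d : ℕ} (ħ : ℝ) {N : Matrix (Fin d) (Fin d) ℂ}
    {B : Matrix (Fin d) (Fin d) ℝ} (hN : ∀ j k, N k j - N j k = -(B j k : ℂ)) {t : ℝ}
    {v : Fin d → ℂ} (hv : ∀ j, ∑ k, (B j k : ℂ) * v k = Complex.I * t * v j)
    (p : MvPolynomial (Fin d) ℂ) :
    polyHamiltonian ħ N (polyMomentumDir ħ N v p) =
      polyMomentumDir ħ N v (polyHamiltonian ħ N p) - (2 * ħ * t : ℂ) • polyMomentumDir ħ N v p := by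
  have h1 : ∀ j k, polyMomentum ħ N j (polyMomentum ħ N j (polyMomentum ħ N k p)) =
      polyMomentum ħ N k (polyMomentum ħ N j (polyMomentum ħ N j p)) +
        (2 * (Complex.I * ħ * B j k)) • polyMomentum ħ N j p := by
    intro j k
    rw [polyMomentum_comm_field ħ hN j k p, map_add, map_smul,
      polyMomentum_comm_field ħ hN j k (polyMomentum ħ N j p), two_mul, add_smul, add_assoc]
  have h2 : polyHamiltonian ħ N (polyMomentumDir ħ N v p) =
      ∑ k, ∑ j, v k • polyMomentum ħ N j (polyMomentum ħ N j (polyMomentum ħ N k p)) := by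
    rw [polyHamiltonian_apply, polyMomentumDir_apply, Finset.sum_comm]
    simp only [map_sum, map_smul]
  -- Contracting `[P_j², P_k] = 2 i ħ B_{jk} P_j` with `v` replaces `B v` by `i t v`, and the two
  -- factors `i` give the sign of the shift `-2ħt`.
  have h3 : ∑ k, ∑ j, (v k * (2 * (Complex.I * ħ * B j k))) • polyMomentum ħ N j p =
      -((2 * ħ * t : ℂ) • polyMomentumDir ħ N v p) := by
    rw [Finset.sum_comm, polyMomentumDir_apply, Finset.smul_sum, ← Finset.sum_neg_distrib]
    refine Finset.sum_congr rfl fun j _ => ?_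
    rw [← Finset.sum_smul, smul_smul, ← neg_smul]
    congr 1
    have : ∑ k, v k * (2 * (Complex.I * ħ * B j k)) = 2 * (Complex.I * ħ) * ∑ k, B j k * v k := by
      rw [Finset.mul_sum]
      exact Finset.sum_congr rfl fun k _ => by ring
    rw [this, hv]
    linear_combination (2 * ħ * t * v j : ℂ) * Complex.I_sq
  rw [h2, sub_eq_add_neg, ← h3, polyMomentumDir_apply, ← Finset.sum_add_distrib]
  refine Finset.sum_congr rfl fun k _ => ?_
  rw [polyHamiltonian_apply, map_sum, Finset.smul_sum, ← Finset.sum_add_distrib]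
  refine Finset.sum_congr rfl fun j _ => ?_
  rw [h1, smul_add, smul_smul]

lemma polyMomentumDir_polyMomentumDir {d : ℕ} (ħ : ℝ) (N : Matrix (Fin d) (Fin d) ℂ)
    (v w : Fin d → ℂ) (p : MvPolynomial (Fin d) ℂ) :
    polyMomentumDir ħ N v (polyMomentumDir ħ N w p) =
      ∑ j, ∑ k, (v j * w k) • polyMomentum ħ N j (polyMomentum ħ N k p) := by
  rw [polyMomentumDir_apply]
  refine Finset.sum_congr rfl fun j _ => ?_
  rw [polyMomentumDir_apply, map_sum, Finset.smul_sum]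
  exact Finset.sum_congr rfl fun k _ => by rw [map_smul, smul_smul]

/-- The direction of the lowering operator attached to the `l`-th eigenvector. -/
def loweringDir {d : ℕ} (θ : Fin d → ℝ) (w : Fin d → Fin d → ℂ) (l : Fin d) : Fin d → ℂ :=
  if 0 < θ l then w l else fun j => starRingEnd ℂ (w l j)

/-- As `B` is real, conjugating an eigenvector changes `i θ` to `-i θ`. This is why the conjugate is
used when `θ l` is negative. -/
lemma SpectralData.eigen_loweringDir {d : ℕ} {B : Matrix (Fin d) (Fin d) ℝ} {θ : Fin d → ℝ}
    {w : Fin d → Fin d → ℂ} (h : SpectralData B θ w) (l j : Fin d) :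
    ∑ k, (B j k : ℂ) * loweringDir θ w l k = Complex.I * (|θ l| : ℝ) * loweringDir θ w l j := by
  unfold loweringDir
  split_ifs with hl
  · rw [abs_of_pos hl]; exact h.eigen l j
  · have hl' : θ l < 0 := lt_of_le_of_ne (not_lt.mp hl) (h.ne_zero l)
    rw [abs_of_neg hl']
    have := congrArg (starRingEnd ℂ) (h.eigen l j)
    simpa [map_sum, map_mul] using this

/-- The ladder decomposition of the operator. -/
lemma polyHamiltonian_eq_sum_lowering {d : ℕ} (ħ : ℝ) {N : Matrix (Fin d) (Fin d) ℂ}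
    {B : Matrix (Fin d) (Fin d) ℝ} (hN : ∀ j k, N k j - N j k = -(B j k : ℂ)) {θ : Fin d → ℝ}
    {w : Fin d → Fin d → ℂ} (h : SpectralData B θ w) (p : MvPolynomial (Fin d) ℂ) :
    polyHamiltonian ħ N p =
      ∑ l, polyMomentumDir ħ N (fun j => starRingEnd ℂ (loweringDir θ w l j))
        (polyMomentumDir ħ N (loweringDir θ w l) p) +
      (ħ * ∑ l, max (-θ l) 0 : ℝ) • p := by
  -- By completeness of the eigenbasis, the sum of squares can be written in the directions `w l`
  -- instead of the coordinate directions.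
  have h1 : polyHamiltonian ħ N p = ∑ l, polyMomentumDir ħ N (fun j => starRingEnd ℂ (w l j))
      (polyMomentumDir ħ N (w l) p) := by
    simp only [polyMomentumDir_polyMomentumDir]
    rw [Finset.sum_comm, polyHamiltonian_apply]
    refine Finset.sum_congr rfl fun j _ => ?_
    rw [Finset.sum_comm, Finset.sum_eq_single j]
    · rw [← Finset.sum_smul]
      have := h.complete j j
      rw [if_pos rfl] at this
      simp only [mul_comm (starRingEnd ℂ _), this, one_smul]
    · intro k _ hk
      have := h.complete k j
      rw [if_neg hk] at this
      rw [← Finset.sum_smul]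
      simp only [mul_comm (starRingEnd ℂ _), this, zero_smul]
    · simp
  rw [h1, Finset.mul_sum, Finset.sum_smul, ← Finset.sum_add_distrib]
  refine Finset.sum_congr rfl fun l _ => ?_
  unfold loweringDir
  split_ifs with hl
  · rw [max_eq_right (by linarith)]; simp
  -- For negative `θ l` the lowering operator is the left factor. Interchanging the two factors puts
  -- it on the right and leaves the scalar `-ħ θ l`.
  · rw [max_eq_left (by linarith)]
    simp only [Complex.conj_conj]
    rw [polyMomentumDir_polyMomentumDir, polyMomentumDir_polyMomentumDir]
    have h2 : ∀ j k : Fin d, (starRingEnd ℂ (w l j) * w l k) •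
        polyMomentum ħ N j (polyMomentum ħ N k p) =
        (w l k * starRingEnd ℂ (w l j)) • polyMomentum ħ N k (polyMomentum ħ N j p) +
        (starRingEnd ℂ (w l j) * w l k * (Complex.I * ħ * B j k)) • p := by
      intro j k
      rw [polyMomentum_comm_field ħ hN j k p, smul_add, smul_smul, mul_comm (w l k)]
    have h5 : ∑ j, ∑ k, (starRingEnd ℂ (w l j) * w l k) •
        polyMomentum ħ N j (polyMomentum ħ N k p) =
        ∑ k, ∑ j, (w l k * starRingEnd ℂ (w l j)) •
          polyMomentum ħ N k (polyMomentum ħ N j p) +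
        ∑ j, ∑ k, (starRingEnd ℂ (w l j) * w l k * (Complex.I * ħ * B j k)) • p := by
      rw [Finset.sum_comm (f := fun k j => (w l k * starRingEnd ℂ (w l j)) •
          polyMomentum ħ N k (polyMomentum ħ N j p)), ← Finset.sum_add_distrib]
      refine Finset.sum_congr rfl fun j _ => ?_
      rw [← Finset.sum_add_distrib]
      exact Finset.sum_congr rfl fun k _ => h2 j k
    rw [h5]
    refine congrArg₂ (· + ·) rfl ?_
    · simp only [← Finset.sum_smul]
      have h3 : ∑ j, ∑ k, starRingEnd ℂ (w l j) * w l k * (Complex.I * ħ * B j k) =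
          ((ħ * -θ l : ℝ) : ℂ) := by
        have : ∀ j, ∑ k, starRingEnd ℂ (w l j) * w l k * (Complex.I * ħ * B j k) =
            (-ħ * θ l : ℂ) * (w l j * starRingEnd ℂ (w l j)) := by
          intro j
          have h4 : ∑ k, starRingEnd ℂ (w l j) * w l k * (Complex.I * ħ * B j k) =
              Complex.I * ħ * starRingEnd ℂ (w l j) * ∑ k, B j k * w l k := by
            rw [Finset.mul_sum]
            exact Finset.sum_congr rfl fun k _ => by ring
          rw [h4, h.eigen]
          linear_combination (ħ * θ l * w l j * starRingEnd ℂ (w l j) : ℂ) * Complex.I_sq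
        simp only [this]
        rw [← Finset.mul_sum, h.unit]
        push_cast; ring
      rw [h3]
      exact Complex.coe_smul _ _

/-- The hypotheses under which the polynomial model of the Landau Hamiltonian is analysed:
`N = i S + ½ B` with `S = ½ |B|`. -/
structure GaugeData {d : ℕ} (B S : Matrix (Fin d) (Fin d) ℝ) (θ : Fin d → ℝ)
    (w : Fin d → Fin d → ℂ) : Prop extends SpectralData B θ w where
  antisymm : ∀ j k, B k j = -B j k
  symm : ∀ j k, S j k = S k j
  half_abs : ∀ (t : ℝ) (v : Fin d → ℂ), 0 < t →
    (∀ j, ∑ k, (B j k : ℂ) * v k = Complex.I * t * v j) → ∀ j, ∑ k, (S j k : ℂ) * v k = t / 2 * v j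

/-- The matrix `N = i S + ½ B`. -/
def gaugeMatrix {d : ℕ} (B S : Matrix (Fin d) (Fin d) ℝ) : Matrix (Fin d) (Fin d) ℂ :=
  Matrix.of fun j k => Complex.I * S j k + B j k / 2

namespace GaugeData

variable {d : ℕ} {B S : Matrix (Fin d) (Fin d) ℝ} {θ : Fin d → ℝ} {w : Fin d → Fin d → ℂ}

lemma gaugeMatrix_sub (h : GaugeData B S θ w) (j k : Fin d) :
    gaugeMatrix B S k j - gaugeMatrix B S j k = -(B j k : ℂ) := by
  simp only [gaugeMatrix, Matrix.of_apply, h.antisymm j k, h.symm j k]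
  push_cast; ring

/-- This is the reason for taking `S = ½|B|`: on a lowering direction `i S v = i t v / 2` and `½ B v
= i t v / 2` cancel, so the momentum along `v` loses its multiplication term and becomes a
derivative. -/
lemma loweringDir_gaugeMatrix (h : GaugeData B S θ w) (l k : Fin d) :
    ∑ j, loweringDir θ w l j * gaugeMatrix B S j k = 0 := by
  have h1 := h.eigen_loweringDir l
  have h2 := h.half_abs _ _ (abs_pos.mpr (h.ne_zero l)) h1 k
  have h3 : ∑ j, loweringDir θ w l j * gaugeMatrix B S j k =
      Complex.I * ∑ j, S k j * loweringDir θ w l j - 1 / 2 * ∑ j, B k j * loweringDir θ w l j := by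
    rw [Finset.mul_sum, Finset.mul_sum, ← Finset.sum_sub_distrib]
    refine Finset.sum_congr rfl fun j _ => ?_
    simp only [gaugeMatrix, Matrix.of_apply, h.antisymm k j, h.symm j k]
    push_cast; ring
  rw [h3, h2, h1]
  ring

lemma lowering_mem (h : GaugeData B S θ w) (ħ : ℝ) (l : Fin d) {m : ℕ}
    {p : MvPolynomial (Fin d) ℂ} (hp : p ∈ restrictTotalDegree (Fin d) ℂ (m + 1)) :
    polyMomentumDir ħ (gaugeMatrix B S) (loweringDir θ w l) p ∈
      restrictTotalDegree (Fin d) ℂ m := by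
  rw [polyMomentumDir_eq_pderiv ħ (h.loweringDir_gaugeMatrix l)]
  exact Submodule.smul_mem _ _ (Submodule.sum_mem _ fun j _ =>
    Submodule.smul_mem _ _ (pderiv_mem_restrictTotalDegree j hp))

lemma lowering_eq_zero (h : GaugeData B S θ w) (ħ : ℝ) (l : Fin d)
    {p : MvPolynomial (Fin d) ℂ} (hp : p ∈ restrictTotalDegree (Fin d) ℂ 0) :
    polyMomentumDir ħ (gaugeMatrix B S) (loweringDir θ w l) p = 0 := by
  rw [polyMomentumDir_eq_pderiv ħ (h.loweringDir_gaugeMatrix l)]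
  simp [pderiv_eq_zero_of_mem_restrictTotalDegree_zero _ hp]

/-- The operator does not increase the degree of polynomials. -/
lemma polyHamiltonian_mem (h : GaugeData B S θ w) (ħ : ℝ) {m : ℕ}
    {p : MvPolynomial (Fin d) ℂ} (hp : p ∈ restrictTotalDegree (Fin d) ℂ m) :
    polyHamiltonian ħ (gaugeMatrix B S) p ∈ restrictTotalDegree (Fin d) ℂ m := by
  rw [polyHamiltonian_eq_sum_lowering ħ h.gaugeMatrix_sub h.toSpectralData]
  refine Submodule.add_mem _ (Submodule.sum_mem _ fun l _ => ?_) ?_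
  · rcases m with _ | m
    · rw [h.lowering_eq_zero ħ l hp, map_zero]
      exact Submodule.zero_mem _
    · rw [polyMomentumDir_apply]
      exact Submodule.sum_mem _ fun j _ => Submodule.smul_mem _ _
        (polyMomentum_mem_restrictTotalDegree ħ _ j (h.lowering_mem ħ l hp))
  · rw [← Complex.coe_smul]
    exact Submodule.smul_mem _ _ hp

/-- The eigenvalues of the polynomial model are the Landau levels. -/
lemma exists_level_of_eigenvector (h : GaugeData B S θ w) (ħ : ℝ) {n : ℕ} {a : Fin n → ℝ}
    (ha : ∀ l, ∃ j, |θ l| = a j) (hsum : ∑ l, max (-θ l) 0 = ∑ j, a j) (m : ℕ) :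
    ∀ (E : ℂ) (p : MvPolynomial (Fin d) ℂ), p ∈ restrictTotalDegree (Fin d) ℂ m → p ≠ 0 →
      polyHamiltonian ħ (gaugeMatrix B S) p = E • p →
      ∃ k : Fin n → ℕ, E = (ħ * ∑ j, (2 * (k j : ℝ) + 1) * a j : ℝ) := by
  -- At the bottom of the ladder only the scalar term of the ladder decomposition survives; it is
  -- the level with all quantum numbers zero.
  have hbottom : ∀ (E : ℂ) (p : MvPolynomial (Fin d) ℂ), p ≠ 0 →
      polyHamiltonian ħ (gaugeMatrix B S) p = E • p →
      (∀ l, polyMomentumDir ħ (gaugeMatrix B S) (loweringDir θ w l) p = 0) →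
      ∃ k : Fin n → ℕ, E = (ħ * ∑ j, (2 * (k j : ℝ) + 1) * a j : ℝ) := by
    intro E p hp hE hl
    refine ⟨fun _ => 0, ?_⟩
    rw [polyHamiltonian_eq_sum_lowering ħ h.gaugeMatrix_sub h.toSpectralData] at hE
    simp only [hl, map_zero, Finset.sum_const_zero, zero_add] at hE
    rw [← Complex.coe_smul] at hE
    have := smul_left_injective ℂ hp hE
    rw [← this, hsum]
    simp
  induction m with
  | zero =>
    intro E p hp hp0 hE
    exact hbottom E p hp0 hE fun l => h.lowering_eq_zero ħ l hp
  | succ m ih =>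
    intro E p hp hp0 hE
    by_cases hl : ∀ l, polyMomentumDir ħ (gaugeMatrix B S) (loweringDir θ w l) p = 0
    · exact hbottom E p hp0 hE hl
    · push Not at hl
      obtain ⟨l, hl⟩ := hl
      have h1 := polyHamiltonian_polyMomentumDir ħ h.gaugeMatrix_sub (h.eigen_loweringDir l) p
      rw [hE, map_smul, ← sub_smul] at h1
      obtain ⟨k, hk⟩ := ih _ _ (h.lowering_mem ħ l hp) hl h1
      obtain ⟨j, hj⟩ := ha l
      -- The lowered polynomial has eigenvalue `E - 2ħ|θ l|`, so `E` is one step higher in a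
      -- coordinate `j` with `a j = |θ l|`.
      refine ⟨Function.update k j (k j + 1), ?_⟩
      have h2 : ∑ i, (2 * ((Function.update k j (k j + 1) i : ℕ) : ℝ) + 1) * a i =
          ∑ i, (2 * (k i : ℝ) + 1) * a i + 2 * a j := by
        rw [← Finset.add_sum_erase _ _ (Finset.mem_univ j),
          ← Finset.add_sum_erase Finset.univ (fun i => (2 * (k i : ℝ) + 1) * a i)
            (Finset.mem_univ j)]
        have : ∑ i ∈ Finset.univ.erase j, (2 * ((Function.update k j (k j + 1) i : ℕ) : ℝ) + 1) *
            a i = ∑ i ∈ Finset.univ.erase j, (2 * (k i : ℝ) + 1) * a i := by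
          refine Finset.sum_congr rfl fun i hi => ?_
          rw [Function.update_of_ne (Finset.ne_of_mem_erase hi)]
        rw [this, Function.update_self]
        push_cast; ring
      rw [h2, mul_add, Complex.ofReal_add, ← hk, hj]
      push_cast; ring

end GaugeData

end

/-! ### A lower bound from finite-dimensional invariant subspaces -/

section

open scoped InnerProductSpace

/-- A weak lower bound for a symmetric operator that leaves invariant an exhausting family of
finite-dimensional subspaces. -/
lemma mul_norm_le_of_invariant_subspaces {𝓗 M : Type*} [NormedAddCommGroup 𝓗]
    [InnerProductSpace ℂ 𝓗] [AddCommGroup M] [Module ℂ M] (ι : M →ₗ[ℂ] 𝓗)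
    (hι : Function.Injective ι) (T : M →ₗ[ℂ] M) (F : ℕ → Submodule ℂ M)
    [∀ m, Module.Finite ℂ (F m)] (hF : ∀ m, ∀ p ∈ F m, T p ∈ F m)
    (hT : ∀ p q, ⟪ι (T p), ι q⟫_ℂ = ⟪ι p, ι (T q)⟫_ℂ) {μ D : ℝ} (hD : 0 ≤ D)
    (heig : ∀ m, ∀ (e : ℝ) (p : M), p ∈ F m → p ≠ 0 → T p = (e : ℂ) • p → D ≤ |e - μ|)
    {U H : 𝓗} (hUH : ∀ p, ⟪ι p, H⟫_ℂ = ⟪ι (T p) - (μ : ℂ) • ι p, U⟫_ℂ)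
    (hdense : ∀ ε > 0, ∃ m, ∃ p ∈ F m, ‖U - ι p‖ < ε) : D * ‖U‖ ≤ ‖H‖ := by
  -- The bound is first proved for the orthogonal projection of `U` onto the image of `F m`. The
  -- rest of `U` is no longer than `U - ι p`, because the projection is the nearest point.
  have key : ∀ m, ∀ p ∈ F m, D * ‖U‖ ≤ ‖H‖ + D * ‖U - ι p‖ := by
    intro m p hp
    set W : Submodule ℂ 𝓗 := (F m).map ι with hW
    have hfin : FiniteDimensional ℂ W := Module.Finite.map _ _
    have hTW : ∀ x : W, ∃ q ∈ F m, ι q = x := fun x => by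
      obtain ⟨q, hq, hqx⟩ := Submodule.mem_map.mp x.2
      exact ⟨q, hq, hqx⟩
    let e : F m ≃ₗ[ℂ] W := Submodule.equivMapOfInjective ι hι (F m)
    have he : ∀ x : F m, (e x : 𝓗) = ι x := fun x => rfl
    let T' : W →ₗ[ℂ] W := e.toLinearMap ∘ₗ (T.restrict (hF m)) ∘ₗ e.symm.toLinearMap
    have hT' : ∀ x : F m, T' (e x) = e (T.restrict (hF m) x) := fun x => by
      simp [T']
    have hsymm : T'.IsSymmetric := by
      intro x y
      obtain ⟨x, rfl⟩ := e.surjective x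
      obtain ⟨y, rfl⟩ := e.surjective y
      rw [hT', hT', Submodule.coe_inner, Submodule.coe_inner, he, he, he, he]
      exact hT x y
    let b := hsymm.eigenvectorBasis rfl
    let ev := hsymm.eigenvalues rfl
    -- `H` is the weak image of `U` under `T - μ`. Testing it against an eigenvector multiplies the
    -- coefficient of `U` by `ev i - μ`, of modulus at least `D`.
    have hb : ∀ i, ⟪(b i : 𝓗), H⟫_ℂ = ((ev i - μ : ℝ) : ℂ) * ⟪(b i : 𝓗), U⟫_ℂ ∧
        D ≤ |ev i - μ| := by
      intro i
      obtain ⟨q, hq⟩ := e.surjective (b i)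
      have h1 : T' (b i) = (ev i : ℂ) • b i := hsymm.apply_eigenvectorBasis rfl i
      rw [← hq, hT', ← map_smul] at h1
      have h2 : T (q : M) = (ev i : ℂ) • (q : M) := congrArg Subtype.val (e.injective h1)
      have hq0 : (q : M) ≠ 0 := by
        intro h0
        have : q = 0 := Subtype.ext h0
        rw [this, map_zero] at hq
        exact b.orthonormal.ne_zero i hq.symm
      refine ⟨?_, heig m _ _ q.2 hq0 h2⟩
      rw [← hq, he, hUH, h2, map_smul, ← sub_smul, inner_smul_left]
      congr 1
      simp
    have hon : Orthonormal ℂ fun i => (b i : 𝓗) :=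
      b.orthonormal.comp_linearIsometry W.subtypeₗᵢ
    -- Parseval's identity in the finite-dimensional space for `U`, Bessel's inequality for `H`.
    have h1 : D ^ 2 * ‖W.starProjection U‖ ^ 2 ≤ ‖H‖ ^ 2 := by
      have h2 : ‖W.starProjection U‖ ^ 2 = ∑ i, ‖⟪(b i : 𝓗), U⟫_ℂ‖ ^ 2 := by
        rw [Submodule.starProjection_apply, ← Submodule.coe_norm, ← b.sum_sq_norm_inner_right]
        refine Finset.sum_congr rfl fun i _ => ?_
        rw [Submodule.inner_orthogonalProjectionOnto_eq_of_mem_left]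
      rw [h2, Finset.mul_sum]
      refine le_trans (Finset.sum_le_sum fun i _ => ?_)
        (hon.sum_inner_products_le (x := H) (s := Finset.univ))
      rw [(hb i).1, norm_mul, mul_pow, Complex.norm_real, Real.norm_eq_abs]
      gcongr
      exact (hb i).2
    have h3 : D * ‖W.starProjection U‖ ≤ ‖H‖ := by
      rw [← mul_pow] at h1
      exact le_of_sq_le_sq h1 (norm_nonneg _)
    have h4 : ‖U - W.starProjection U‖ ≤ ‖U - ι p‖ := by
      rw [Submodule.starProjection_minimal]
      exact ciInf_le ⟨0, by rintro _ ⟨x, rfl⟩; positivity⟩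
        (⟨ι p, Submodule.mem_map_of_mem hp⟩ : W)
    have h5 : ‖U‖ ≤ ‖W.starProjection U‖ + ‖U - W.starProjection U‖ := by
      have := norm_add_le (W.starProjection U) (U - W.starProjection U)
      rwa [add_sub_cancel] at this
    calc D * ‖U‖ ≤ D * (‖W.starProjection U‖ + ‖U - ι p‖) := by gcongr; linarith
      _ ≤ _ := by rw [mul_add]; linarith
  refine le_of_forall_pos_le_add fun ε hε => ?_
  -- The denominator is `D + 1` because `D` may vanish.
  obtain ⟨m, p, hp, h⟩ := hdense (ε / (D + 1)) (by positivity)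
  refine (key m p hp).trans ?_
  have : D * ‖U - ι p‖ ≤ (D + 1) * (ε / (D + 1)) := by
    apply mul_le_mul (by linarith) h.le (norm_nonneg _) (by linarith)
  rw [mul_div_cancel₀ _ (by positivity)] at this
  linarith

end

/-! ### Calculus of partial derivatives and symmetry of the momenta -/

section

variable {d : ℕ}

lemma partialDeriv_add {F : Type*} [NormedAddCommGroup F] [NormedSpace ℝ F] {j : Fin d}
    {f g : EuclideanSpace ℝ (Fin d) → F} {x : EuclideanSpace ℝ (Fin d)} (hf : DifferentiableAt ℝ f x) (hg : DifferentiableAt ℝ g x) :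
    partialDeriv j (fun y => f y + g y) x = partialDeriv j f x + partialDeriv j g x := by
  unfold partialDeriv
  rw [fderiv_fun_add hf hg]; rfl

lemma partialDeriv_mul {𝕜 : Type*} [NormedCommRing 𝕜] [NormedAlgebra ℝ 𝕜] {j : Fin d}
    {f g : EuclideanSpace ℝ (Fin d) → 𝕜} {x : EuclideanSpace ℝ (Fin d)} (hf : DifferentiableAt ℝ f x) (hg : DifferentiableAt ℝ g x) :
    partialDeriv j (fun y => f y * g y) x =
      partialDeriv j f x * g x + f x * partialDeriv j g x := by
  unfold partialDeriv
  rw [fderiv_fun_mul hf hg]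
  simp only [add_apply, smul_apply, smul_eq_mul]
  ring

lemma partialDeriv_const {F : Type*} [NormedAddCommGroup F] [NormedSpace ℝ F] (j : Fin d)
    (c : F) (x : EuclideanSpace ℝ (Fin d)) : partialDeriv j (fun _ => c) x = 0 := by
  simp [partialDeriv]

lemma partialDeriv_const_mul {j : Fin d} {f : EuclideanSpace ℝ (Fin d) → ℂ} {x : EuclideanSpace ℝ (Fin d)} (c : ℂ)
    (hf : DifferentiableAt ℝ f x) :
    partialDeriv j (fun y => c * f y) x = c * partialDeriv j f x := by
  rw [partialDeriv_mul (differentiableAt_const c) hf, partialDeriv_const]; ring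

lemma partialDeriv_ofReal {j : Fin d} {f : EuclideanSpace ℝ (Fin d) → ℝ} {x : EuclideanSpace ℝ (Fin d)} (hf : DifferentiableAt ℝ f x) :
    partialDeriv j (fun y => (f y : ℂ)) x = ((partialDeriv j f x : ℝ) : ℂ) := by
  unfold partialDeriv
  have := Complex.ofRealCLM.hasFDerivAt.comp x hf.hasFDerivAt
  have h2 : fderiv ℝ (fun y => (f y : ℂ)) x = Complex.ofRealCLM.comp (fderiv ℝ f x) := this.fderiv
  rw [h2]; rfl

lemma partialDeriv_conj {j : Fin d} {f : EuclideanSpace ℝ (Fin d) → ℂ} {x : EuclideanSpace ℝ (Fin d)} (hf : DifferentiableAt ℝ f x) :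
    partialDeriv j (fun y => starRingEnd ℂ (f y)) x = starRingEnd ℂ (partialDeriv j f x) := by
  unfold partialDeriv
  have := Complex.conjCLE.toContinuousLinearMap.hasFDerivAt.comp x hf.hasFDerivAt
  have h2 : fderiv ℝ (fun y => starRingEnd ℂ (f y)) x =
    Complex.conjCLE.toContinuousLinearMap.comp (fderiv ℝ f x) := this.fderiv
  rw [h2]; rfl

lemma partialDeriv_cexp {j : Fin d} {f : EuclideanSpace ℝ (Fin d) → ℂ} {x : EuclideanSpace ℝ (Fin d)} (hf : DifferentiableAt ℝ f x) :
    partialDeriv j (fun y => Complex.exp (f y)) x = Complex.exp (f x) * partialDeriv j f x := by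
  unfold partialDeriv
  rw [hf.hasFDerivAt.cexp.fderiv]; rfl

lemma partialDeriv_coord (j k : Fin d) (x : EuclideanSpace ℝ (Fin d)) :
    partialDeriv j (fun y : EuclideanSpace ℝ (Fin d) => y k) x = if j = k then 1 else 0 := by
  unfold partialDeriv
  have : HasFDerivAt (fun y : EuclideanSpace ℝ (Fin d) => y k) (EuclideanSpace.proj k : EuclideanSpace ℝ (Fin d) →L[ℝ] ℝ) x :=
    (EuclideanSpace.proj k : EuclideanSpace ℝ (Fin d) →L[ℝ] ℝ).hasFDerivAt
  rw [this.fderiv]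
  simp [eq_comm]

lemma continuous_partialDeriv {F : Type*} [NormedAddCommGroup F] [NormedSpace ℝ F] {j : Fin d}
    {f : EuclideanSpace ℝ (Fin d) → F} (hf : ContDiff ℝ 1 f) : Continuous (partialDeriv j f) :=
  (hf.continuous_fderiv one_ne_zero).clm_apply continuous_const

lemma contDiff_partialDeriv {F : Type*} [NormedAddCommGroup F] [NormedSpace ℝ F] {j : Fin d}
    {f : EuclideanSpace ℝ (Fin d) → F} (hf : ContDiff ℝ ∞ f) : ContDiff ℝ ∞ (partialDeriv j f) :=
  (hf.fderiv_right (by simp)).clm_apply contDiff_const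

lemma HasCompactSupport.partialDeriv {F : Type*} [NormedAddCommGroup F] [NormedSpace ℝ F]
    {f : EuclideanSpace ℝ (Fin d) → F} (hf : HasCompactSupport f) (j : Fin d) :
    HasCompactSupport (partialDeriv j f) :=
  (hf.fderiv ℝ).comp_left (g := fun L : EuclideanSpace ℝ (Fin d) →L[ℝ] F => L (EuclideanSpace.single j 1)) rfl

/-- The momentum operators are symmetric. -/
lemma integral_conj_mul_momentum (ħ : ℝ) (A : Fin d → EuclideanSpace ℝ (Fin d) → ℝ) (j : Fin d) {u v : EuclideanSpace ℝ (Fin d) → ℂ}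
    (hu : Differentiable ℝ u) (hv : Differentiable ℝ v)
    (h1 : Integrable fun x => starRingEnd ℂ (v x) * partialDeriv j u x)
    (h2 : Integrable fun x => starRingEnd ℂ (partialDeriv j v x) * u x)
    (h3 : Integrable fun x => starRingEnd ℂ (v x) * u x)
    (h4 : Integrable fun x => starRingEnd ℂ (v x) * ((A j x : ℂ) * u x)) :
    ∫ x, starRingEnd ℂ (v x) * momentum ħ A j u x =
      ∫ x, starRingEnd ℂ (momentum ħ A j v x) * u x := by
  have hcv : Differentiable ℝ fun x => starRingEnd ℂ (v x) := fun x =>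
    (Complex.conjCLE.toContinuousLinearMap.hasFDerivAt.comp x (hv x).hasFDerivAt).differentiableAt
  have hparts : ∫ x, starRingEnd ℂ (v x) * partialDeriv j u x =
      -∫ x, starRingEnd ℂ (partialDeriv j v x) * u x := by
    have := integral_mul_fderiv_eq_neg_fderiv_mul_of_integrable (μ := (volume : Measure (EuclideanSpace ℝ (Fin d))))
      (f := fun x => starRingEnd ℂ (v x)) (g := u) (v := EuclideanSpace.single j 1)
      (by
        refine h2.congr (Filter.Eventually.of_forall fun x => ?_)
        change _ = partialDeriv j (fun x => starRingEnd ℂ (v x)) x * u x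
        rw [partialDeriv_conj (hv x)]) h1 h3 (fun x _ => hcv x) (fun x _ => hu x)
    rw [show (∫ x, starRingEnd ℂ (v x) * partialDeriv j u x) =
      ∫ x, starRingEnd ℂ (v x) * (fderiv ℝ u x) (EuclideanSpace.single j 1) from rfl, this]
    congr 1
    refine integral_congr_ae (Filter.Eventually.of_forall fun x => ?_)
    change partialDeriv j (fun x => starRingEnd ℂ (v x)) x * u x = _
    rw [partialDeriv_conj (hv x)]
  have e1 : ∀ x, starRingEnd ℂ (v x) * momentum ħ A j u x =
      (ħ / Complex.I) * (starRingEnd ℂ (v x) * partialDeriv j u x) -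
        starRingEnd ℂ (v x) * ((A j x : ℂ) * u x) := fun x => by
    unfold momentum; ring
  -- The conjugate of `ħ/i` is `-ħ/i`; this sign compensates the one from integration by parts.
  have e2 : ∀ x, starRingEnd ℂ (momentum ħ A j v x) * u x =
      (-(ħ / Complex.I)) * (starRingEnd ℂ (partialDeriv j v x) * u x) -
        starRingEnd ℂ (v x) * ((A j x : ℂ) * u x) := fun x => by
    unfold momentum
    simp only [map_sub, map_mul, map_div₀, Complex.conj_ofReal, Complex.conj_I, div_neg]
    ring
  simp only [e1, e2]
  rw [integral_sub (h1.const_mul _) h4, integral_sub (h2.const_mul _) h4,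
    integral_const_mul, integral_const_mul, hparts]
  ring

/-- The momentum operators are symmetric on functions one of which has compact support. -/
lemma integral_conj_mul_momentum_of_hasCompactSupport (ħ : ℝ) {A : Fin d → EuclideanSpace ℝ (Fin d) → ℝ}
    (hA : ∀ j, Continuous (A j)) (j : Fin d) {u v : EuclideanSpace ℝ (Fin d) → ℂ}
    (hu : ContDiff ℝ 1 u) (hv : ContDiff ℝ 1 v) (hc : HasCompactSupport u) :
    ∫ x, starRingEnd ℂ (v x) * momentum ħ A j u x =
      ∫ x, starRingEnd ℂ (momentum ħ A j v x) * u x := by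
  have hcu := hu.continuous
  have hcv := hv.continuous
  have hdu : Continuous (partialDeriv j u) := continuous_partialDeriv hu
  have hdv : Continuous (partialDeriv j v) := continuous_partialDeriv hv
  have hAj := hA j
  refine integral_conj_mul_momentum ħ A j (hu.differentiable one_ne_zero)
    (hv.differentiable one_ne_zero) ?_ ?_ ?_ ?_
  · exact Continuous.integrable_of_hasCompactSupport
      ((Complex.continuous_conj.comp hcv).mul hdu) ((HasCompactSupport.partialDeriv hc j).mul_left)
  · exact Continuous.integrable_of_hasCompactSupport
      ((Complex.continuous_conj.comp hdv).mul hcu) hc.mul_left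
  · exact Continuous.integrable_of_hasCompactSupport
      ((Complex.continuous_conj.comp hcv).mul hcu) hc.mul_left
  · exact Continuous.integrable_of_hasCompactSupport
      ((Complex.continuous_conj.comp hcv).mul ((Complex.continuous_ofReal.comp hAj).mul hcu))
      (hc.mul_left.mul_left)

lemma continuous_momentum (ħ : ℝ) {A : Fin d → EuclideanSpace ℝ (Fin d) → ℝ} {j : Fin d}
    (hA : Continuous (A j)) {u : EuclideanSpace ℝ (Fin d) → ℂ} (hu : ContDiff ℝ 1 u) :
    Continuous (momentum ħ A j u) :=
  (continuous_const.mul (continuous_partialDeriv hu)).sub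
    ((Complex.continuous_ofReal.comp hA).mul hu.continuous)

lemma contDiff_momentum (ħ : ℝ) {A : Fin d → EuclideanSpace ℝ (Fin d) → ℝ} {j : Fin d}
    (hA : ContDiff ℝ ∞ (A j)) {u : EuclideanSpace ℝ (Fin d) → ℂ} (hu : ContDiff ℝ ∞ u) :
    ContDiff ℝ ∞ (momentum ħ A j u) :=
  (contDiff_const.mul (contDiff_partialDeriv hu)).sub
    ((Complex.ofRealCLM.contDiff.comp hA).mul hu)

lemma HasCompactSupport.momentum {u : EuclideanSpace ℝ (Fin d) → ℂ} (hc : HasCompactSupport u) (ħ : ℝ)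
    (A : Fin d → EuclideanSpace ℝ (Fin d) → ℝ) (j : Fin d) : HasCompactSupport (momentum ħ A j u) :=
  ((HasCompactSupport.partialDeriv hc j).mul_left).sub hc.mul_left

end

/-! ### Polynomials times a Gaussian -/

section

open MvPolynomial

variable {d : ℕ}

lemma partialDeriv_sum {F ι : Type*} [NormedAddCommGroup F] [NormedSpace ℝ F] {j : Fin d}
    {s : Finset ι} {f : ι → EuclideanSpace ℝ (Fin d) → F} {x : EuclideanSpace ℝ (Fin d)}
    (hf : ∀ i ∈ s, DifferentiableAt ℝ (f i) x) :
    partialDeriv j (fun y => ∑ i ∈ s, f i y) x = ∑ i ∈ s, partialDeriv j (f i) x := by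
  unfold partialDeriv
  rw [fderiv_fun_sum hf]
  simp

lemma contDiff_coord {n : WithTop ℕ∞} (k : Fin d) :
    ContDiff ℝ n fun y : EuclideanSpace ℝ (Fin d) => y k :=
  (EuclideanSpace.proj k : EuclideanSpace ℝ (Fin d) →L[ℝ] ℝ).contDiff

/-- The quadratic form `∑_{jk} S_{jk} x_j x_k`. -/
def quadForm (S : Matrix (Fin d) (Fin d) ℝ) (x : EuclideanSpace ℝ (Fin d)) : ℝ :=
  ∑ j, x j * ∑ k, S j k * x k

lemma contDiff_quadForm {n : WithTop ℕ∞} (S : Matrix (Fin d) (Fin d) ℝ) :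
    ContDiff ℝ n (quadForm S) :=
  ContDiff.sum fun j _ => (contDiff_coord j).mul
    (ContDiff.sum fun k _ => contDiff_const.mul (contDiff_coord k))

lemma partialDeriv_quadForm {S : Matrix (Fin d) (Fin d) ℝ} (hS : ∀ j k, S j k = S k j)
    (j : Fin d) (x : EuclideanSpace ℝ (Fin d)) :
    partialDeriv j (quadForm S) x = 2 * ∑ k, S j k * x k := by
  have hc : ∀ k : Fin d, DifferentiableAt ℝ (fun y : EuclideanSpace ℝ (Fin d) => y k) x :=
    fun k => (contDiff_coord (n := 1) k).differentiable one_ne_zero x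
  have hlin : ∀ i, DifferentiableAt ℝ
      (fun y : EuclideanSpace ℝ (Fin d) => ∑ k, S i k * y k) x := fun i =>
    DifferentiableAt.fun_sum fun k _ => (hc k).const_mul _
  have h1 : ∀ i, partialDeriv j (fun y : EuclideanSpace ℝ (Fin d) => ∑ k, S i k * y k) x =
      S i j := by
    intro i
    rw [partialDeriv_sum fun k _ => (hc k).const_mul _, Finset.sum_eq_single j]
    · rw [partialDeriv_mul (differentiableAt_const _) (hc j), partialDeriv_const,
        partialDeriv_coord]
      simp
    · intro k _ hk
      rw [partialDeriv_mul (differentiableAt_const _) (hc k), partialDeriv_const,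
        partialDeriv_coord, if_neg (Ne.symm hk)]
      simp
    · simp
  unfold quadForm
  rw [partialDeriv_sum fun i _ => (hc i).fun_mul (hlin i)]
  simp only [partialDeriv_mul (hc _) (hlin _), h1, partialDeriv_coord, Finset.sum_add_distrib]
  rw [two_mul]
  congr 1
  · simp
  · exact Finset.sum_congr rfl fun i _ => by rw [hS i j]; ring

/-- The Gaussian `exp(-⟨x, S x⟩ / 2ħ)`. -/
def gaussWeight (ħ : ℝ) (S : Matrix (Fin d) (Fin d) ℝ) (x : EuclideanSpace ℝ (Fin d)) : ℂ :=
  Complex.exp ((-(1 / (2 * ħ)) * quadForm S x : ℝ) : ℂ)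

lemma contDiff_gaussWeight {n : WithTop ℕ∞} (ħ : ℝ) (S : Matrix (Fin d) (Fin d) ℝ) :
    ContDiff ℝ n (gaussWeight ħ S) :=
  (Complex.ofRealCLM.contDiff.comp (contDiff_const.mul (contDiff_quadForm S))).cexp

lemma partialDeriv_gaussWeight {ħ : ℝ} (hħ : ħ ≠ 0) {S : Matrix (Fin d) (Fin d) ℝ}
    (hS : ∀ j k, S j k = S k j) (j : Fin d) (x : EuclideanSpace ℝ (Fin d)) :
    partialDeriv j (gaussWeight ħ S) x =
      -(1 / ħ : ℂ) * (∑ k, (S j k : ℂ) * x k) * gaussWeight ħ S x := by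
  have hq : DifferentiableAt ℝ (quadForm S) x :=
    (contDiff_quadForm (n := 1) S).differentiable one_ne_zero x
  have hq' := hq.const_mul (-(1 / (2 * ħ)))
  have : DifferentiableAt ℝ (fun y => ((-(1 / (2 * ħ)) * quadForm S y : ℝ) : ℂ)) x :=
    (Complex.ofRealCLM.hasFDerivAt.comp x hq'.hasFDerivAt).differentiableAt
  unfold gaussWeight
  rw [partialDeriv_cexp this, partialDeriv_ofReal hq',
    partialDeriv_mul (differentiableAt_const _) hq, partialDeriv_const,
    partialDeriv_quadForm hS]
  have : (ħ : ℂ) ≠ 0 := by exact_mod_cast hħ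
  push_cast
  field_simp
  ring

lemma norm_gaussWeight (ħ : ℝ) (S : Matrix (Fin d) (Fin d) ℝ) (x : EuclideanSpace ℝ (Fin d)) :
    ‖gaussWeight ħ S x‖ = Real.exp (-(1 / (2 * ħ)) * quadForm S x) := by
  rw [gaussWeight, Complex.norm_exp, Complex.ofReal_re]

/-- The value of a complex polynomial at a real point. -/
def polyFun (p : MvPolynomial (Fin d) ℂ) (x : EuclideanSpace ℝ (Fin d)) : ℂ :=
  eval (fun j => (x j : ℂ)) p

lemma contDiff_polyFun {n : WithTop ℕ∞} (p : MvPolynomial (Fin d) ℂ) :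
    ContDiff ℝ n (polyFun p) := by
  unfold polyFun
  induction p using MvPolynomial.induction_on with
  | C a => simpa using contDiff_const
  | add p q hp hq => simpa using hp.add hq
  | mul_X p i hp =>
    simpa using hp.mul (Complex.ofRealCLM.contDiff.comp (contDiff_coord i))

lemma partialDeriv_polyFun (j : Fin d) (p : MvPolynomial (Fin d) ℂ)
    (x : EuclideanSpace ℝ (Fin d)) :
    partialDeriv j (polyFun p) x = polyFun (pderiv j p) x := by
  have hdiff : ∀ p : MvPolynomial (Fin d) ℂ, DifferentiableAt ℝ (polyFun p) x := fun p =>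
    (contDiff_polyFun (n := 1) p).differentiable one_ne_zero x
  induction p using MvPolynomial.induction_on with
  | C a =>
    have : polyFun (C a : MvPolynomial (Fin d) ℂ) = fun _ => a := by ext; simp [polyFun]
    rw [this, partialDeriv_const]; simp [polyFun]
  | add p q hp hq =>
    have : polyFun (p + q) = fun y => polyFun p y + polyFun q y := by ext; simp [polyFun]
    rw [this, partialDeriv_add (hdiff p) (hdiff q), hp, hq]
    simp [polyFun]
  | mul_X p i hp =>
    have h1 : polyFun (p * X i) = fun y => polyFun p y * ((y i : ℝ) : ℂ) := by
      ext; simp [polyFun]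
    have hc : DifferentiableAt ℝ (fun y : EuclideanSpace ℝ (Fin d) => y i) x :=
      (contDiff_coord (n := 1) i).differentiable one_ne_zero x
    have hc' : DifferentiableAt ℝ (fun y : EuclideanSpace ℝ (Fin d) => ((y i : ℝ) : ℂ)) x :=
      (Complex.ofRealCLM.hasFDerivAt.comp x hc.hasFDerivAt).differentiableAt
    rw [h1, partialDeriv_mul (hdiff p) hc', hp, partialDeriv_ofReal hc, partialDeriv_coord]
    simp only [Derivation.leibniz, pderiv_X, polyFun, map_add, smul_eq_mul, map_mul, eval_X,
      Pi.single_apply]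
    by_cases hij : j = i
    · subst hij; simp; ring
    · simp [hij, Ne.symm hij]; ring

/-- The function `p · exp(-⟨x, S x⟩ / 2ħ)`, for a polynomial `p`. -/
def gaussPoly (ħ : ℝ) (S : Matrix (Fin d) (Fin d) ℝ) (p : MvPolynomial (Fin d) ℂ)
    (x : EuclideanSpace ℝ (Fin d)) : ℂ :=
  polyFun p x * gaussWeight ħ S x

lemma contDiff_gaussPoly {n : WithTop ℕ∞} (ħ : ℝ) (S : Matrix (Fin d) (Fin d) ℝ)
    (p : MvPolynomial (Fin d) ℂ) : ContDiff ℝ n (gaussPoly ħ S p) :=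
  (contDiff_polyFun p).mul (contDiff_gaussWeight ħ S)

lemma gaussPoly_add (ħ : ℝ) (S : Matrix (Fin d) (Fin d) ℝ) (p q : MvPolynomial (Fin d) ℂ)
    (x : EuclideanSpace ℝ (Fin d)) :
    gaussPoly ħ S (p + q) x = gaussPoly ħ S p x + gaussPoly ħ S q x := by
  simp [gaussPoly, polyFun]; ring

lemma gaussPoly_smul (ħ : ℝ) (S : Matrix (Fin d) (Fin d) ℝ) (c : ℂ) (p : MvPolynomial (Fin d) ℂ)
    (x : EuclideanSpace ℝ (Fin d)) : gaussPoly ħ S (c • p) x = c * gaussPoly ħ S p x := by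
  simp [gaussPoly, polyFun, smul_eval]; ring

lemma partialDeriv_gaussPoly {ħ : ℝ} (hħ : ħ ≠ 0) {S : Matrix (Fin d) (Fin d) ℝ}
    (hS : ∀ j k, S j k = S k j) (j : Fin d) (p : MvPolynomial (Fin d) ℂ) :
    partialDeriv j (gaussPoly ħ S p) =
      gaussPoly ħ S (pderiv j p + (-(1 / ħ : ℂ)) • ((∑ k, (S j k : ℂ) • X k) * p)) := by
  ext x
  unfold gaussPoly
  rw [partialDeriv_mul ((contDiff_polyFun (n := 1) p).differentiable one_ne_zero x)
    ((contDiff_gaussWeight (n := 1) ħ S).differentiable one_ne_zero x), partialDeriv_polyFun,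
    partialDeriv_gaussWeight hħ hS]
  simp only [polyFun, map_add, smul_eval, map_mul, map_sum, eval_X]
  ring

/-- The symmetric gauge `A_k = ½ ∑_j x_j B_{jk}` of a constant magnetic field. -/
def symmGauge (B : Matrix (Fin d) (Fin d) ℝ) (k : Fin d) (x : EuclideanSpace ℝ (Fin d)) : ℝ :=
  1 / 2 * ∑ j, x j * B j k

lemma contDiff_symmGauge {n : WithTop ℕ∞} (B : Matrix (Fin d) (Fin d) ℝ) (k : Fin d) :
    ContDiff ℝ n (symmGauge B k) :=
  contDiff_const.mul (ContDiff.sum fun j _ => (contDiff_coord j).mul contDiff_const)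

lemma symmGauge_mul_gaussPoly (ħ : ℝ) (B S : Matrix (Fin d) (Fin d) ℝ) (k : Fin d)
    (p : MvPolynomial (Fin d) ℂ) (x : EuclideanSpace ℝ (Fin d)) :
    (symmGauge B k x : ℂ) * gaussPoly ħ S p x =
      gaussPoly ħ S ((1 / 2 : ℂ) • ((∑ j, (B j k : ℂ) • X j) * p)) x := by
  simp only [gaussPoly, symmGauge, polyFun, smul_eval, map_mul, map_sum, eval_X]
  push_cast
  simp only [mul_comm (x _ : ℂ)]
  ring

/-- The momenta in the symmetric gauge act on `p · exp(-⟨x, S x⟩ / 2ħ)` through the operators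
`polyMomentum`. -/
lemma momentum_gaussPoly {ħ : ℝ} (hħ : ħ ≠ 0) {B S : Matrix (Fin d) (Fin d) ℝ}
    (hS : ∀ j k, S j k = S k j) (hB : ∀ j k, B k j = -B j k) (j : Fin d)
    (p : MvPolynomial (Fin d) ℂ) :
    momentum ħ (symmGauge B) j (gaussPoly ħ S p) =
      gaussPoly ħ S (polyMomentum ħ (gaugeMatrix B S) j p) := by
  ext x
  have hħ' : (ħ : ℂ) ≠ 0 := by exact_mod_cast hħ
  -- The first sum is what `ħ/i` makes of the logarithmic derivative of the Gaussian; the second is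
  -- the symmetric gauge, after one use of antisymmetry.
  have h1 : (∑ k, gaugeMatrix B S j k * x k : ℂ) =
      Complex.I * (∑ k, (S j k : ℂ) * x k) - 1 / 2 * ∑ k, (B k j : ℂ) * x k := by
    rw [Finset.mul_sum, Finset.mul_sum, ← Finset.sum_sub_distrib]
    refine Finset.sum_congr rfl fun k _ => ?_
    simp only [gaugeMatrix, Matrix.of_apply, hB j k]
    push_cast; ring
  unfold momentum
  rw [partialDeriv_gaussPoly hħ hS, symmGauge_mul_gaussPoly, polyMomentum_apply]
  simp only [gaussPoly, polyFun, map_add, smul_eval, map_mul, map_sum, eval_X, h1]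
  rw [div_eq_mul_inv, Complex.inv_I]
  field_simp
  ring

/-- The exponent `η` is quantified inside the induction: each further coordinate factor is absorbed
by half of it. -/
lemma exists_norm_polyFun_le (p : MvPolynomial (Fin d) ℂ) :
    ∀ η > 0, ∃ C, ∀ x : EuclideanSpace ℝ (Fin d), ‖polyFun p x‖ ≤ C * Real.exp (η * ‖x‖ ^ 2) := by
  induction p using MvPolynomial.induction_on with
  | C a =>
    intro η hη
    refine ⟨‖a‖, fun x => ?_⟩
    have h1 : 1 ≤ Real.exp (η * ‖x‖ ^ 2) := Real.one_le_exp (by positivity)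
    simpa [polyFun] using le_mul_of_one_le_right (norm_nonneg a) h1
  | add p q hp hq =>
    intro η hη
    obtain ⟨C₁, h1⟩ := hp η hη
    obtain ⟨C₂, h2⟩ := hq η hη
    refine ⟨C₁ + C₂, fun x => ?_⟩
    have : polyFun (p + q) x = polyFun p x + polyFun q x := by simp [polyFun]
    rw [this, add_mul]
    exact (norm_add_le _ _).trans (add_le_add (h1 x) (h2 x))
  | mul_X p i hp =>
    intro η hη
    obtain ⟨C₁, h1⟩ := hp (η / 2) (by positivity)
    refine ⟨C₁ * (1 + 2 / η), fun x => ?_⟩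
    have h2 : polyFun (p * X i) x = polyFun p x * ((x i : ℝ) : ℂ) := by simp [polyFun]
    have h3 : |x i| ≤ ‖x‖ := by simpa using PiLp.norm_apply_le x i
    have h4 : ‖x‖ ≤ (1 + 2 / η) * Real.exp (η / 2 * ‖x‖ ^ 2) := by
      have h5 := Real.add_one_le_exp (η / 2 * ‖x‖ ^ 2)
      have h6 : ‖x‖ ≤ 1 + ‖x‖ ^ 2 := by nlinarith [sq_nonneg (‖x‖ - 1)]
      have h7 : (1 + 2 / η) * (η / 2 * ‖x‖ ^ 2 + 1) =
          1 + ‖x‖ ^ 2 + η / 2 * ‖x‖ ^ 2 + 2 / η := by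
        field_simp
        ring
      have h8 : 0 ≤ η / 2 * ‖x‖ ^ 2 + 2 / η := by positivity
      calc ‖x‖ ≤ (1 + 2 / η) * (η / 2 * ‖x‖ ^ 2 + 1) := by rw [h7]; linarith
        _ ≤ _ := by gcongr
    rw [h2, norm_mul, Complex.norm_real, Real.norm_eq_abs]
    have h9 := mul_le_mul (h1 x) (h3.trans h4) (abs_nonneg _) ((norm_nonneg _).trans (h1 x))
    refine h9.trans (le_of_eq ?_)
    rw [show η * ‖x‖ ^ 2 = η / 2 * ‖x‖ ^ 2 + η / 2 * ‖x‖ ^ 2 by ring, Real.exp_add]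
    ring

lemma integrable_exp_neg_mul_sq_norm {c : ℝ} (hc : 0 < c) :
    Integrable fun x : EuclideanSpace ℝ (Fin d) => Real.exp (-c * ‖x‖ ^ 2) := by
  have := (GaussianFourier.integrable_cexp_neg_mul_sq_norm_add
    (V := EuclideanSpace ℝ (Fin d)) (b := (c : ℂ)) (by simpa using hc) 0 0).norm
  refine this.congr (Filter.Eventually.of_forall fun x => ?_)
  simp only [Complex.norm_exp]
  congr 1
  simp [← Complex.ofReal_pow, ← Complex.ofReal_mul]

/-- The Gaussian decays at least like `exp(-c‖x‖²/2ħ)`; half of this decay is spent on the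
polynomial. -/
lemma exists_norm_gaussPoly_le {ħ : ℝ} (hħ : 0 < ħ) {S : Matrix (Fin d) (Fin d) ℝ} {c : ℝ}
    (hc : 0 < c) (hS : ∀ x, c * ‖x‖ ^ 2 ≤ quadForm S x) (p : MvPolynomial (Fin d) ℂ) :
    ∃ C, ∀ x, ‖gaussPoly ħ S p x‖ ≤ C * Real.exp (-(c / (4 * ħ)) * ‖x‖ ^ 2) := by
  obtain ⟨C, hC⟩ := exists_norm_polyFun_le p (c / (4 * ħ)) (by positivity)
  refine ⟨C, fun x => ?_⟩
  rw [gaussPoly, norm_mul, norm_gaussWeight]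
  have h1 : Real.exp (-(1 / (2 * ħ)) * quadForm S x) ≤
      Real.exp (-(1 / (2 * ħ)) * (c * ‖x‖ ^ 2)) := by
    apply Real.exp_le_exp.mpr
    have : 0 ≤ 1 / (2 * ħ) := by positivity
    nlinarith [hS x]
  refine (mul_le_mul (hC x) h1 (Real.exp_nonneg _) ((norm_nonneg _).trans (hC x))).trans
    (le_of_eq ?_)
  rw [mul_assoc, ← Real.exp_add]
  congr 2
  field_simp
  ring

lemma memLp_gaussPoly {ħ : ℝ} (hħ : 0 < ħ) {S : Matrix (Fin d) (Fin d) ℝ} {c : ℝ}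
    (hc : 0 < c) (hS : ∀ x, c * ‖x‖ ^ 2 ≤ quadForm S x) (p : MvPolynomial (Fin d) ℂ) :
    MemLp (gaussPoly ħ S p) 2 := by
  obtain ⟨C, hC⟩ := exists_norm_gaussPoly_le hħ hc hS p
  have hcont : Continuous (gaussPoly ħ S p) := (contDiff_gaussPoly (n := 1) ħ S p).continuous
  rw [memLp_two_iff_integrable_sq_norm hcont.aestronglyMeasurable]
  refine ((integrable_exp_neg_mul_sq_norm (d := d) (c := c / (2 * ħ)) (by positivity)).const_mul
    (C ^ 2)).mono' (hcont.norm.pow 2).aestronglyMeasurable (Filter.Eventually.of_forall fun x => ?_)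
  rw [Real.norm_eq_abs, abs_of_nonneg (by positivity)]
  calc ‖gaussPoly ħ S p x‖ ^ 2 ≤ (C * Real.exp (-(c / (4 * ħ)) * ‖x‖ ^ 2)) ^ 2 := by
        gcongr; exact hC x
    _ = _ := by
        rw [mul_pow, ← Real.exp_nat_mul]
        congr 2
        push_cast
        field_simp
        ring

/-- The momenta are symmetric on the functions `p · exp(-⟨x, S x⟩ / 2ħ)`. -/
lemma integral_conj_gaussPoly_mul_momentum {ħ : ℝ} (hħ : 0 < ħ)
    {B S : Matrix (Fin d) (Fin d) ℝ} (hSs : ∀ j k, S j k = S k j) {c : ℝ}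
    (hc : 0 < c) (hS : ∀ x, c * ‖x‖ ^ 2 ≤ quadForm S x) (j : Fin d)
    (p q : MvPolynomial (Fin d) ℂ) :
    ∫ x, starRingEnd ℂ (gaussPoly ħ S p x) *
        momentum ħ (symmGauge B) j (gaussPoly ħ S q) x =
      ∫ x, starRingEnd ℂ (momentum ħ (symmGauge B) j (gaussPoly ħ S p) x) *
        gaussPoly ħ S q x := by
  have hint : ∀ p q, Integrable fun x =>
      starRingEnd ℂ (gaussPoly ħ S p x) * gaussPoly ħ S q x := fun p q =>
    (memLp_gaussPoly hħ hc hS p).star.integrable_mul (memLp_gaussPoly hħ hc hS q)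
  refine integral_conj_mul_momentum ħ _ j
    ((contDiff_gaussPoly (n := 1) ħ S q).differentiable one_ne_zero)
    ((contDiff_gaussPoly (n := 1) ħ S p).differentiable one_ne_zero) ?_ ?_ (hint p q) ?_
  · rw [partialDeriv_gaussPoly hħ.ne' hSs]
    exact hint _ _
  · rw [partialDeriv_gaussPoly hħ.ne' hSs]
    exact hint _ _
  · simp only [symmGauge_mul_gaussPoly]
    exact hint _ _

end

/-! ### Totality of the Gaussian polynomials -/

section

open MvPolynomial
open scoped FourierTransform InnerProductSpace

variable {d : ℕ}

/-- An integrable function whose Fourier transform vanishes is zero. -/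
lemma ae_eq_zero_of_fourier_eq_zero {V : Type*} [NormedAddCommGroup V] [InnerProductSpace ℝ V]
    [FiniteDimensional ℝ V] [MeasurableSpace V] [BorelSpace V] {h : V → ℂ}
    (hi : Integrable h) (hF : ∀ ξ, 𝓕 h ξ = 0) : h =ᵐ[volume] 0 := by
  -- A test function is the Fourier transform of a Schwartz function, and in the pairing the
  -- transform can be moved to `h`.
  refine ae_eq_zero_of_integral_contDiff_smul_eq_zero hi.locallyIntegrable fun φ hφ hc => ?_
  have hφc : HasCompactSupport fun x => (φ x : ℂ) := hc.comp_left (g := fun t : ℝ => (t : ℂ)) rfl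
  let ψ : SchwartzMap V ℂ :=
    hφc.toSchwartzMap (Complex.ofRealCLM.contDiff.comp hφ)
  have h1 : ∫ x, (𝓕 (𝓕⁻ ψ)) x • h x = ∫ x, (𝓕⁻ ψ) x • 𝓕 h x :=
    VectorFourier.integral_fourierIntegral_smul_eq_flip (L := innerₗ V)
      Real.continuous_fourierChar continuous_inner (𝓕⁻ ψ).integrable hi |>.trans (by
        rw [flip_innerₗ]; rfl)
  rw [FourierTransform.fourier_fourierInv_eq] at h1
  simp only [hF, smul_zero, integral_zero] at h1
  rw [← h1]
  refine integral_congr_ae (Filter.Eventually.of_forall fun x => ?_)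
  change φ x • h x = (φ x : ℂ) • h x
  exact (Complex.coe_smul _ _).symm

/-- The Gaussian has no zeros, and a complex polynomial vanishing on a product of infinite sets,
here copies of the reals, is zero. -/
lemma gaussPoly_eq_zero {ħ : ℝ} {S : Matrix (Fin d) (Fin d) ℝ} {p : MvPolynomial (Fin d) ℂ}
    (h : ∀ x, gaussPoly ħ S p x = 0) : p = 0 := by
  apply MvPolynomial.funext_set fun _ : Fin d => Set.range ((↑) : ℝ → ℂ)
  · intro i
    exact Set.infinite_range_of_injective Complex.ofReal_injective
  · intro z hz
    choose t ht using fun i => hz i (Set.mem_univ i)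
    have h1 := h (WithLp.toLp 2 t)
    rw [gaussPoly, mul_eq_zero] at h1
    have h2 : polyFun p (WithLp.toLp 2 t) = 0 := h1.resolve_right (Complex.exp_ne_zero _)
    have h3 : z = fun j => ((t j : ℝ) : ℂ) := funext fun j => (ht j).symm
    rw [h3, map_zero]
    exact h2

/-- A square integrable function orthogonal to all functions `p · exp(-⟨x, S x⟩ / 2ħ)` is zero. -/
lemma ae_eq_zero_of_forall_integral_gaussPoly_eq_zero {ħ : ℝ} (hħ : 0 < ħ)
    {S : Matrix (Fin d) (Fin d) ℝ} {c : ℝ} (hc : 0 < c) (hS : ∀ x, c * ‖x‖ ^ 2 ≤ quadForm S x)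
    {f : EuclideanSpace ℝ (Fin d) → ℂ} (hf : MemLp f 2)
    (h0 : ∀ p, ∫ x, starRingEnd ℂ (gaussPoly ħ S p x) * f x = 0) : f =ᵐ[volume] 0 := by
  set g : EuclideanSpace ℝ (Fin d) → ℂ := gaussWeight ħ S with hg
  have hg1 : gaussPoly ħ S 1 = g := by ext x; simp [gaussPoly, polyFun, hg]
  have hgL : MemLp g 2 := hg1 ▸ memLp_gaussPoly hħ hc hS 1
  have hconj : ∀ x, starRingEnd ℂ (g x) = g x := fun x => by
    rw [hg, gaussWeight, ← Complex.exp_conj, Complex.conj_ofReal]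
  have hi : Integrable fun x => g x * f x := hgL.integrable_mul hf
  have hgf : (fun x => g x * f x) =ᵐ[volume] 0 := by
    -- The Fourier transform of `g f` at `ξ` is a limit of integrals of `f` against polynomials
    -- times `g`, namely those given by the partial sums of the exponential series, and all of these
    -- vanish by hypothesis.
    refine ae_eq_zero_of_fourier_eq_zero hi fun ξ => ?_
    rw [Real.fourier_eq']
    set τ : EuclideanSpace ℝ (Fin d) → ℝ := fun x => -2 * Real.pi * ⟪x, ξ⟫_ℝ with hτ
    -- partial sums of the exponential series
    have hlim : Filter.Tendsto (fun N : ℕ => ∫ x, (∑ k ∈ Finset.range N,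
        ((τ x : ℂ) * Complex.I) ^ k / (Nat.factorial k : ℂ)) • (g x * f x)) Filter.atTop
        (nhds (∫ x, Complex.exp ((τ x : ℂ) * Complex.I) • (g x * f x))) := by
      set a : ℝ := 2 * Real.pi * ‖ξ‖ with ha
      have hτa : ∀ x, |τ x| ≤ a * ‖x‖ := fun x => by
        have := abs_real_inner_le_norm x ξ
        rw [hτ, ha, abs_mul, abs_mul, abs_neg, abs_two, abs_of_pos Real.pi_pos]
        nlinarith [Real.pi_pos]
      refine tendsto_integral_of_dominated_convergence
        (fun x => Real.exp (a * ‖x‖) * ‖g x‖ * ‖f x‖) (fun N => ?_) ?_ (fun N => ?_) ?_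
      · have hcont : Continuous fun x => ∑ k ∈ Finset.range N,
            ((τ x : ℂ) * Complex.I) ^ k / (Nat.factorial k : ℂ) := by
          rw [hτ]; fun_prop
        exact hcont.aestronglyMeasurable.smul hi.aestronglyMeasurable
      · have hexp : MemLp (fun x : EuclideanSpace ℝ (Fin d) => Real.exp (a * ‖x‖) * ‖g x‖) 2 := by
          have hgc : Continuous g := (contDiff_gaussWeight (n := 1) ħ S).continuous
          have hcont : Continuous
              fun x : EuclideanSpace ℝ (Fin d) => Real.exp (a * ‖x‖) * ‖g x‖ := by fun_prop
          rw [memLp_two_iff_integrable_sq_norm hcont.aestronglyMeasurable]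
          refine ((integrable_exp_neg_mul_sq_norm (d := d) (c := c / (2 * ħ))
            (by positivity)).const_mul (Real.exp (2 * ħ / c * a ^ 2))).mono'
            (hcont.norm.pow 2).aestronglyMeasurable (Filter.Eventually.of_forall fun x => ?_)
          rw [Real.norm_eq_abs, abs_of_nonneg (by positivity), Real.norm_eq_abs,
            abs_of_nonneg (by positivity), hg, norm_gaussWeight, ← Real.exp_add, ← Real.exp_add,
            ← Real.exp_nat_mul]
          apply Real.exp_le_exp.mpr
          -- Completing the square: the linear exponent `2a‖x‖` costs half of the quadratic decay of
          -- `‖g‖²` and the constant `2ħa²/c`.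
          have h1 : 0 ≤ (c / (2 * ħ)) * (‖x‖ - 2 * ħ / c * a) ^ 2 := by positivity
          have h2 : (c / (2 * ħ)) * (‖x‖ - 2 * ħ / c * a) ^ 2 =
              c / (2 * ħ) * ‖x‖ ^ 2 - 2 * a * ‖x‖ + 2 * ħ / c * a ^ 2 := by
            field_simp
            ring
          have h3 : (1 / ħ) * (c * ‖x‖ ^ 2) ≤ (1 / ħ) * quadForm S x :=
            mul_le_mul_of_nonneg_left (hS x) (by positivity)
          have h4 : (1 / ħ) * (c * ‖x‖ ^ 2) = 2 * (c / (2 * ħ) * ‖x‖ ^ 2) := by field_simp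
          have h5 : 1 / (2 * ħ) * quadForm S x = 1 / 2 * ((1 / ħ) * quadForm S x) := by
            field_simp
          push_cast
          rw [neg_mul, h5]
          linarith
        exact hexp.integrable_mul hf.norm
      · refine Filter.Eventually.of_forall fun x => ?_
        rw [norm_smul, norm_mul, mul_assoc]
        gcongr
        refine (norm_sum_le _ _).trans ?_
        refine le_trans ?_ (Real.sum_le_exp_of_nonneg
          (by positivity : 0 ≤ a * ‖x‖) N)
        refine Finset.sum_le_sum fun k _ => ?_
        rw [norm_div, norm_pow, norm_mul, Complex.norm_I, mul_one, Complex.norm_real,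
          Complex.norm_natCast, Real.norm_eq_abs]
        gcongr
        exact hτa x
      · refine Filter.Eventually.of_forall fun x => ?_
        have := (NormedSpace.expSeries_div_hasSum_exp
          ((τ x : ℂ) * Complex.I)).tendsto_sum_nat
        rw [← Complex.exp_eq_exp_ℂ] at this
        exact this.smul_const _
    refine tendsto_nhds_unique hlim ?_
    have hzero : ∀ N : ℕ, ∫ x, (∑ k ∈ Finset.range N,
        ((τ x : ℂ) * Complex.I) ^ k / (Nat.factorial k : ℂ)) • (g x * f x) = 0 := by
      intro N
      let q : MvPolynomial (Fin d) ℂ := ∑ j, ((-2 * Real.pi * ξ j : ℝ) : ℂ) • X j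
      have hq : ∀ x, polyFun q x = τ x := fun x => by
        simp only [polyFun, q, map_sum, smul_eval, eval_X, hτ, PiLp.inner_apply]
        simp only [RCLike.inner_apply, conj_trivial]
        push_cast
        rw [Finset.mul_sum]
        exact Finset.sum_congr rfl fun j _ => by ring
      -- The coefficients carry `-i` in place of `i` because the Gaussian polynomial enters the
      -- pairing conjugated.
      rw [← h0 (∑ k ∈ Finset.range N, ((-Complex.I) ^ k / (Nat.factorial k : ℂ)) • q ^ k)]
      refine integral_congr_ae (Filter.Eventually.of_forall fun x => ?_)
      have h1 : polyFun (∑ k ∈ Finset.range N,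
          ((-Complex.I) ^ k / (Nat.factorial k : ℂ)) • q ^ k) x =
          ∑ k ∈ Finset.range N, ((-Complex.I) ^ k / (Nat.factorial k : ℂ)) * (τ x : ℂ) ^ k := by
        rw [← hq]
        simp [polyFun, smul_eval]
      simp only [gaussPoly, h1, map_mul, map_sum, map_pow, map_div₀, map_neg, Complex.conj_I,
        neg_neg, Complex.conj_ofReal, Complex.conj_natCast, smul_eq_mul]
      rw [← hg, hconj, mul_assoc]
      congr 1
      exact Finset.sum_congr rfl fun k _ => by rw [mul_pow]; ring
    simp only [hzero]
    exact tendsto_const_nhds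
  filter_upwards [hgf] with x hx
  exact (mul_eq_zero.mp hx).resolve_left (Complex.exp_ne_zero _)

end

/-! ### The spectral gap of the constant-field operator -/

section

open MvPolynomial
open scoped InnerProductSpace

variable {d : ℕ}

lemma inner_toLp_toLp {α : Type*} [MeasurableSpace α] {μ : Measure α} {f g : α → ℂ}
    (hf : MemLp f 2 μ) (hg : MemLp g 2 μ) :
    ⟪hf.toLp f, hg.toLp g⟫_ℂ = ∫ x, starRingEnd ℂ (f x) * g x ∂μ := by
  rw [L2.inner_def]
  refine integral_congr_ae ?_
  filter_upwards [hf.coeFn_toLp, hg.coeFn_toLp] with x h1 h2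
  rw [h1, h2, RCLike.inner_apply, mul_comm]

lemma norm_toLp_sq {α : Type*} [MeasurableSpace α] {μ : Measure α} {f : α → ℂ}
    (hf : MemLp f 2 μ) : ‖hf.toLp f‖ ^ 2 = ∫ x, ‖f x‖ ^ 2 ∂μ := by
  have h1 : ((‖hf.toLp f‖ ^ 2 : ℝ) : ℂ) = ((∫ x, ‖f x‖ ^ 2 ∂μ : ℝ) : ℂ) := by
    have h2 := inner_self_eq_norm_sq_to_K (𝕜 := ℂ) (hf.toLp f)
    rw [inner_toLp_toLp] at h2
    rw [← integral_complex_ofReal]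
    simp only [Complex.conj_mul'] at h2
    push_cast
    exact h2.symm
  exact_mod_cast h1

/-- The functions `p · exp(-⟨x, S x⟩ / 2ħ)` as elements of `L²`. -/
def gaussPolyLp {ħ : ℝ} {S : Matrix (Fin d) (Fin d) ℝ}
    (hL : ∀ p, MemLp (gaussPoly ħ S p) 2 (volume : Measure (EuclideanSpace ℝ (Fin d)))) :
    MvPolynomial (Fin d) ℂ →ₗ[ℂ] Lp ℂ 2 (volume : Measure (EuclideanSpace ℝ (Fin d))) where
  toFun p := (hL p).toLp _
  map_add' p q := by
    rw [← MemLp.toLp_add]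
    congr 1
    ext x; exact gaussPoly_add ħ S p q x
  map_smul' c p := by
    rw [RingHom.id_apply, ← MemLp.toLp_const_smul]
    congr 1
    ext x; exact gaussPoly_smul ħ S c p x

lemma gaussPolyLp_injective {ħ : ℝ} {S : Matrix (Fin d) (Fin d) ℝ}
    (hL : ∀ p, MemLp (gaussPoly ħ S p) 2 (volume : Measure (EuclideanSpace ℝ (Fin d)))) :
    Function.Injective (gaussPolyLp hL) := by
  rw [← LinearMap.ker_eq_bot, LinearMap.ker_eq_bot']
  intro p hp
  have h1 : gaussPoly ħ S p =ᵐ[volume] 0 := by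
    have := (hL p).coeFn_toLp
    have h2 : (hL p).toLp _ = 0 := hp
    rw [h2] at this
    exact this.symm.trans (Lp.coeFn_zero _ _ _)
  have h2 : gaussPoly ħ S p = 0 :=
    (contDiff_gaussPoly (n := 1) ħ S p).continuous.ae_eq_iff_eq volume continuous_zero |>.mp h1
  exact gaussPoly_eq_zero (congrFun h2)

/-- A subspace of a Hilbert space with trivial orthogonal complement is dense; triviality is the
totality statement above. -/
lemma dense_range_gaussPolyLp {ħ : ℝ} (hħ : 0 < ħ) {S : Matrix (Fin d) (Fin d) ℝ} {c : ℝ}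
    (hc : 0 < c) (hS : ∀ x, c * ‖x‖ ^ 2 ≤ quadForm S x)
    (hL : ∀ p, MemLp (gaussPoly ħ S p) 2 (volume : Measure (EuclideanSpace ℝ (Fin d)))) :
    Dense ((gaussPolyLp hL).range : Set (Lp ℂ 2 (volume : Measure (EuclideanSpace ℝ (Fin d))))) := by
  rw [Submodule.dense_iff_topologicalClosure_eq_top,
    Submodule.topologicalClosure_eq_top_iff, Submodule.eq_bot_iff]
  intro f hf
  rw [Submodule.mem_orthogonal] at hf
  have h1 : (f : EuclideanSpace ℝ (Fin d) → ℂ) =ᵐ[volume] 0 := by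
    refine ae_eq_zero_of_forall_integral_gaussPoly_eq_zero hħ hc hS (Lp.memLp f) fun p => ?_
    have h2 := hf _ (LinearMap.mem_range_self (gaussPolyLp hL) p)
    rw [← Lp.toLp_coeFn f (Lp.memLp f)] at h2
    exact (inner_toLp_toLp (hL p) (Lp.memLp f)).symm.trans h2
  exact Lp.eq_zero_iff_ae_eq_zero.mpr h1

lemma hasCompactSupport_sum {X ι : Type*} [TopologicalSpace X] (s : Finset ι)
    {f : ι → X → ℂ} (hf : ∀ i, HasCompactSupport (f i)) :
    HasCompactSupport fun x => ∑ i ∈ s, f i x := by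
  classical
  induction s using Finset.induction_on with
  | empty => exact HasCompactSupport.zero
  | insert i s hi ih =>
    simp only [Finset.sum_insert hi]
    exact (hf i).add ih

lemma gaussPoly_sum (ħ : ℝ) (S : Matrix (Fin d) (Fin d) ℝ) {ι : Type*} (s : Finset ι)
    (p : ι → MvPolynomial (Fin d) ℂ) (x : EuclideanSpace ℝ (Fin d)) :
    gaussPoly ħ S (∑ i ∈ s, p i) x = ∑ i ∈ s, gaussPoly ħ S (p i) x := by
  simp [gaussPoly, polyFun, Finset.sum_mul]

set_option maxHeartbeats 1000000 in
/-- The spectral gap of the Landau Hamiltonian: for a constant nondegenerate magnetic field `B` the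
operator `∑_j P_j² / ħ + V₀` has its spectrum in the set of Landau levels. -/
lemma landau_spectral_gap {n : ℕ} {B : Matrix (Fin (2 * n)) (Fin (2 * n)) ℝ}
    (hanti : B.transpose = -B) (hrank : B.rank = 2 * n) :
    ∃ a : Fin n → ℝ, IsFrequencies B a ∧ ∀ ħ > 0, ∀ V₀ μ D : ℝ, 0 ≤ D →
      (∀ k : Fin n → ℕ, D ≤ |(∑ j, (2 * (k j : ℝ) + 1) * a j) + V₀ - μ|) →
      ∀ u : EuclideanSpace ℝ (Fin (2 * n)) → ℂ, ContDiff ℝ 1 u → HasCompactSupport u →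
        (∀ j, ContDiff ℝ 1 (momentum ħ (symmGauge B) j u)) →
        D ^ 2 * ∫ x, ‖u x‖ ^ 2 ≤
          ∫ x, ‖(∑ j, momentum ħ (symmGauge B) j (momentum ħ (symmGauge B) j u) x) / ħ +
            ((V₀ - μ : ℝ) : ℂ) * u x‖ ^ 2 := by
  obtain ⟨a, θ, w, hfreq, hspec, hθ, hsum⟩ := exists_frequencies hanti hrank
  have hunit : IsUnit B := by
    rw [← Matrix.mulVec_surjective_iff_isUnit]
    have h1 : LinearMap.range B.mulVecLin = ⊤ := by
      apply Submodule.eq_top_of_finrank_eq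
      rw [← Matrix.rank, hrank]; simp
    exact LinearMap.range_eq_top.mp h1
  obtain ⟨S, hSs, ⟨c, hc, hSc⟩, hhalf⟩ := exists_half_abs hanti hunit
  have hBa : ∀ j k, B k j = -B j k := fun j k => by
    have := congrFun (congrFun hanti j) k
    simpa using this
  have G : GaugeData B S θ w := { hspec with antisymm := hBa, symm := hSs, half_abs := hhalf }
  refine ⟨a, hfreq, fun ħ hħ V₀ μ D hD hgap u hu huc hPu => ?_⟩
  have hL := fun p => memLp_gaussPoly hħ hc hSc p
  have hA : ∀ j, Continuous (symmGauge B j) := fun j => (contDiff_symmGauge (n := 1) B j).continuous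
  set T := polyHamiltonian ħ (gaugeMatrix B S) with hT
  set P := fun j => momentum ħ (symmGauge B) j with hP
  have hPΦ : ∀ j p, P j (gaussPoly ħ S p) =
      gaussPoly ħ S (polyMomentum ħ (gaugeMatrix B S) j p) := fun j p =>
    momentum_gaussPoly hħ.ne' hSs hBa j p
  have hħc : (ħ : ℂ) ≠ 0 := by exact_mod_cast hħ.ne'
  -- the function `H u`
  set h : EuclideanSpace ℝ (Fin (2 * n)) → ℂ := fun x =>
    (∑ j, P j (P j u) x) - ((ħ * (μ - V₀) : ℝ) : ℂ) * u x with hh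
  have hPc : ∀ j, HasCompactSupport (P j u) := fun j => HasCompactSupport.momentum huc _ _ _
  have hPPcont : ∀ j, Continuous (P j (P j u)) := fun j => continuous_momentum ħ (hA j) (hPu j)
  have hcont : Continuous h :=
    (continuous_finsetSum _ fun j _ => hPPcont j).sub (continuous_const.mul hu.continuous)
  have hPPc : ∀ j, HasCompactSupport (P j (P j u)) := fun j =>
    HasCompactSupport.momentum (hPc j) _ _ _
  have hcs : HasCompactSupport h := by
    refine HasCompactSupport.sub ?_ huc.mul_left
    exact hasCompactSupport_sum Finset.univ hPPc
  have hhL : MemLp h 2 := hcont.memLp_of_hasCompactSupport hcs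
  have huL : MemLp u 2 := hu.continuous.memLp_of_hasCompactSupport huc
  have hint : ∀ p (v : EuclideanSpace ℝ (Fin (2 * n)) → ℂ), MemLp v 2 →
      Integrable fun x => starRingEnd ℂ (gaussPoly ħ S p x) * v x := fun p v hv =>
    (hL p).star.integrable_mul hv
  -- The abstract bound is applied to the sum of squares before division by `ħ`, so that the gap is
  -- `ħ D` and the spectral parameter `ħ (μ - V₀)`.
  have main : (ħ * D) * ‖huL.toLp u‖ ≤ ‖hhL.toLp h‖ := by
    refine mul_norm_le_of_invariant_subspaces (gaussPolyLp hL) (gaussPolyLp_injective hL) T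
      (fun m => restrictTotalDegree (Fin (2 * n)) ℂ m)
      (fun m p hp => G.polyHamiltonian_mem ħ hp) ?_ (μ := ħ * (μ - V₀)) (by positivity) ?_ ?_ ?_
    · intro p q
      have h1 : ∀ p, (gaussPolyLp hL p) = (hL p).toLp _ := fun p => rfl
      rw [h1, h1, h1, h1, inner_toLp_toLp, inner_toLp_toLp]
      simp only [hT, polyHamiltonian_apply, gaussPoly_sum, map_sum, Finset.sum_mul, Finset.mul_sum]
      rw [integral_finsetSum _ fun j _ => hint _ _ (hL _),
        integral_finsetSum _ fun j _ => hint _ _ (hL _)]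
      refine Finset.sum_congr rfl fun j _ => ?_
      have h2 := integral_conj_gaussPoly_mul_momentum (B := B) hħ hSs hc hSc j p
        (polyMomentum ħ (gaugeMatrix B S) j q)
      have h3 := integral_conj_gaussPoly_mul_momentum (B := B) hħ hSs hc hSc j
        (polyMomentum ħ (gaugeMatrix B S) j p) q
      simp only [momentum_gaussPoly hħ.ne' hSs hBa] at h2 h3
      exact (h2.trans h3).symm
    · intro m e p hp hp0 hTp
      obtain ⟨k, hk⟩ := G.exists_level_of_eigenvector ħ hθ hsum m e p hp hp0 hTp
      have hk' : e = ħ * ∑ j, (2 * (k j : ℝ) + 1) * a j := by exact_mod_cast hk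
      have : e - ħ * (μ - V₀) = ħ * ((∑ j, (2 * (k j : ℝ) + 1) * a j) + V₀ - μ) := by
        rw [hk']; ring
      rw [this, abs_mul, abs_of_pos hħ]
      exact mul_le_mul_of_nonneg_left (hgap k) hħ.le
    · intro p
      have h1 : ∀ p, (gaussPolyLp hL p) = (hL p).toLp _ := fun p => rfl
      rw [← map_smul, ← map_sub, h1, h1, inner_toLp_toLp, inner_toLp_toLp]
      -- The two momenta are moved one after the other onto the Gaussian polynomial; compact support
      -- of `u` makes all integrals converge.
      have h2 : ∀ j, ∫ x, starRingEnd ℂ (gaussPoly ħ S p x) * P j (P j u) x =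
          ∫ x, starRingEnd ℂ (gaussPoly ħ S (polyMomentum ħ (gaugeMatrix B S) j
            (polyMomentum ħ (gaugeMatrix B S) j p)) x) * u x := by
        intro j
        rw [← hPΦ, ← hPΦ]
        rw [integral_conj_mul_momentum_of_hasCompactSupport ħ hA j (hPu j)
          (contDiff_gaussPoly ħ S p) (hPc j)]
        have h3 := integral_conj_mul_momentum_of_hasCompactSupport ħ hA j hu
          (contDiff_gaussPoly ħ S (polyMomentum ħ (gaugeMatrix B S) j p)) huc
        rw [← hPΦ] at h3
        exact h3
      have h4 : ∀ x, starRingEnd ℂ (gaussPoly ħ S p x) * h x =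
          (∑ j, starRingEnd ℂ (gaussPoly ħ S p x) * P j (P j u) x) -
            ((ħ * (μ - V₀) : ℝ) : ℂ) * (starRingEnd ℂ (gaussPoly ħ S p x) * u x) := by
        intro x
        rw [hh, ← Finset.mul_sum]; ring
      have h5 : ∀ x, starRingEnd ℂ
          (gaussPoly ħ S (T p - ((ħ * (μ - V₀) : ℝ) : ℂ) • p) x) * u x =
          (∑ j, starRingEnd ℂ (gaussPoly ħ S (polyMomentum ħ (gaugeMatrix B S) j
            (polyMomentum ħ (gaugeMatrix B S) j p)) x) * u x) -
            ((ħ * (μ - V₀) : ℝ) : ℂ) * (starRingEnd ℂ (gaussPoly ħ S p x) * u x) := by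
        intro x
        rw [sub_eq_add_neg, ← neg_smul, gaussPoly_add, gaussPoly_smul, hT, polyHamiltonian_apply,
          gaussPoly_sum, ← Finset.sum_mul, map_add, map_sum, map_mul, map_neg, Complex.conj_ofReal]
        ring
      simp only [h4, h5]
      rw [integral_sub, integral_sub]
      · congr 1
        rw [integral_finsetSum, integral_finsetSum]
        · exact Finset.sum_congr rfl fun j _ => h2 j
        · exact fun j _ => hint _ _ huL
        · exact fun j _ => hint _ _ ((hPPcont j).memLp_of_hasCompactSupport (hPPc j))
      · exact integrable_finsetSum _ fun j _ => hint _ _ huL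
      · exact (hint _ _ huL).const_mul _
      · exact integrable_finsetSum _ fun j _ =>
          hint _ _ ((hPPcont j).memLp_of_hasCompactSupport (hPPc j))
      · exact (hint _ _ huL).const_mul _
    · intro ε hε
      have h1 := dense_range_gaussPolyLp hħ hc hSc hL
      obtain ⟨_, hp, ⟨p, rfl⟩⟩ := Metric.dense_iff.mp h1 (huL.toLp u) ε hε
      refine ⟨p.totalDegree, p, (mem_restrictTotalDegree _ _ _).mpr le_rfl, ?_⟩
      rw [← dist_eq_norm, dist_comm]
      exact hp
  have h1 : (ħ * D) ^ 2 * ∫ x, ‖u x‖ ^ 2 ≤ ∫ x, ‖h x‖ ^ 2 := by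
    rw [← norm_toLp_sq huL, ← norm_toLp_sq hhL, ← mul_pow]
    exact pow_le_pow_left₀ (by positivity) main 2
  have h2 : ∀ x, ‖(∑ j, P j (P j u) x) / ħ + ((V₀ - μ : ℝ) : ℂ) * u x‖ ^ 2 =
      (ħ ^ 2)⁻¹ * ‖h x‖ ^ 2 := by
    intro x
    have : (∑ j, P j (P j u) x) / ħ + ((V₀ - μ : ℝ) : ℂ) * u x = (ħ : ℂ)⁻¹ * h x := by
      simp only [hh]
      push_cast
      field_simp
      ring
    rw [this, norm_mul, mul_pow, norm_inv, Complex.norm_real, Real.norm_eq_abs, inv_pow, sq_abs]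
  change D ^ 2 * ∫ x, ‖u x‖ ^ 2 ≤
    ∫ x, ‖(∑ j, P j (P j u) x) / ħ + ((V₀ - μ : ℝ) : ℂ) * u x‖ ^ 2
  simp only [h2]
  rw [integral_const_mul, le_inv_mul_iff₀ (by positivity)]
  linarith

end

/-! ### The Poincaré gauge -/

section

variable {d : ℕ}

/-- Differentiation under the integral sign, for a jointly smooth integrand. -/
lemma hasFDerivAt_integral_of_contDiff {F : ℝ → EuclideanSpace ℝ (Fin d) → ℝ}
    (hF : ContDiff ℝ ∞ (Function.uncurry F)) (x₀ : EuclideanSpace ℝ (Fin d)) :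
    HasFDerivAt (fun x => ∫ s in (0 : ℝ)..1, F s x) (∫ s in (0 : ℝ)..1, fderiv ℝ (F s) x₀) x₀ ∧
      Continuous fun x => ∫ s in (0 : ℝ)..1, fderiv ℝ (F s) x := by
  have hFs : ∀ s, ContDiff ℝ ∞ (F s) := fun s =>
    hF.comp (contDiff_const.prodMk contDiff_id)
  have hcont : Continuous fun p : EuclideanSpace ℝ (Fin d) × ℝ => F p.2 p.1 :=
    hF.continuous.comp continuous_swap
  have hder : Continuous fun p : EuclideanSpace ℝ (Fin d) × ℝ => fderiv ℝ (F p.2) p.1 := by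
    have h1 : ContDiff ℝ 0 fun q : ℝ × EuclideanSpace ℝ (Fin d) => fderiv ℝ (F q.1) q.2 :=
      ContDiff.fderiv (n := 0) (m := ∞) (f := fun q : ℝ × EuclideanSpace ℝ (Fin d) => F q.1)
        (hF.comp ((contDiff_fst.comp contDiff_fst).prodMk contDiff_snd)) contDiff_snd (by simp)
    exact h1.continuous.comp continuous_swap
  refine ⟨?_, intervalIntegral.continuous_parametric_intervalIntegral_of_continuous' hder 0 1⟩
  obtain ⟨K, hK⟩ := ((isCompact_closedBall x₀ 1).prod
    (isCompact_Icc (a := (0 : ℝ)) (b := 1))).exists_bound_of_continuousOn hder.continuousOn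
  refine intervalIntegral.hasFDerivAt_integral_of_dominated_of_fderiv_le
    (F := fun x s => F s x) (F' := fun x s => fderiv ℝ (F s) x) (bound := fun _ => K)
    (s := Metric.closedBall x₀ 1) (Metric.closedBall_mem_nhds _ one_pos)
    (Filter.Eventually.of_forall fun x => ?_) ?_ ?_ ?_ ?_ ?_
  · exact (hcont.comp (continuous_const.prodMk continuous_id)).aestronglyMeasurable
  · exact (hcont.comp (continuous_const.prodMk continuous_id)).intervalIntegrable _ _
  · exact (hder.comp (continuous_const.prodMk continuous_id)).aestronglyMeasurable
  · refine Filter.Eventually.of_forall fun s hs x hx => hK (x, s) ⟨hx, ?_⟩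
    rw [Set.uIoc_of_le zero_le_one] at hs
    exact Set.Ioc_subset_Icc_self hs
  · exact intervalIntegrable_const
  · exact Filter.Eventually.of_forall fun s _ x _ =>
      ((hFs s).differentiable (by simp) x).hasFDerivAt

lemma contDiff_one_integral {F : ℝ → EuclideanSpace ℝ (Fin d) → ℝ}
    (hF : ContDiff ℝ ∞ (Function.uncurry F)) :
    ContDiff ℝ 1 fun x => ∫ s in (0 : ℝ)..1, F s x := by
  rw [contDiff_one_iff_fderiv]
  refine ⟨fun x => (hasFDerivAt_integral_of_contDiff hF x).1.differentiableAt, ?_⟩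
  have : (fderiv ℝ fun x => ∫ s in (0 : ℝ)..1, F s x) =
      fun x => ∫ s in (0 : ℝ)..1, fderiv ℝ (F s) x :=
    funext fun x => (hasFDerivAt_integral_of_contDiff hF x).1.fderiv
  rw [this]
  exact (hasFDerivAt_integral_of_contDiff hF 0).2

lemma partialDeriv_integral {F : ℝ → EuclideanSpace ℝ (Fin d) → ℝ}
    (hF : ContDiff ℝ ∞ (Function.uncurry F)) (j : Fin d) (x : EuclideanSpace ℝ (Fin d)) :
    partialDeriv j (fun x => ∫ s in (0 : ℝ)..1, F s x) x =
      ∫ s in (0 : ℝ)..1, partialDeriv j (F s) x := by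
  unfold partialDeriv
  rw [(hasFDerivAt_integral_of_contDiff hF x).1.fderiv,
    ContinuousLinearMap.intervalIntegral_apply]
  apply Continuous.intervalIntegrable
  have h1 : ContDiff ℝ 0 fun s : ℝ => fderiv ℝ (F s) x :=
    ContDiff.fderiv (n := 0) (m := ∞) hF contDiff_const (by simp)
  exact h1.continuous

lemma fderiv_eq_sum_partialDeriv {F : Type*} [NormedAddCommGroup F] [NormedSpace ℝ F]
    (f : EuclideanSpace ℝ (Fin d) → F) (x y : EuclideanSpace ℝ (Fin d)) :
    fderiv ℝ f x y = ∑ i, y i • partialDeriv i f x := by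
  have hy : y = ∑ i, y i • EuclideanSpace.single i (1 : ℝ) := by
    ext k
    simp [Finset.sum_apply, Pi.single_apply]
  conv_lhs => rw [hy, map_sum]
  exact Finset.sum_congr rfl fun i _ => map_smul _ _ _

lemma norm_partialDeriv_le {F : Type*} [NormedAddCommGroup F] [NormedSpace ℝ F]
    (f : EuclideanSpace ℝ (Fin d) → F) (x : EuclideanSpace ℝ (Fin d)) (j : Fin d) :
    ‖partialDeriv j f x‖ ≤ ‖fderiv ℝ f x‖ := by
  have := (fderiv ℝ f x).le_opNorm (EuclideanSpace.single j (1 : ℝ))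
  simpa [partialDeriv] using this

lemma partialDeriv_comp_homothety {f : EuclideanSpace ℝ (Fin d) → ℝ} (hf : Differentiable ℝ f)
    (x₀ x : EuclideanSpace ℝ (Fin d)) (s : ℝ) (j : Fin d) :
    partialDeriv j (fun x => f (x₀ + s • (x - x₀))) x =
      s * partialDeriv j f (x₀ + s • (x - x₀)) := by
  unfold partialDeriv
  have h1 : HasFDerivAt (fun x : EuclideanSpace ℝ (Fin d) => x₀ + s • (x - x₀))
      (s • ContinuousLinearMap.id ℝ _) x :=
    (((hasFDerivAt_id x).sub_const x₀).const_smul s).const_add x₀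
  have h2 := (hf (x₀ + s • (x - x₀))).hasFDerivAt.comp x h1
  rw [show (fun x => f (x₀ + s • (x - x₀))) = f ∘ fun x => x₀ + s • (x - x₀) from rfl, h2.fderiv]
  simp

lemma contDiff_homothety (x₀ : EuclideanSpace ℝ (Fin d)) :
    ContDiff ℝ ∞ fun p : ℝ × EuclideanSpace ℝ (Fin d) => x₀ + p.1 • (p.2 - x₀) :=
  contDiff_const.add (contDiff_fst.smul (contDiff_snd.sub contDiff_const))

lemma contDiff_magneticField {A : Fin d → EuclideanSpace ℝ (Fin d) → ℝ}
    (hA : ∀ j, ContDiff ℝ ∞ (A j)) (j k : Fin d) :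
    ContDiff ℝ ∞ fun x => magneticField A x j k :=
  (contDiff_partialDeriv (hA k)).sub (contDiff_partialDeriv (hA j))

/-- The Poincaré gauge: near `x₀` a magnetic potential is, up to a gradient, the symmetric gauge of
the field at `x₀` with an error controlled by the first derivatives of the field. -/
lemma exists_gauge {A : Fin d → EuclideanSpace ℝ (Fin d) → ℝ} (hA : ∀ j, ContDiff ℝ ∞ (A j))
    {K : ℝ} (hK : ∀ j k x, ‖fderiv ℝ (fun x => magneticField A x j k) x‖ ≤ K)
    (x₀ : EuclideanSpace ℝ (Fin d)) :
    ∃ (φ : EuclideanSpace ℝ (Fin d) → ℝ) (R : Fin d → EuclideanSpace ℝ (Fin d) → ℝ),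
      ContDiff ℝ 1 φ ∧ (∀ k, ContDiff ℝ 1 (R k)) ∧
      (∀ k x, A k x = partialDeriv k φ x + symmGauge (magneticField A x₀) k x + R k x) ∧
      (∀ k x, |R k x| ≤ (d * K) * ‖x - x₀‖ ^ 2) ∧
      ∀ k x, |partialDeriv k (R k) x| ≤ ((d + 1) * K) * ‖x - x₀‖ := by
  set b : Fin d → Fin d → EuclideanSpace ℝ (Fin d) → ℝ := fun j k x => magneticField A x j k
    with hb
  have hbs : ∀ j k, ContDiff ℝ ∞ (b j k) := contDiff_magneticField hA
  have hAd : ∀ j, Differentiable ℝ (A j) := fun j => (hA j).differentiable (by simp)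
  have hbd : ∀ j k, Differentiable ℝ (b j k) := fun j k => (hbs j k).differentiable (by simp)
  have hK0 : ∀ j k : Fin d, 0 ≤ K := fun j k => (norm_nonneg _).trans (hK j k 0)
  have hblip : ∀ j k x, |b j k x - b j k x₀| ≤ K * ‖x - x₀‖ := fun j k x =>
    Convex.norm_image_sub_le_of_norm_fderiv_le (s := Set.univ) (fun x _ => hbd j k x)
      (fun x _ => hK j k x) convex_univ (Set.mem_univ _) (Set.mem_univ _)
  -- Integrated over `s`, `Fφ` gives the line integral of `A` along the segment from `x₀` to `x`,
  -- and `FR` gives the contribution of the variation of the field along it.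
  let Fφ : ℝ → EuclideanSpace ℝ (Fin d) → ℝ := fun s x =>
    ∑ i, (x i - x₀ i) * A i (x₀ + s • (x - x₀))
  let FR : Fin d → ℝ → EuclideanSpace ℝ (Fin d) → ℝ := fun k s x =>
    ∑ i, (x i - x₀ i) * (s * (b i k (x₀ + s • (x - x₀)) - b i k x₀))
  have hcoord : ∀ i : Fin d, ContDiff ℝ ∞
      fun p : ℝ × EuclideanSpace ℝ (Fin d) => p.2 i - x₀ i := fun i =>
    ((contDiff_coord i).comp contDiff_snd).sub contDiff_const
  have hFφ : ContDiff ℝ ∞ (Function.uncurry Fφ) :=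
    ContDiff.sum fun i _ => (hcoord i).mul ((hA i).comp (contDiff_homothety x₀))
  have hFR : ∀ k, ContDiff ℝ ∞ (Function.uncurry (FR k)) := fun k =>
    ContDiff.sum fun i _ => (hcoord i).mul
      (contDiff_fst.mul (((hbs i k).comp (contDiff_homothety x₀)).sub contDiff_const))
  have hcd : ∀ (i : Fin d) x,
      DifferentiableAt ℝ (fun y : EuclideanSpace ℝ (Fin d) => y i - x₀ i) x := fun i x =>
    ((contDiff_coord (n := 1) i).differentiable one_ne_zero x).sub_const _
  have hcp : ∀ (i k : Fin d) x, partialDeriv k (fun y : EuclideanSpace ℝ (Fin d) => y i - x₀ i) x =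
      if k = i then 1 else 0 := fun i k x => by
    rw [← partialDeriv_coord k i x]
    unfold partialDeriv
    rw [fderiv_sub_const]
  have hhom : ∀ (s : ℝ) x, DifferentiableAt ℝ
      (fun y : EuclideanSpace ℝ (Fin d) => x₀ + s • (y - x₀)) x := fun s x => by fun_prop
  have hAc : ∀ i s x, DifferentiableAt ℝ (fun y => A i (x₀ + s • (y - x₀))) x := fun i s x =>
    (hAd i _).comp x (hhom s x)
  have hbc : ∀ i k s x, DifferentiableAt ℝ (fun y => b i k (x₀ + s • (y - x₀))) x :=
    fun i k s x => (hbd i k _).comp x (hhom s x)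
  have hdFφ : ∀ k s x, partialDeriv k (Fφ s) x = A k (x₀ + s • (x - x₀)) +
      ∑ i, (x i - x₀ i) * (s * partialDeriv k (A i) (x₀ + s • (x - x₀))) := by
    intro k s x
    rw [partialDeriv_sum fun i _ => (hcd i x).fun_mul (hAc i s x)]
    simp only [partialDeriv_mul (hcd _ x) (hAc _ s x), hcp, partialDeriv_comp_homothety (hAd _),
      Finset.sum_add_distrib]
    simp
  have hdFR : ∀ k s x, partialDeriv k (FR k s) x = s * (b k k (x₀ + s • (x - x₀)) - b k k x₀) +
      ∑ i, (x i - x₀ i) * (s * (s * partialDeriv k (b i k) (x₀ + s • (x - x₀)))) := by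
    intro k s x
    have h1 : ∀ i, DifferentiableAt ℝ
        (fun y => s * (b i k (x₀ + s • (y - x₀)) - b i k x₀)) x := fun i =>
      ((hbc i k s x).sub_const _).const_mul s
    have h2 : ∀ i, partialDeriv k (fun y => s * (b i k (x₀ + s • (y - x₀)) - b i k x₀)) x =
        s * (s * partialDeriv k (b i k) (x₀ + s • (x - x₀))) := by
      intro i
      rw [partialDeriv_mul (differentiableAt_const s) ((hbc i k s x).sub_const _),
        partialDeriv_const, ← partialDeriv_comp_homothety (hbd i k)]
      unfold partialDeriv
      rw [fderiv_sub_const]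
      ring
    rw [partialDeriv_sum fun i _ => (hcd i x).fun_mul (h1 i)]
    simp only [partialDeriv_mul (hcd _ x) (h1 _), hcp, h2, Finset.sum_add_distrib]
    simp
  let φ₀ : EuclideanSpace ℝ (Fin d) → ℝ := fun x => ∫ s in (0 : ℝ)..1, Fφ s x
  let R : Fin d → EuclideanSpace ℝ (Fin d) → ℝ := fun k x => ∫ s in (0 : ℝ)..1, FR k s x
  -- The construction yields the symmetric gauge centred at `x₀`. The linear function `ℓ` recentres
  -- it at the origin, the two differing by a constant vector.
  let ℓ : EuclideanSpace ℝ (Fin d) → ℝ := fun x => ∑ k, (-(1 / 2) * ∑ i, x₀ i * b i k x₀) * x k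
  have hℓ : ContDiff ℝ ∞ ℓ := ContDiff.sum fun k _ => contDiff_const.mul (contDiff_coord k)
  have hdℓ : ∀ k x, partialDeriv k ℓ x = -(1 / 2) * ∑ i, x₀ i * b i k x₀ := by
    intro k x
    have hc : ∀ i : Fin d, DifferentiableAt ℝ (fun y : EuclideanSpace ℝ (Fin d) => y i) x :=
      fun i => (contDiff_coord (n := 1) i).differentiable one_ne_zero x
    rw [partialDeriv_sum fun i _ => (hc i).const_mul _]
    simp only [partialDeriv_mul (differentiableAt_const _) (hc _), partialDeriv_const,
      partialDeriv_coord]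
    simp
  have hsegment : ∀ x s, s ∈ Set.Ioc (0 : ℝ) 1 → ‖x₀ + s • (x - x₀) - x₀‖ ≤ ‖x - x₀‖ := by
    intro x s hs
    rw [add_sub_cancel_left, norm_smul, Real.norm_eq_abs, abs_of_pos hs.1]
    exact mul_le_of_le_one_left (norm_nonneg _) hs.2
  have hcoordle : ∀ (x : EuclideanSpace ℝ (Fin d)) (i : Fin d), |x i - x₀ i| ≤ ‖x - x₀‖ :=
    fun x i => by simpa using PiLp.norm_apply_le (x - x₀) i
  refine ⟨fun x => φ₀ x + ℓ x, R, (contDiff_one_integral hFφ).add (hℓ.of_le (by simp)),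
    fun k => contDiff_one_integral (hFR k), fun k x => ?_, fun k x => ?_, fun k x => ?_⟩
  · rw [partialDeriv_add ((contDiff_one_integral hFφ).differentiable one_ne_zero x)
      (hℓ.differentiable (by simp) x), hdℓ, partialDeriv_integral hFφ]
    simp only [hdFφ]
    have hpath : Continuous fun s : ℝ => x₀ + s • (x - x₀) := by fun_prop
    -- the radial derivative
    have hrad : ∫ s in (0 : ℝ)..1, (A k (x₀ + s • (x - x₀)) +
        s * ∑ i, (x i - x₀ i) * partialDeriv i (A k) (x₀ + s • (x - x₀))) = A k x := by
      have h1 : ∀ s ∈ Set.uIcc (0 : ℝ) 1, HasDerivAt (fun s : ℝ => s * A k (x₀ + s • (x - x₀)))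
          (A k (x₀ + s • (x - x₀)) +
            s * ∑ i, (x i - x₀ i) * partialDeriv i (A k) (x₀ + s • (x - x₀))) s := by
        intro s _
        have h2 : HasDerivAt (fun s : ℝ => x₀ + s • (x - x₀)) (x - x₀) s := by
          simpa using ((hasDerivAt_id s).smul_const (x - x₀)).const_add x₀
        have h3 := (hAd k (x₀ + s • (x - x₀))).hasFDerivAt.comp_hasDerivAt s h2
        have h4 := (hasDerivAt_id' s).fun_mul h3
        rw [fderiv_eq_sum_partialDeriv] at h4
        simpa only [Function.comp_apply, one_mul, smul_eq_mul, PiLp.sub_apply] using h4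
      rw [intervalIntegral.integral_eq_sub_of_hasDerivAt h1]
      · simp
      · apply Continuous.intervalIntegrable
        refine ((hA k).continuous.comp hpath).add (continuous_id.mul ?_)
        exact continuous_finsetSum _ fun i _ => continuous_const.mul
          ((contDiff_partialDeriv (hA k)).continuous.comp hpath)
    -- Exchanging the indices of the derivative of `A` produces the field, which is then split into
    -- its value at `x₀` and the deviation in `FR`. The factor `s` integrates to the `½` of the
    -- symmetric gauge.
    have hsplit : ∀ s : ℝ, A k (x₀ + s • (x - x₀)) +
        ∑ i, (x i - x₀ i) * (s * partialDeriv k (A i) (x₀ + s • (x - x₀))) =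
        (A k (x₀ + s • (x - x₀)) +
          s * ∑ i, (x i - x₀ i) * partialDeriv i (A k) (x₀ + s • (x - x₀))) -
          FR k s x - s * ∑ i, (x i - x₀ i) * b i k x₀ := by
      intro s
      simp only [FR, Finset.mul_sum]
      rw [add_sub_assoc, add_sub_assoc, sub_sub, ← Finset.sum_add_distrib,
        ← Finset.sum_sub_distrib]
      congr 1
      refine Finset.sum_congr rfl fun i _ => ?_
      simp only [hb, magneticField, Matrix.of_apply]
      ring
    have hFRc : Continuous fun s => FR k s x :=
      (hFR k).continuous.comp (continuous_id.prodMk continuous_const)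
    simp only [hsplit]
    rw [intervalIntegral.integral_sub, intervalIntegral.integral_sub, hrad,
      intervalIntegral.integral_mul_const, integral_id]
    · simp only [symmGauge, R, sub_mul, Finset.sum_sub_distrib, hb]
      ring
    · apply Continuous.intervalIntegrable
      refine ((hA k).continuous.comp hpath).add (continuous_id.mul ?_)
      exact continuous_finsetSum _ fun i _ => continuous_const.mul
        ((contDiff_partialDeriv (hA k)).continuous.comp hpath)
    · exact hFRc.intervalIntegrable _ _
    · apply Continuous.intervalIntegrable
      refine (((hA k).continuous.comp hpath).add (continuous_id.mul ?_)).sub hFRc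
      exact continuous_finsetSum _ fun i _ => continuous_const.mul
        ((contDiff_partialDeriv (hA k)).continuous.comp hpath)
    · exact (continuous_id.mul continuous_const).intervalIntegrable _ _
  · have h1 : ∀ s ∈ Set.uIoc (0 : ℝ) 1, ‖FR k s x‖ ≤ (d * K) * ‖x - x₀‖ ^ 2 := by
      intro s hs
      rw [Set.uIoc_of_le zero_le_one] at hs
      have hs0 := hs.1.le
      have hs1 := hs.2
      refine (norm_sum_le _ _).trans ?_
      have : ∀ i ∈ (Finset.univ : Finset (Fin d)),
          ‖(x i - x₀ i) * (s * (b i k (x₀ + s • (x - x₀)) - b i k x₀))‖ ≤ K * ‖x - x₀‖ ^ 2 := by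
        intro i _
        rw [norm_mul, norm_mul, Real.norm_eq_abs, Real.norm_eq_abs, Real.norm_eq_abs,
          abs_of_pos hs.1]
        have h3 : |b i k (x₀ + s • (x - x₀)) - b i k x₀| ≤ K * ‖x - x₀‖ :=
          (hblip i k _).trans (mul_le_mul_of_nonneg_left (hsegment x s hs) (hK0 i k))
        calc _ ≤ ‖x - x₀‖ * (1 * (K * ‖x - x₀‖)) := by
              gcongr
              exact hcoordle x i
          _ = _ := by ring
      refine (Finset.sum_le_sum this).trans (le_of_eq ?_)
      simp; ring
    have := intervalIntegral.norm_integral_le_of_norm_le_const h1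
    simpa using this
  · rw [partialDeriv_integral (hFR k)]
    have h1 : ∀ s ∈ Set.uIoc (0 : ℝ) 1, ‖partialDeriv k (FR k s) x‖ ≤
        ((d + 1) * K) * ‖x - x₀‖ := by
      intro s hs
      rw [Set.uIoc_of_le zero_le_one] at hs
      have hs0 := hs.1.le
      have hs1 := hs.2
      rw [hdFR]
      refine (norm_add_le _ _).trans ?_
      have h2 : ‖s * (b k k (x₀ + s • (x - x₀)) - b k k x₀)‖ ≤ K * ‖x - x₀‖ := by
        rw [norm_mul, Real.norm_eq_abs, Real.norm_eq_abs, abs_of_pos hs.1]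
        have h3 : |b k k (x₀ + s • (x - x₀)) - b k k x₀| ≤ K * ‖x - x₀‖ :=
          (hblip k k _).trans (mul_le_mul_of_nonneg_left (hsegment x s hs) (hK0 k k))
        calc _ ≤ 1 * (K * ‖x - x₀‖) := by gcongr
          _ = _ := one_mul _
      have h4 : ∀ i ∈ (Finset.univ : Finset (Fin d)),
          ‖(x i - x₀ i) * (s * (s * partialDeriv k (b i k) (x₀ + s • (x - x₀))))‖ ≤
            K * ‖x - x₀‖ := by
        intro i _
        simp only [norm_mul]
        rw [Real.norm_eq_abs, Real.norm_eq_abs s, abs_of_pos hs.1]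
        calc _ ≤ ‖x - x₀‖ * (1 * (1 * K)) := by
              gcongr
              · exact hcoordle x i
              · exact (norm_partialDeriv_le _ _ _).trans (hK i k _)
          _ = _ := by ring
      have h5 := (norm_sum_le _ _).trans (Finset.sum_le_sum h4)
      simp only [Finset.sum_const, Finset.card_univ, Fintype.card_fin, nsmul_eq_mul] at h5
      linarith
    have := intervalIntegral.norm_integral_le_of_norm_le_const h1
    simpa using this

end

/-! ### Comparison with the constant-field model on a small ball -/

section

variable {d : ℕ}

/-- The gauge factor `exp(-i φ / ħ)`. -/
def gaugeFactor (ħ : ℝ) (φ : EuclideanSpace ℝ (Fin d) → ℝ) (x : EuclideanSpace ℝ (Fin d)) : ℂ :=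
  Complex.exp (-(Complex.I / ħ) * (φ x : ℂ))

lemma norm_gaugeFactor (ħ : ℝ) (φ : EuclideanSpace ℝ (Fin d) → ℝ) (x : EuclideanSpace ℝ (Fin d)) :
    ‖gaugeFactor ħ φ x‖ = 1 := by
  have : -(Complex.I / ħ) * (φ x : ℂ) = ((-(φ x / ħ) : ℝ) : ℂ) * Complex.I := by
    push_cast; ring
  rw [gaugeFactor, this, Complex.norm_exp_ofReal_mul_I]

lemma contDiff_gaugeFactor {n : WithTop ℕ∞} (ħ : ℝ) {φ : EuclideanSpace ℝ (Fin d) → ℝ}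
    (hφ : ContDiff ℝ n φ) : ContDiff ℝ n (gaugeFactor ħ φ) :=
  (contDiff_const.mul (Complex.ofRealCLM.contDiff.comp hφ)).cexp

lemma momentum_gaugeFactor_mul {ħ : ℝ} (hħ : ħ ≠ 0) {A A₀ R : Fin d → EuclideanSpace ℝ (Fin d) → ℝ}
    {φ : EuclideanSpace ℝ (Fin d) → ℝ} (hφ : ContDiff ℝ 1 φ)
    (hA : ∀ k x, A k x = partialDeriv k φ x + A₀ k x + R k x) (j : Fin d)
    {w : EuclideanSpace ℝ (Fin d) → ℂ} (hw : ContDiff ℝ 1 w) (x : EuclideanSpace ℝ (Fin d)) :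
    momentum ħ A₀ j (fun x => gaugeFactor ħ φ x * w x) x =
      gaugeFactor ħ φ x * (momentum ħ A j w x + (R j x : ℂ) * w x) := by
  have hħ' : (ħ : ℂ) ≠ 0 := by exact_mod_cast hħ
  have hφd := hφ.differentiable one_ne_zero x
  have hφc : DifferentiableAt ℝ (fun y => (φ y : ℂ)) x :=
    (Complex.ofRealCLM.hasFDerivAt.comp x hφd.hasFDerivAt).differentiableAt
  have h1 : partialDeriv j (gaugeFactor ħ φ) x =
      gaugeFactor ħ φ x * (-(Complex.I / ħ) * (partialDeriv j φ x : ℝ)) := by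
    unfold gaugeFactor
    rw [partialDeriv_cexp (hφc.const_mul _), partialDeriv_const_mul _ hφc, partialDeriv_ofReal hφd]
  unfold momentum
  rw [partialDeriv_mul ((contDiff_gaugeFactor ħ hφ).differentiable one_ne_zero x)
    (hw.differentiable one_ne_zero x), h1, hA j x]
  push_cast
  field_simp
  ring

lemma momentum_add (ħ : ℝ) (A : Fin d → EuclideanSpace ℝ (Fin d) → ℝ) (j : Fin d)
    {u v : EuclideanSpace ℝ (Fin d) → ℂ} {x : EuclideanSpace ℝ (Fin d)}
    (hu : DifferentiableAt ℝ u x) (hv : DifferentiableAt ℝ v x) :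
    momentum ħ A j (fun y => u y + v y) x = momentum ħ A j u x + momentum ħ A j v x := by
  unfold momentum
  rw [partialDeriv_add hu hv]; ring

/-- The Leibniz rule for the momentum operators. -/
lemma momentum_ofReal_mul (ħ : ℝ) (A : Fin d → EuclideanSpace ℝ (Fin d) → ℝ) (j : Fin d)
    {f : EuclideanSpace ℝ (Fin d) → ℝ} {u : EuclideanSpace ℝ (Fin d) → ℂ}
    {x : EuclideanSpace ℝ (Fin d)} (hf : DifferentiableAt ℝ f x) (hu : DifferentiableAt ℝ u x) :
    momentum ħ A j (fun y => (f y : ℂ) * u y) x =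
      (f x : ℂ) * momentum ħ A j u x + ħ / Complex.I * (partialDeriv j f x : ℝ) * u x := by
  have hfc : DifferentiableAt ℝ (fun y => (f y : ℂ)) x :=
    (Complex.ofRealCLM.hasFDerivAt.comp x hf.hasFDerivAt).differentiableAt
  unfold momentum
  rw [partialDeriv_mul hfc hu, partialDeriv_ofReal hf]; ring

lemma momentum_eq_zero_of_notMem_tsupport (ħ : ℝ) (A : Fin d → EuclideanSpace ℝ (Fin d) → ℝ)
    (j : Fin d) {u : EuclideanSpace ℝ (Fin d) → ℂ} {x : EuclideanSpace ℝ (Fin d)}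
    (hx : x ∉ tsupport u) : momentum ħ A j u x = 0 := by
  have h1 : fderiv ℝ u x = 0 := by
    by_contra h
    exact hx (support_fderiv_subset ℝ h)
  rw [momentum, partialDeriv, h1, image_eq_zero_of_notMem_tsupport hx]
  simp

/-- Young's inequality with weight `δ`: the principal term keeps a coefficient close to one, at the
price of `1/δ` on the error. -/
lemma norm_add_sq_le_of_pos (z w : ℂ) {δ : ℝ} (hδ : 0 < δ) :
    ‖z + w‖ ^ 2 ≤ (1 + δ) * ‖z‖ ^ 2 + (1 + 1 / δ) * ‖w‖ ^ 2 := by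
  have h1 : ‖z + w‖ ^ 2 ≤ (‖z‖ + ‖w‖) ^ 2 := by gcongr; exact norm_add_le z w
  have h2 : 0 ≤ (δ * ‖z‖ - ‖w‖) ^ 2 / δ := by positivity
  have h3 : (δ * ‖z‖ - ‖w‖) ^ 2 / δ = δ * ‖z‖ ^ 2 - 2 * ‖z‖ * ‖w‖ + 1 / δ * ‖w‖ ^ 2 := by
    field_simp
    ring
  nlinarith

lemma magneticField_transpose (A : Fin d → EuclideanSpace ℝ (Fin d) → ℝ)
    (x : EuclideanSpace ℝ (Fin d)) :
    (magneticField A x).transpose = -magneticField A x := by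
  ext i j
  simp [magneticField]

lemma continuous_hamiltonian (ħ : ℝ) {A : Fin d → EuclideanSpace ℝ (Fin d) → ℝ}
    {V : EuclideanSpace ℝ (Fin d) → ℝ} (hA : ∀ j, ContDiff ℝ ∞ (A j)) (hV : ContDiff ℝ ∞ V)
    {u : EuclideanSpace ℝ (Fin d) → ℂ} (hu : ContDiff ℝ ∞ u) :
    Continuous (hamiltonian ħ A V u) :=
  (continuous_finsetSum _ fun j _ =>
    (contDiff_momentum ħ (hA j) (contDiff_momentum ħ (hA j) hu)).continuous).add
    ((continuous_const.mul (Complex.continuous_ofReal.comp hV.continuous)).mul hu.continuous)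

lemma HasCompactSupport.hamiltonian {u : EuclideanSpace ℝ (Fin d) → ℂ} (hc : HasCompactSupport u)
    (ħ : ℝ) (A : Fin d → EuclideanSpace ℝ (Fin d) → ℝ) (V : EuclideanSpace ℝ (Fin d) → ℝ) :
    HasCompactSupport (MagneticSchrodinger.hamiltonian ħ A V u) := by
  have h1 : HasCompactSupport fun x =>
      ∑ j, MagneticSchrodinger.momentum ħ A j (MagneticSchrodinger.momentum ħ A j u) x :=
    hasCompactSupport_sum Finset.univ fun j =>
      HasCompactSupport.momentum (HasCompactSupport.momentum hc ħ A j) ħ A j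
  have h2 : HasCompactSupport ((fun x => (ħ : ℂ) * (V x : ℂ)) * u) := hc.mul_left
  exact h1.add h2

lemma integrable_norm_sq {u : EuclideanSpace ℝ (Fin d) → ℂ} (hu : Continuous u)
    (hc : HasCompactSupport u) : Integrable fun x => ‖u x‖ ^ 2 := by
  have h : HasCompactSupport ((fun z : ℂ => ‖z‖ ^ 2) ∘ u) := hc.comp_left (by simp)
  exact (hu.norm.pow 2).integrable_of_hasCompactSupport h

/-- The error made when the operator is replaced by its model at `x₀`, in terms of the gauge
remainder `R`. -/
def modelError (ħ : ℝ) (A : Fin d → EuclideanSpace ℝ (Fin d) → ℝ)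
    (V : EuclideanSpace ℝ (Fin d) → ℝ) (R : Fin d → EuclideanSpace ℝ (Fin d) → ℝ)
    (x₀ : EuclideanSpace ℝ (Fin d)) (v : EuclideanSpace ℝ (Fin d) → ℂ)
    (x : EuclideanSpace ℝ (Fin d)) : ℂ :=
  (∑ j, (2 * (R j x : ℂ) * momentum ħ A j v x +
    ħ / Complex.I * (partialDeriv j (R j) x : ℝ) * v x + (R j x : ℂ) ^ 2 * v x)) / ħ +
    ((V x₀ - V x : ℝ) : ℂ) * v x

/-- With `R = O(r²)` and `∂_j R_j = O(r)`, division by `ħ` leaves terms of size `r²/ħ` on the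
momenta and `r` and `r⁴/ħ` on `v`; the variation of `V` is another `O(r)`. -/
lemma norm_modelError_sq_le {ħ : ℝ} (hħ : 0 < ħ) {A : Fin d → EuclideanSpace ℝ (Fin d) → ℝ}
    {V : EuclideanSpace ℝ (Fin d) → ℝ} {R : Fin d → EuclideanSpace ℝ (Fin d) → ℝ}
    {x₀ x : EuclideanSpace ℝ (Fin d)} {v : EuclideanSpace ℝ (Fin d) → ℂ} {M r : ℝ} (hM : 0 ≤ M)
    (hr : 0 ≤ r) (hR : ∀ j, |R j x| ≤ M * r ^ 2) (hdR : ∀ j, |partialDeriv j (R j) x| ≤ M * r)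
    (hV : |V x₀ - V x| ≤ M * r) :
    ‖modelError ħ A V R x₀ v x‖ ^ 2 ≤
      (3 * (2 * M + (d + 1) * M + d * M ^ 2) ^ 2 * (d + 1)) *
        (r ^ 4 / ħ ^ 2 * ∑ j, ‖momentum ħ A j v x‖ ^ 2 + (r ^ 2 + r ^ 8 / ħ ^ 2) * ‖v x‖ ^ 2) := by
  set p := fun j => ‖momentum ħ A j v x‖ with hp
  set N := 2 * M + (d + 1) * M + d * M ^ 2 with hN
  have hN0 : 0 ≤ N := by positivity
  have h1 : ‖modelError ħ A V R x₀ v x‖ ≤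
      N * (r ^ 2 / ħ * ∑ j, p j + r * ‖v x‖ + r ^ 4 / ħ * ‖v x‖) := by
    have hterm : ∀ j, ‖2 * (R j x : ℂ) * momentum ħ A j v x +
        ħ / Complex.I * (partialDeriv j (R j) x : ℝ) * v x + (R j x : ℂ) ^ 2 * v x‖ ≤
        2 * (M * r ^ 2) * p j + ħ * (M * r) * ‖v x‖ + (M * r ^ 2) ^ 2 * ‖v x‖ := by
      intro j
      refine (norm_add₃_le).trans ?_
      simp only [norm_mul, norm_div, norm_pow, Complex.norm_real, Complex.norm_I, div_one,
        Real.norm_eq_abs, Complex.norm_ofNat, abs_of_pos hħ]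
      gcongr
      · exact hR j
      · exact hdR j
      · exact hR j
    have hsum := (norm_sum_le Finset.univ _).trans (Finset.sum_le_sum fun j _ => hterm j)
    have hV' : ‖((V x₀ - V x : ℝ) : ℂ) * v x‖ ≤ M * r * ‖v x‖ := by
      rw [norm_mul, Complex.norm_real]
      gcongr
      exact hV
    calc ‖modelError ħ A V R x₀ v x‖ ≤
          (∑ j, (2 * (M * r ^ 2) * p j + ħ * (M * r) * ‖v x‖ + (M * r ^ 2) ^ 2 * ‖v x‖)) / ħ +
            M * r * ‖v x‖ := by
          refine (norm_add_le _ _).trans (add_le_add ?_ hV')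
          rw [norm_div, Complex.norm_real, Real.norm_eq_abs, abs_of_pos hħ]
          gcongr
      _ = 2 * M * (r ^ 2 / ħ * ∑ j, p j) + (d + 1) * M * (r * ‖v x‖) +
            d * M ^ 2 * (r ^ 4 / ħ * ‖v x‖) := by
          rw [Finset.sum_add_distrib, Finset.sum_add_distrib, ← Finset.mul_sum]
          simp only [Finset.sum_const, Finset.card_univ, Fintype.card_fin, nsmul_eq_mul]
          field_simp
          ring
      _ ≤ N * (r ^ 2 / ħ * ∑ j, p j) + N * (r * ‖v x‖) + N * (r ^ 4 / ħ * ‖v x‖) := by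
          have hs : 0 ≤ ∑ j, p j := Finset.sum_nonneg fun j _ => norm_nonneg _
          have e1 : 0 ≤ (d + 1) * M := by positivity
          have e2 : 0 ≤ d * M ^ 2 := by positivity
          gcongr
          · rw [hN]; linarith
          · rw [hN]; linarith
          · rw [hN]; linarith
      _ = _ := by ring
  have h2 : (∑ j, p j) ^ 2 ≤ d * ∑ j, p j ^ 2 := by
    simpa using sq_sum_le_card_mul_sum_sq (s := Finset.univ) (f := p)
  have h3 : ∀ a b c : ℝ, (a + b + c) ^ 2 ≤ 3 * (a ^ 2 + b ^ 2 + c ^ 2) := fun a b c => by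
    nlinarith [sq_nonneg (a - b), sq_nonneg (b - c), sq_nonneg (a - c)]
  have hs2 : 0 ≤ ∑ j, p j ^ 2 := Finset.sum_nonneg fun j _ => sq_nonneg _
  calc ‖modelError ħ A V R x₀ v x‖ ^ 2 ≤
        (N * (r ^ 2 / ħ * ∑ j, p j + r * ‖v x‖ + r ^ 4 / ħ * ‖v x‖)) ^ 2 := by gcongr
    _ = N ^ 2 * (r ^ 2 / ħ * ∑ j, p j + r * ‖v x‖ + r ^ 4 / ħ * ‖v x‖) ^ 2 := by ring
    _ ≤ N ^ 2 * (3 * ((r ^ 2 / ħ * ∑ j, p j) ^ 2 + (r * ‖v x‖) ^ 2 + (r ^ 4 / ħ * ‖v x‖) ^ 2)) := by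
        gcongr; exact h3 _ _ _
    _ = 3 * N ^ 2 * (r ^ 4 / ħ ^ 2 * (∑ j, p j) ^ 2 + (r ^ 2 + r ^ 8 / ħ ^ 2) * ‖v x‖ ^ 2) := by
        field_simp
        ring
    _ ≤ 3 * N ^ 2 * ((d + 1) * (r ^ 4 / ħ ^ 2 * ∑ j, p j ^ 2) +
          (d + 1) * ((r ^ 2 + r ^ 8 / ħ ^ 2) * ‖v x‖ ^ 2)) := by
        have hd1 : (1 : ℝ) ≤ d + 1 := by linarith [(Nat.cast_nonneg d : (0 : ℝ) ≤ d)]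
        have e1 : r ^ 4 / ħ ^ 2 * (∑ j, p j) ^ 2 ≤ (d + 1) * (r ^ 4 / ħ ^ 2 * ∑ j, p j ^ 2) := by
          calc _ ≤ r ^ 4 / ħ ^ 2 * ((d + 1) * ∑ j, p j ^ 2) := by
                gcongr
                linarith
            _ = _ := by ring
        have e2 : (r ^ 2 + r ^ 8 / ħ ^ 2) * ‖v x‖ ^ 2 ≤
            (d + 1) * ((r ^ 2 + r ^ 8 / ħ ^ 2) * ‖v x‖ ^ 2) :=
          le_mul_of_one_le_left (by positivity) hd1
        gcongr
    _ = _ := by ring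

/-- The gauge transformation intertwines the operator with its model at `x₀` up to `modelError`. -/
lemma model_gaugeFactor_mul {ħ : ℝ} (hħ : ħ ≠ 0) {A A₀ R : Fin d → EuclideanSpace ℝ (Fin d) → ℝ}
    {V φ : EuclideanSpace ℝ (Fin d) → ℝ} (hAs : ∀ j, ContDiff ℝ ∞ (A j)) (hφ : ContDiff ℝ 1 φ)
    (hR : ∀ k, ContDiff ℝ 1 (R k)) (hA : ∀ k x, A k x = partialDeriv k φ x + A₀ k x + R k x)
    {v : EuclideanSpace ℝ (Fin d) → ℂ} (hv : ContDiff ℝ ∞ v) (μ : ℝ)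
    (x₀ x : EuclideanSpace ℝ (Fin d)) :
    (∀ j, momentum ħ A₀ j (fun x => gaugeFactor ħ φ x * v x) =
        fun x => gaugeFactor ħ φ x * (momentum ħ A j v x + (R j x : ℂ) * v x)) ∧
      (∑ j, momentum ħ A₀ j (momentum ħ A₀ j (fun x => gaugeFactor ħ φ x * v x)) x) / ħ +
        ((V x₀ - μ : ℝ) : ℂ) * (gaugeFactor ħ φ x * v x) =
        gaugeFactor ħ φ x * ((hamiltonian ħ A V v x / ħ - μ * v x) +
          modelError ħ A V R x₀ v x) := by
  have hħ' : (ħ : ℂ) ≠ 0 := by exact_mod_cast hħ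
  have hv1 : ContDiff ℝ 1 v := hv.of_le (by simp)
  have hPv : ∀ j, ContDiff ℝ 1 (momentum ħ A j v) := fun j =>
    (contDiff_momentum ħ (hAs j) hv).of_le (by simp)
  have hRv : ∀ j, ContDiff ℝ 1 fun x => (R j x : ℂ) * v x := fun j =>
    (Complex.ofRealCLM.contDiff.comp (hR j)).mul hv1
  have h1 : ∀ j, momentum ħ A₀ j (fun x => gaugeFactor ħ φ x * v x) =
      fun x => gaugeFactor ħ φ x * (momentum ħ A j v x + (R j x : ℂ) * v x) := fun j =>
    funext fun x => momentum_gaugeFactor_mul hħ hφ hA j hv1 x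
  refine ⟨h1, ?_⟩
  have h2 : ∀ j, momentum ħ A₀ j (momentum ħ A₀ j (fun x => gaugeFactor ħ φ x * v x)) x =
      gaugeFactor ħ φ x * (momentum ħ A j (momentum ħ A j v) x +
        (2 * (R j x : ℂ) * momentum ħ A j v x +
          ħ / Complex.I * (partialDeriv j (R j) x : ℝ) * v x + (R j x : ℂ) ^ 2 * v x)) := by
    intro j
    rw [h1, momentum_gaugeFactor_mul hħ hφ hA j ((hPv j).add (hRv j)),
      momentum_add ħ A j ((hPv j).differentiable one_ne_zero x)
        ((hRv j).differentiable one_ne_zero x),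
      momentum_ofReal_mul ħ A j ((hR j).differentiable one_ne_zero x)
        (hv1.differentiable one_ne_zero x)]
    ring
  simp only [h2]
  rw [← Finset.mul_sum, Finset.sum_add_distrib]
  unfold hamiltonian modelError
  push_cast
  generalize ∑ j, momentum ħ A j (momentum ħ A j v) x = s₁
  generalize ∑ j, (2 * (R j x : ℂ) * momentum ħ A j v x +
    ħ / Complex.I * (partialDeriv j (R j) x : ℝ) * v x + (R j x : ℂ) ^ 2 * v x) = s₂
  field_simp
  ring

/-- The lower bound for functions supported in a small ball around a point whose Landau levels are
at distance at least `D` from `μ`. -/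
lemma exists_local_estimate {n : ℕ} {A : Fin (2 * n) → EuclideanSpace ℝ (Fin (2 * n)) → ℝ}
    {V : EuclideanSpace ℝ (Fin (2 * n)) → ℝ} (hA : ∀ j, ContDiff ℝ ∞ (A j))
    (hV : ContDiff ℝ ∞ V) {K : ℝ} (hK : ∀ j k x, ‖fderiv ℝ (fun x => magneticField A x j k) x‖ ≤ K)
    (hKV : ∀ x, ‖fderiv ℝ V x‖ ≤ K)
    (hrank : ∀ x, (magneticField A x).rank = 2 * n) :
    ∃ C > 0, ∀ (x₀ : EuclideanSpace ℝ (Fin (2 * n))) (μ D : ℝ), 0 ≤ D →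
      (∀ Λ ∈ landauLevels A V x₀, D ≤ |Λ - μ|) → ∀ ħ > 0, ∀ r > 0, ∀ δ > 0,
      ∀ v : EuclideanSpace ℝ (Fin (2 * n)) → ℂ, ContDiff ℝ ∞ v → HasCompactSupport v →
        tsupport v ⊆ Metric.closedBall x₀ (2 * r) →
        D ^ 2 * ∫ x, ‖v x‖ ^ 2 ≤
          (1 + δ) * (∫ x, ‖hamiltonian ħ A V v x / ħ - μ * v x‖ ^ 2) +
          (1 + 1 / δ) * (C * (r ^ 4 / ħ ^ 2 * (∑ j, ∫ x, ‖momentum ħ A j v x‖ ^ 2) +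
            (r ^ 2 + r ^ 8 / ħ ^ 2) * ∫ x, ‖v x‖ ^ 2)) := by
  have hK0 : 0 ≤ K := (norm_nonneg _).trans (hKV 0)
  -- The ball has radius `2r`, whence the factors `4` and `2` in the quadratic and linear bounds.
  set M : ℝ := (2 * n : ℕ) * K * 4 + ((2 * n : ℕ) + 1) * K * 2 + K * 2 with hM
  have hM0 : 0 ≤ M := by positivity
  set C := 3 * (2 * M + ((2 * n : ℕ) + 1) * M + (2 * n : ℕ) * M ^ 2) ^ 2 * ((2 * n : ℕ) + 1)
    with hC
  have hC0 : 0 ≤ C := by positivity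
  -- One is added because `C` vanishes when `K = 0`.
  refine ⟨C + 1, by positivity, fun x₀ μ D hD hgap ħ hħ r hr δ hδ v hv hvc hsupp => ?_⟩
  obtain ⟨φ, R, hφ, hR, hdecomp, hRle, hdRle⟩ := exists_gauge hA hK x₀
  obtain ⟨a, ha, hmodel⟩ := landau_spectral_gap (magneticField_transpose A x₀) (hrank x₀)
  have hv1 : ContDiff ℝ 1 v := hv.of_le (by simp)
  have hg := contDiff_gaugeFactor ħ hφ
  have hP := fun x => model_gaugeFactor_mul (V := V) hħ.ne' hA hφ hR hdecomp hv μ x₀ x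
  have hPs : ∀ j, ContDiff ℝ ∞ (momentum ħ A j v) := fun j => contDiff_momentum ħ (hA j) hv
  -- The gauge function is only known to be `C¹`. This suffices: the momenta of the transformed
  -- function are the gauge factor times a `C¹` function, with no derivative of `φ` left.
  have h1 := hmodel ħ hħ (V x₀) μ D hD (fun k => hgap _ ⟨a, ha, k, rfl⟩)
    (fun x => gaugeFactor ħ φ x * v x) (hg.mul hv1) hvc.mul_left (fun j => by
      rw [(hP 0).1 j]
      exact hg.mul (((hPs j).of_le (by simp)).add
        ((Complex.ofRealCLM.contDiff.comp (hR j)).mul hv1)))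
  simp only [fun x => (hP x).2, norm_mul, norm_gaugeFactor, one_mul] at h1
  refine h1.trans ?_
  set f : EuclideanSpace ℝ (Fin (2 * n)) → ℂ := fun x => hamiltonian ħ A V v x / ħ - μ * v x
    with hf
  have hfc : Continuous f :=
    ((continuous_hamiltonian ħ hA hV hv).div_const _).sub (continuous_const.mul hv.continuous)
  have hfs : HasCompactSupport f := by
    have : HasCompactSupport fun x => hamiltonian ħ A V v x / (ħ : ℂ) :=
      (HasCompactSupport.hamiltonian hvc ħ A V).comp_left (g := fun z : ℂ => z / ħ) (by simp)
    exact this.sub hvc.mul_left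
  have hpoint : ∀ x, ‖f x + modelError ħ A V R x₀ v x‖ ^ 2 ≤ (1 + δ) * ‖f x‖ ^ 2 +
      (1 + 1 / δ) * (C * (r ^ 4 / ħ ^ 2 * ∑ j, ‖momentum ħ A j v x‖ ^ 2 +
        (r ^ 2 + r ^ 8 / ħ ^ 2) * ‖v x‖ ^ 2)) := by
    intro x
    refine (norm_add_sq_le_of_pos _ _ hδ).trans ?_
    gcongr
    by_cases hx : x ∈ tsupport v
    · have hxr : ‖x - x₀‖ ≤ 2 * r := by simpa [dist_eq_norm] using hsupp hx
      have hn : (0 : ℝ) ≤ (2 * n : ℕ) := Nat.cast_nonneg _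
      refine norm_modelError_sq_le hħ hM0 hr.le (fun j => (hRle j x).trans ?_)
        (fun j => (hdRle j x).trans ?_) ?_
      · calc ((2 * n : ℕ) : ℝ) * K * ‖x - x₀‖ ^ 2 ≤ (2 * n : ℕ) * K * (2 * r) ^ 2 := by gcongr
          _ = (2 * n : ℕ) * K * 4 * r ^ 2 := by ring
          _ ≤ M * r ^ 2 := by
              have : 0 ≤ ((2 * n : ℕ) + 1) * K * 2 + K * 2 := by positivity
              gcongr
              rw [hM]; linarith
      · calc (((2 * n : ℕ) : ℝ) + 1) * K * ‖x - x₀‖ ≤ ((2 * n : ℕ) + 1) * K * (2 * r) := by gcongr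
          _ = ((2 * n : ℕ) + 1) * K * 2 * r := by ring
          _ ≤ M * r := by
              have : 0 ≤ (2 * n : ℕ) * K * 4 + K * 2 := by positivity
              gcongr
              rw [hM]; linarith
      · have h2 : |V x - V x₀| ≤ K * ‖x - x₀‖ :=
          Convex.norm_image_sub_le_of_norm_fderiv_le (s := Set.univ)
            (fun x _ => hV.differentiable (by simp) x)
            (fun x _ => hKV x) convex_univ (Set.mem_univ _) (Set.mem_univ _)
        rw [abs_sub_comm]
        calc |V x - V x₀| ≤ K * (2 * r) := h2.trans (by gcongr)
          _ = K * 2 * r := by ring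
          _ ≤ M * r := by
              have : 0 ≤ (2 * n : ℕ) * K * 4 + ((2 * n : ℕ) + 1) * K * 2 := by positivity
              gcongr
              rw [hM]; linarith
    · have h0 : modelError ħ A V R x₀ v x = 0 := by
        simp [modelError, momentum_eq_zero_of_notMem_tsupport ħ A _ hx,
          image_eq_zero_of_notMem_tsupport hx]
      rw [h0]
      have : 0 ≤ ∑ j, ‖momentum ħ A j v x‖ ^ 2 := Finset.sum_nonneg fun j _ => sq_nonneg _
      rw [norm_zero, zero_pow two_ne_zero]
      positivity
  have hif := integrable_norm_sq hfc hfs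
  have hiv := integrable_norm_sq hv.continuous hvc
  have hiP : ∀ j, Integrable fun x => ‖momentum ħ A j v x‖ ^ 2 := fun j =>
    integrable_norm_sq (hPs j).continuous (HasCompactSupport.momentum hvc ħ A j)
  have hisum : Integrable fun x => ∑ j, ‖momentum ħ A j v x‖ ^ 2 :=
    integrable_finsetSum _ fun j _ => hiP j
  have hierr : Integrable fun x => r ^ 4 / ħ ^ 2 * ∑ j, ‖momentum ħ A j v x‖ ^ 2 +
      (r ^ 2 + r ^ 8 / ħ ^ 2) * ‖v x‖ ^ 2 := (hisum.const_mul _).add (hiv.const_mul _)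
  have h3 := integral_mono_of_nonneg (Filter.Eventually.of_forall fun x => by positivity)
    ((hif.const_mul (1 + δ)).add ((hierr.const_mul C).const_mul (1 + 1 / δ)))
    (Filter.Eventually.of_forall hpoint)
  refine h3.trans ?_
  simp only [Pi.add_apply]
  rw [integral_add (hif.const_mul _) ((hierr.const_mul C).const_mul _), integral_const_mul,
    integral_const_mul, integral_const_mul, integral_add (hisum.const_mul _) (hiv.const_mul _),
    integral_const_mul, integral_const_mul, integral_finsetSum _ fun j _ => hiP j]
  have hs : 0 ≤ ∑ j, ∫ x, ‖momentum ħ A j v x‖ ^ 2 :=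
    Finset.sum_nonneg fun j _ => integral_nonneg fun x => sq_nonneg _
  have hs' : 0 ≤ ∫ x, ‖v x‖ ^ 2 := integral_nonneg fun x => sq_nonneg _
  refine add_le_add le_rfl (mul_le_mul_of_nonneg_left
    (mul_le_mul_of_nonneg_right (by linarith) (by positivity)) (by positivity))

end

/-! ### Normalized cutoff functions -/

section

variable {d : ℕ}

/-- The Laplacian `∑_j ∂²f/∂x_j²`. -/
def coordLaplacian (f : EuclideanSpace ℝ (Fin d) → ℝ) (x : EuclideanSpace ℝ (Fin d)) : ℝ :=
  ∑ j, partialDeriv j (partialDeriv j f) x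

lemma continuous_coordLaplacian {f : EuclideanSpace ℝ (Fin d) → ℝ} (hf : ContDiff ℝ ∞ f) :
    Continuous (coordLaplacian f) :=
  continuous_finsetSum _ fun _ _ =>
    (contDiff_partialDeriv (contDiff_partialDeriv hf)).continuous

lemma partialDeriv_comp_sub (j : Fin d) (f : EuclideanSpace ℝ (Fin d) → ℝ)
    (x y : EuclideanSpace ℝ (Fin d)) :
    partialDeriv j (fun x => f (x - y)) x = partialDeriv j f (x - y) := by
  rw [partialDeriv, partialDeriv, fderiv_comp_sub]

lemma partialDeriv_const_mul_comp_smul (j : Fin d) {f : EuclideanSpace ℝ (Fin d) → ℝ}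
    (hf : Differentiable ℝ f) (s t : ℝ) :
    partialDeriv j (fun x => s * f (t • x)) = fun x => (s * t) * partialDeriv j f (t • x) := by
  funext x
  have h1 : DifferentiableAt ℝ (fun x => f (t • x)) x :=
    (hf (t • x)).comp x (differentiableAt_id.const_smul t)
  have h' : fderiv ℝ (fun x => s * f (t • x)) x = s • fderiv ℝ (fun x => f (t • x)) x :=
    fderiv_const_mul h1 s
  rw [partialDeriv, h', fderiv_comp_smul]
  simp [partialDeriv, mul_assoc]

lemma notMem_tsupport_partialDeriv {F : Type*} [NormedAddCommGroup F] [NormedSpace ℝ F]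
    (j : Fin d) {f : EuclideanSpace ℝ (Fin d) → F} {x : EuclideanSpace ℝ (Fin d)}
    (hx : x ∉ tsupport f) : x ∉ tsupport (partialDeriv j f) := by
  refine fun h => hx (tsupport_fderiv_subset ℝ (f := f) (closure_mono ?_ h))
  intro y hy h0
  apply hy
  have h0' : fderiv ℝ f y = 0 := h0
  rw [partialDeriv, h0']
  rfl

/-- A normalized cutoff function at scale `r`. -/
structure IsCutoff (c r : ℝ) (ρ : EuclideanSpace ℝ (Fin d) → ℝ) : Prop where
  contDiff : ContDiff ℝ ∞ ρ
  tsupport_subset : tsupport ρ ⊆ Metric.closedBall 0 r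
  integral_sq : ∫ z, ρ z ^ 2 = 1
  integral_mul_partialDeriv : ∀ j, ∫ z, ρ z * partialDeriv j ρ z = 0
  integral_partialDeriv_sq : ∀ j, ∫ z, partialDeriv j ρ z ^ 2 ≤ c / r ^ 2
  integral_mul_laplacian : |∫ z, ρ z * coordLaplacian ρ z| ≤ c / r ^ 2
  integral_laplacian_sq : ∫ z, coordLaplacian ρ z ^ 2 ≤ c / r ^ 4

/-- Integration by parts identifies the integral with its own negative. -/
lemma integral_mul_partialDeriv_self (j : Fin d) {f : EuclideanSpace ℝ (Fin d) → ℝ}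
    (hf : ContDiff ℝ ∞ f) (hc : HasCompactSupport f) : ∫ x, f x * partialDeriv j f x = 0 := by
  have hd : Continuous (partialDeriv j f) := continuous_partialDeriv (hf.of_le (by simp))
  have hi : Integrable fun x => f x * partialDeriv j f x :=
    (hf.continuous.mul hd).integrable_of_hasCompactSupport hc.mul_right
  have hi' : Integrable fun x => partialDeriv j f x * f x :=
    (hd.mul hf.continuous).integrable_of_hasCompactSupport hc.mul_left
  have hi2 : Integrable fun x => f x * f x :=
    (hf.continuous.mul hf.continuous).integrable_of_hasCompactSupport hc.mul_left
  have h := integral_mul_fderiv_eq_neg_fderiv_mul_of_integrable (μ := volume)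
    (v := EuclideanSpace.single j 1) hi' hi hi2
    (fun x _ => hf.differentiable (by simp) x) (fun x _ => hf.differentiable (by simp) x)
  have h2 : ∫ x, fderiv ℝ f x (EuclideanSpace.single j 1) * f x =
      ∫ x, f x * partialDeriv j f x := integral_congr_ae (.of_forall fun x => mul_comm _ _)
  rw [h2] at h
  change ∫ x, f x * partialDeriv j f x = -∫ x, f x * partialDeriv j f x at h
  linarith

lemma exists_isCutoff (d : ℕ) :
    ∃ c > 0, ∀ r > 0, ∃ ρ : EuclideanSpace ℝ (Fin d) → ℝ, IsCutoff c r ρ := by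
  let χ : ContDiffBump (0 : EuclideanSpace ℝ (Fin d)) := ⟨1 / 2, 1, by norm_num, by norm_num⟩
  have hχ : ContDiff ℝ ∞ χ := χ.contDiff
  have hχc : HasCompactSupport χ := χ.hasCompactSupport
  set N := ∫ x, χ x ^ 2 with hN
  have hN0 : 0 < N := by
    refine Continuous.integral_pos_of_hasCompactSupport_nonneg_nonzero (x := 0)
      (hχ.continuous.pow 2) ?_ (fun x => sq_nonneg _) ?_
    · exact hχc.comp_left (g := fun t : ℝ => t ^ 2) (by simp)
    · have : χ 0 = 1 := χ.one_of_mem_closedBall (by simp; positivity)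
      simp [this]
  set a := ∑ j, ∫ x, partialDeriv j χ x ^ 2
  set b := |∫ x, χ x * coordLaplacian χ x|
  set e := ∫ x, coordLaplacian χ x ^ 2
  have ha : 0 ≤ a := Finset.sum_nonneg fun j _ => integral_nonneg fun x => sq_nonneg _
  have hb : 0 ≤ b := abs_nonneg _
  have he : 0 ≤ e := integral_nonneg fun x => sq_nonneg _
  -- One constant serves all scales, since each integral for `ρ` is the one for the fixed bump `χ`
  -- times a power of `r`; the added one makes it positive.
  refine ⟨(a + b + e) / N + 1, by positivity, fun r hr => ?_⟩
  -- This amplitude gives `ρ` unit `L²` norm.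
  set s := (Real.sqrt (r ^ d * N))⁻¹ with hs
  have hs2 : s ^ 2 * r ^ d = 1 / N := by
    rw [hs, inv_pow, Real.sq_sqrt (by positivity)]
    field_simp
  have hs0 : 0 < s := by positivity
  have hscale : ∀ g : EuclideanSpace ℝ (Fin d) → ℝ, ∫ x, g (r⁻¹ • x) = r ^ d * ∫ x, g x := by
    intro g
    rw [Measure.integral_comp_smul_of_nonneg volume _ _ (hR := by positivity)]
    simp
  set ρ : EuclideanSpace ℝ (Fin d) → ℝ := fun x => s * χ (r⁻¹ • x) with hρ
  have hρs : ContDiff ℝ ∞ ρ := contDiff_const.mul (hχ.comp (contDiff_id.const_smul r⁻¹))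
  have hd1 : ∀ j, partialDeriv j ρ = fun x => (s * r⁻¹) * partialDeriv j χ (r⁻¹ • x) := fun j =>
    partialDeriv_const_mul_comp_smul j (hχ.differentiable (by simp)) s r⁻¹
  have hd2 : ∀ x, coordLaplacian ρ x = s * r⁻¹ * r⁻¹ * coordLaplacian χ (r⁻¹ • x) := by
    intro x
    rw [coordLaplacian, coordLaplacian, Finset.mul_sum]
    refine Finset.sum_congr rfl fun j _ => ?_
    rw [hd1 j, partialDeriv_const_mul_comp_smul j
      ((contDiff_partialDeriv hχ).differentiable (by simp))]
  have hsupp : tsupport ρ ⊆ Metric.closedBall 0 r := by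
    refine closure_minimal (fun x hx => ?_) Metric.isClosed_closedBall
    by_contra hxr
    apply hx
    have : χ (r⁻¹ • x) = 0 := by
      apply χ.zero_of_le_dist
      simp only [Metric.mem_closedBall, dist_zero_right, not_le] at hxr
      simp only [dist_zero_right, norm_smul, norm_inv, Real.norm_eq_abs, abs_of_pos hr]
      rw [inv_mul_eq_div, le_div_iff₀ hr]
      linarith
    simp [hρ, this]
  have hρc : HasCompactSupport ρ :=
    (isCompact_closedBall _ _).of_isClosed_subset (isClosed_tsupport _) hsupp
  have hint : ∀ (t : ℝ) (g : EuclideanSpace ℝ (Fin d) → ℝ),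
      ∫ x, s ^ 2 * t * g (r⁻¹ • x) = t * ((∫ x, g x) / N) := by
    intro t g
    rw [integral_const_mul, hscale]
    calc s ^ 2 * t * (r ^ d * ∫ x, g x) = s ^ 2 * r ^ d * t * ∫ x, g x := by ring
      _ = _ := by rw [hs2]; ring
  refine ⟨ρ, hρs, hsupp, ?_, fun j => integral_mul_partialDeriv_self j hρs hρc, fun j => ?_,
    ?_, ?_⟩
  · have h := hint 1 fun x => χ x ^ 2
    rw [← hN, div_self hN0.ne'] at h
    rw [← mul_one (1 : ℝ), ← h]
    refine integral_congr_ae (.of_forall fun x => ?_)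
    simp only [hρ]; ring
  · have h := hint (r⁻¹ ^ 2) fun x => partialDeriv j χ x ^ 2
    have h2 : ∫ x, partialDeriv j ρ x ^ 2 = r⁻¹ ^ 2 * ((∫ x, partialDeriv j χ x ^ 2) / N) := by
      rw [← h]
      refine integral_congr_ae (.of_forall fun x => ?_)
      simp only [hd1]; ring
    have h3 : ∫ x, partialDeriv j χ x ^ 2 ≤ a :=
      Finset.single_le_sum (f := fun j => ∫ x, partialDeriv j χ x ^ 2)
        (fun j _ => integral_nonneg fun x => sq_nonneg _) (Finset.mem_univ j)
    rw [h2, inv_pow, inv_mul_eq_div]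
    gcongr
    calc _ ≤ (a + b + e) / N := by gcongr; linarith
      _ ≤ _ := by linarith
  · have h := hint (r⁻¹ ^ 2) fun x => χ x * coordLaplacian χ x
    have h2 : ∫ x, ρ x * coordLaplacian ρ x =
        r⁻¹ ^ 2 * ((∫ x, χ x * coordLaplacian χ x) / N) := by
      rw [← h]
      refine integral_congr_ae (.of_forall fun x => ?_)
      change ρ x * coordLaplacian ρ x = _
      rw [hd2]
      simp only [hρ]
      ring
    rw [h2, abs_mul, abs_div, abs_of_pos hN0, abs_of_pos (by positivity), inv_pow, inv_mul_eq_div]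
    gcongr
    calc _ ≤ (a + b + e) / N := by gcongr; change b ≤ _; linarith
      _ ≤ _ := by linarith
  · have h := hint (r⁻¹ ^ 4) fun x => coordLaplacian χ x ^ 2
    have h2 : ∫ x, coordLaplacian ρ x ^ 2 = r⁻¹ ^ 4 * (e / N) := by
      rw [← h]
      refine integral_congr_ae (.of_forall fun x => ?_)
      simp only [hd2]; ring
    rw [h2, inv_pow, inv_mul_eq_div]
    gcongr
    calc _ ≤ (a + b + e) / N := by gcongr; linarith
      _ ≤ _ := by linarith

namespace IsCutoff

variable {c r : ℝ} {ρ : EuclideanSpace ℝ (Fin d) → ℝ}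

lemma continuous_partialDeriv (h : IsCutoff c r ρ) (j : Fin d) :
    Continuous (partialDeriv j ρ) :=
  (contDiff_partialDeriv h.contDiff).continuous

lemma partialDeriv_eq_zero (h : IsCutoff c r ρ) (j : Fin d) {z : EuclideanSpace ℝ (Fin d)}
    (hz : z ∉ Metric.closedBall 0 r) : partialDeriv j ρ z = 0 :=
  image_eq_zero_of_notMem_tsupport
    (notMem_tsupport_partialDeriv j fun hz' => hz (h.tsupport_subset hz'))

lemma laplacian_eq_zero (h : IsCutoff c r ρ) {z : EuclideanSpace ℝ (Fin d)}
    (hz : z ∉ Metric.closedBall 0 r) : coordLaplacian ρ z = 0 :=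
  Finset.sum_eq_zero fun j _ => image_eq_zero_of_notMem_tsupport
    (notMem_tsupport_partialDeriv j
      (notMem_tsupport_partialDeriv j fun hz' => hz (h.tsupport_subset hz')))

lemma eq_zero (h : IsCutoff c r ρ) {z : EuclideanSpace ℝ (Fin d)}
    (hz : z ∉ Metric.closedBall 0 r) : ρ z = 0 :=
  image_eq_zero_of_notMem_tsupport fun hz' => hz (h.tsupport_subset hz')

lemma integrable {g : EuclideanSpace ℝ (Fin d) → ℝ} (hg : Continuous g)
    (h0 : ∀ z ∉ Metric.closedBall (0 : EuclideanSpace ℝ (Fin d)) r, g z = 0) : Integrable g :=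
  hg.integrable_of_hasCompactSupport (HasCompactSupport.intro (isCompact_closedBall 0 r) h0)

end IsCutoff

end

/-! ### Averaging over the translates of the cutoff -/

section

variable {d : ℕ}

/-- The cross terms with the principal part `α` are kept exactly: the one with `β` will integrate to
zero, and estimating it would spoil the final power of `ħ`. The cross term of `β` and `γ` is
absorbed in the squares. -/
lemma norm_add_three_sq_le (α β γ : ℂ) :
    ‖α + β + γ‖ ^ 2 ≤ ‖α‖ ^ 2 + 2 * (starRingEnd ℂ α * β).re + 2 * (starRingEnd ℂ α * γ).re +
      2 * ‖β‖ ^ 2 + 2 * ‖γ‖ ^ 2 := by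
  simp only [← Complex.normSq_eq_norm_sq, Complex.normSq_apply, Complex.add_re, Complex.add_im,
    Complex.mul_re, Complex.conj_re, Complex.conj_im]
  nlinarith [sq_nonneg (β.re - γ.re), sq_nonneg (β.im - γ.im)]

lemma norm_sum_ofReal_mul_sq_le (t : Fin d → ℝ) (p : Fin d → ℂ) :
    ‖∑ j, (t j : ℂ) * p j‖ ^ 2 ≤ d * ∑ j, t j ^ 2 * ‖p j‖ ^ 2 := by
  have h1 : ‖∑ j, (t j : ℂ) * p j‖ ≤ ∑ j, |t j| * ‖p j‖ := by
    refine (norm_sum_le _ _).trans (le_of_eq (Finset.sum_congr rfl fun j _ => ?_))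
    rw [norm_mul, Complex.norm_real, Real.norm_eq_abs]
  calc ‖∑ j, (t j : ℂ) * p j‖ ^ 2 ≤ (∑ j, |t j| * ‖p j‖) ^ 2 := by gcongr
    _ ≤ d * ∑ j, (|t j| * ‖p j‖) ^ 2 := by
        simpa using sq_sum_le_card_mul_sum_sq (s := Finset.univ) (f := fun j => |t j| * ‖p j‖)
    _ = _ := by simp only [mul_pow, sq_abs]

namespace IsCutoff

variable {c r : ℝ} {ρ : EuclideanSpace ℝ (Fin d) → ℝ}

lemma integrable_sq (h : IsCutoff c r ρ) : Integrable fun z => ρ z ^ 2 :=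
  integrable (r := r) (h.contDiff.continuous.pow 2) fun z hz => by simp [h.eq_zero hz]

lemma integrable_partialDeriv_sq (h : IsCutoff c r ρ) (j : Fin d) :
    Integrable fun z => partialDeriv j ρ z ^ 2 :=
  integrable (r := r) ((h.continuous_partialDeriv j).pow 2) fun z hz => by
    simp [h.partialDeriv_eq_zero j hz]

/-- Integrating the localized momentum over all translates of the cutoff function. -/
lemma integral_norm_momentum_le (h : IsCutoff c r ρ) (ħ : ℝ) (j : Fin d) (p u : ℂ) :
    ∫ z, ‖(ρ z : ℂ) * p + ħ / Complex.I * (partialDeriv j ρ z : ℝ) * u‖ ^ 2 ≤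
      2 * ‖p‖ ^ 2 + 2 * ħ ^ 2 * (c / r ^ 2) * ‖u‖ ^ 2 := by
  have hpt : ∀ z, ‖(ρ z : ℂ) * p + ħ / Complex.I * (partialDeriv j ρ z : ℝ) * u‖ ^ 2 ≤
      2 * ‖p‖ ^ 2 * ρ z ^ 2 + 2 * ħ ^ 2 * ‖u‖ ^ 2 * partialDeriv j ρ z ^ 2 := by
    intro z
    refine (norm_add_sq_le_of_pos _ _ one_pos).trans (le_of_eq ?_)
    simp only [norm_mul, norm_div, Complex.norm_real, Complex.norm_I, Real.norm_eq_abs, div_one,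
      mul_pow, sq_abs]
    ring
  refine (integral_mono_of_nonneg (.of_forall fun z => sq_nonneg _)
    ((h.integrable_sq.const_mul _).add ((h.integrable_partialDeriv_sq j).const_mul _))
    (.of_forall hpt)).trans ?_
  simp only [Pi.add_apply]
  rw [integral_add (h.integrable_sq.const_mul _) ((h.integrable_partialDeriv_sq j).const_mul _),
    integral_const_mul, integral_const_mul, h.integral_sq]
  have := mul_le_mul_of_nonneg_left (h.integral_partialDeriv_sq j)
    (by positivity : 0 ≤ 2 * ħ ^ 2 * ‖u‖ ^ 2)
  linarith

/-- Integrating the localized operator over all translates of the cutoff function: the first order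
cross terms cancel. -/
lemma integral_norm_hamiltonian_le (h : IsCutoff c r ρ) {ħ : ℝ} (hħ : 0 < ħ)
    (f u : ℂ) (p : Fin d → ℂ) :
    ∫ z, ‖(ρ z : ℂ) * f + ∑ j, ((partialDeriv j ρ z : ℝ) : ℂ) * (-2 * Complex.I * p j) +
        (coordLaplacian ρ z : ℂ) * (-ħ * u)‖ ^ 2 ≤
      (1 + ħ * (c / r ^ 2)) * ‖f‖ ^ 2 + 8 * d * (c / r ^ 2) * ∑ j, ‖p j‖ ^ 2 +
        (ħ * (c / r ^ 2) + 2 * ħ ^ 2 * (c / r ^ 4)) * ‖u‖ ^ 2 := by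
  set q : Fin d → ℝ := fun j => 2 * (starRingEnd ℂ f * (-2 * Complex.I * p j)).re with hq
  set q' : ℝ := 2 * (starRingEnd ℂ f * (-ħ * u)).re with hq'
  have hpt : ∀ z, ‖(ρ z : ℂ) * f + ∑ j, ((partialDeriv j ρ z : ℝ) : ℂ) * (-2 * Complex.I * p j) +
      (coordLaplacian ρ z : ℂ) * (-ħ * u)‖ ^ 2 ≤
      ‖f‖ ^ 2 * ρ z ^ 2 + ∑ j, q j * (ρ z * partialDeriv j ρ z) +
        q' * (ρ z * coordLaplacian ρ z) + ∑ j, 8 * d * ‖p j‖ ^ 2 * partialDeriv j ρ z ^ 2 +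
        2 * ħ ^ 2 * ‖u‖ ^ 2 * coordLaplacian ρ z ^ 2 := by
    intro z
    refine (norm_add_three_sq_le _ _ _).trans ?_
    have e1 : ‖(ρ z : ℂ) * f‖ ^ 2 = ‖f‖ ^ 2 * ρ z ^ 2 := by
      rw [norm_mul, Complex.norm_real, mul_pow, Real.norm_eq_abs, sq_abs, mul_comm]
    have e2 : 2 * (starRingEnd ℂ ((ρ z : ℂ) * f) *
        ∑ j, ((partialDeriv j ρ z : ℝ) : ℂ) * (-2 * Complex.I * p j)).re =
        ∑ j, q j * (ρ z * partialDeriv j ρ z) := by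
      rw [Finset.mul_sum, Complex.re_sum, Finset.mul_sum]
      refine Finset.sum_congr rfl fun j _ => ?_
      have : starRingEnd ℂ ((ρ z : ℂ) * f) * (((partialDeriv j ρ z : ℝ) : ℂ) * (-2 * Complex.I * p j)) =
          ((ρ z * partialDeriv j ρ z : ℝ) : ℂ) * (starRingEnd ℂ f * (-2 * Complex.I * p j)) := by
        rw [map_mul, Complex.conj_ofReal]; push_cast; ring
      rw [this, Complex.re_ofReal_mul, hq]; ring
    have e3 : 2 * (starRingEnd ℂ ((ρ z : ℂ) * f) * ((coordLaplacian ρ z : ℂ) * (-ħ * u))).re =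
        q' * (ρ z * coordLaplacian ρ z) := by
      have : starRingEnd ℂ ((ρ z : ℂ) * f) * ((coordLaplacian ρ z : ℂ) * (-ħ * u)) =
          ((ρ z * coordLaplacian ρ z : ℝ) : ℂ) * (starRingEnd ℂ f * (-ħ * u)) := by
        rw [map_mul, Complex.conj_ofReal]; push_cast; ring
      rw [this, Complex.re_ofReal_mul, hq']; ring
    have e4 : 2 * ‖∑ j, ((partialDeriv j ρ z : ℝ) : ℂ) * (-2 * Complex.I * p j)‖ ^ 2 ≤
        ∑ j, 8 * d * ‖p j‖ ^ 2 * partialDeriv j ρ z ^ 2 := by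
      refine (mul_le_mul_of_nonneg_left (norm_sum_ofReal_mul_sq_le _ _) zero_le_two).trans
        (le_of_eq ?_)
      rw [Finset.mul_sum, Finset.mul_sum]
      refine Finset.sum_congr rfl fun j _ => ?_
      simp only [norm_mul, norm_neg, Complex.norm_I, Complex.norm_ofNat, mul_pow]
      ring
    have e5 : 2 * ‖(coordLaplacian ρ z : ℂ) * (-ħ * u)‖ ^ 2 =
        2 * ħ ^ 2 * ‖u‖ ^ 2 * coordLaplacian ρ z ^ 2 := by
      simp only [norm_mul, norm_neg, Complex.norm_real, Real.norm_eq_abs, mul_pow, sq_abs]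
      ring
    rw [e1, e2, e3, e5]
    linarith
  have hL := continuous_coordLaplacian h.contDiff
  have i1 := h.integrable_sq.const_mul (‖f‖ ^ 2)
  have i2' : ∀ j, Integrable fun z => q j * (ρ z * partialDeriv j ρ z) := fun j =>
    (integrable (r := r) (h.contDiff.continuous.mul (h.continuous_partialDeriv j))
      fun z hz => by simp [h.eq_zero hz]).const_mul _
  have i2 := integrable_finsetSum Finset.univ fun j _ => i2' j
  have i3 : Integrable fun z => q' * (ρ z * coordLaplacian ρ z) :=
    (integrable (r := r) (h.contDiff.continuous.mul hL)
      fun z hz => by simp [h.eq_zero hz]).const_mul _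
  have i4' : ∀ j, Integrable fun z => 8 * d * ‖p j‖ ^ 2 * partialDeriv j ρ z ^ 2 := fun j =>
    (h.integrable_partialDeriv_sq j).const_mul _
  have i4 := integrable_finsetSum Finset.univ fun j _ => i4' j
  have i5 : Integrable fun z => 2 * ħ ^ 2 * ‖u‖ ^ 2 * coordLaplacian ρ z ^ 2 :=
    (integrable (r := r) (hL.pow 2) fun z hz => by simp [h.laplacian_eq_zero hz]).const_mul _
  refine (integral_mono_of_nonneg (.of_forall fun z => sq_nonneg _)
    ((((i1.add i2).add i3).add i4).add i5) (.of_forall hpt)).trans ?_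
  -- The sum with coefficients `q j` disappears here, because `ρ` is orthogonal to its first
  -- derivatives.
  have hint : ∫ z, ((‖f‖ ^ 2 * ρ z ^ 2 + ∑ j, q j * (ρ z * partialDeriv j ρ z) +
        q' * (ρ z * coordLaplacian ρ z) + ∑ j, 8 * d * ‖p j‖ ^ 2 * partialDeriv j ρ z ^ 2 +
        2 * ħ ^ 2 * ‖u‖ ^ 2 * coordLaplacian ρ z ^ 2)) =
      ‖f‖ ^ 2 + q' * (∫ z, ρ z * coordLaplacian ρ z) +
        (∑ j, 8 * d * ‖p j‖ ^ 2 * ∫ z, partialDeriv j ρ z ^ 2) +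
        2 * ħ ^ 2 * ‖u‖ ^ 2 * ∫ z, coordLaplacian ρ z ^ 2 := by
    refine (integral_add' (((i1.add i2).add i3).add i4) i5).trans ?_
    rw [integral_add' ((i1.add i2).add i3) i4, integral_add' (i1.add i2) i3, integral_add' i1 i2,
      integral_finsetSum _ fun j _ => i2' j, integral_finsetSum _ fun j _ => i4' j]
    simp only [integral_const_mul, h.integral_sq, h.integral_mul_partialDeriv]
    simp
  refine hint.le.trans ?_
  have hq1 : |q'| ≤ ħ * (‖f‖ ^ 2 + ‖u‖ ^ 2) := by
    have h1 := Complex.abs_re_le_norm (starRingEnd ℂ f * (-ħ * u))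
    simp only [norm_mul, norm_neg, RCLike.norm_conj, Complex.norm_real, Real.norm_eq_abs,
      abs_of_pos hħ] at h1
    rw [hq', abs_mul, abs_two]
    nlinarith [sq_nonneg (‖f‖ - ‖u‖)]
  have b1 : q' * (∫ z, ρ z * coordLaplacian ρ z) ≤ ħ * (‖f‖ ^ 2 + ‖u‖ ^ 2) * (c / r ^ 2) := by
    refine (le_abs_self _).trans ?_
    rw [abs_mul]
    exact mul_le_mul hq1 h.integral_mul_laplacian (abs_nonneg _) (by positivity)
  have b2 : ∑ j, 8 * d * ‖p j‖ ^ 2 * ∫ z, partialDeriv j ρ z ^ 2 ≤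
      ∑ j, 8 * d * ‖p j‖ ^ 2 * (c / r ^ 2) :=
    Finset.sum_le_sum fun j _ => mul_le_mul_of_nonneg_left (h.integral_partialDeriv_sq j)
      (by positivity)
  have b3 : 2 * ħ ^ 2 * ‖u‖ ^ 2 * ∫ z, coordLaplacian ρ z ^ 2 ≤
      2 * ħ ^ 2 * ‖u‖ ^ 2 * (c / r ^ 4) :=
    mul_le_mul_of_nonneg_left h.integral_laplacian_sq (by positivity)
  have b4 : ∑ j, 8 * d * ‖p j‖ ^ 2 * (c / r ^ 2) = 8 * d * (c / r ^ 2) * ∑ j, ‖p j‖ ^ 2 := by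
    rw [Finset.mul_sum]
    exact Finset.sum_congr rfl fun j _ => by ring
  rw [b4] at b2
  linarith

end IsCutoff

end

/-! ### Superposition of the localized estimates -/

section

variable {d : ℕ}

lemma momentum_const_mul (ħ : ℝ) (A : Fin d → EuclideanSpace ℝ (Fin d) → ℝ) (j : Fin d) (c : ℂ)
    {u : EuclideanSpace ℝ (Fin d) → ℂ} {x : EuclideanSpace ℝ (Fin d)}
    (hu : DifferentiableAt ℝ u x) :
    momentum ħ A j (fun y => c * u y) x = c * momentum ħ A j u x := by
  unfold momentum
  rw [partialDeriv_const_mul c hu]; ring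

/-- The Leibniz rule for the magnetic Schrödinger operator. -/
lemma hamiltonian_ofReal_mul {ħ : ℝ} (hħ : ħ ≠ 0) {A : Fin d → EuclideanSpace ℝ (Fin d) → ℝ}
    (V : EuclideanSpace ℝ (Fin d) → ℝ) (hA : ∀ j, ContDiff ℝ ∞ (A j))
    {f : EuclideanSpace ℝ (Fin d) → ℝ} {u : EuclideanSpace ℝ (Fin d) → ℂ} (hf : ContDiff ℝ ∞ f)
    (hu : ContDiff ℝ ∞ u) (μ : ℝ) (x : EuclideanSpace ℝ (Fin d)) :
    hamiltonian ħ A V (fun y => (f y : ℂ) * u y) x / ħ - μ * ((f x : ℂ) * u x) =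
      (f x : ℂ) * (hamiltonian ħ A V u x / ħ - μ * u x) +
        ∑ j, ((partialDeriv j f x : ℝ) : ℂ) * (-2 * Complex.I * momentum ħ A j u x) +
        (coordLaplacian f x : ℂ) * (-ħ * u x) := by
  have hħ' : (ħ : ℂ) ≠ 0 := by exact_mod_cast hħ
  have hfd := hf.differentiable (by simp)
  have hud := hu.differentiable (by simp)
  have hpd : ∀ j, Differentiable ℝ (partialDeriv j f) := fun j =>
    (contDiff_partialDeriv hf).differentiable (by simp)
  have hPd : ∀ j, Differentiable ℝ (momentum ħ A j u) := fun j =>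
    (contDiff_momentum ħ (hA j) hu).differentiable (by simp)
  have h1 : ∀ j, momentum ħ A j (fun y => (f y : ℂ) * u y) = fun y =>
      (f y : ℂ) * momentum ħ A j u y + (partialDeriv j f y : ℝ) * (ħ / Complex.I * u y) :=
    fun j => funext fun y => by
      rw [momentum_ofReal_mul ħ A j (hfd y) (hud y)]; ring
  have hof : ∀ g : EuclideanSpace ℝ (Fin d) → ℝ, Differentiable ℝ g →
      Differentiable ℝ fun y => (g y : ℂ) := fun g hg y =>
    (Complex.ofRealCLM.hasFDerivAt.comp y (hg y).hasFDerivAt).differentiableAt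
  have h2 : ∀ j, momentum ħ A j (momentum ħ A j (fun y => (f y : ℂ) * u y)) x =
      (f x : ℂ) * momentum ħ A j (momentum ħ A j u) x +
        ħ * (((partialDeriv j f x : ℝ) : ℂ) * (-2 * Complex.I * momentum ħ A j u x)) +
        ħ * (((partialDeriv j (partialDeriv j f) x : ℝ) : ℂ) * (-ħ * u x)) := by
    intro j
    rw [h1, momentum_add ħ A j (u := fun y => (f y : ℂ) * momentum ħ A j u y)
        (v := fun y => ((partialDeriv j f y : ℝ) : ℂ) * (ħ / Complex.I * u y))
        ((hof f hfd x).mul (hPd j x)) ((hof _ (hpd j) x).mul ((hud x).const_mul _)),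
      momentum_ofReal_mul ħ A j (hfd x) (hPd j x),
      momentum_ofReal_mul ħ A j (hpd j x) ((hud x).const_mul _),
      momentum_const_mul ħ A j _ (hud x), Complex.div_I]
    linear_combination (ħ : ℂ) ^ 2 * (partialDeriv j (partialDeriv j f) x : ℝ) * u x *
      Complex.I_sq
  unfold hamiltonian coordLaplacian
  simp only [h2, Finset.sum_add_distrib, ← Finset.mul_sum]
  push_cast
  rw [← Finset.sum_mul]
  generalize ∑ j, momentum ħ A j (momentum ħ A j u) x = s₁
  generalize ∑ j, ((partialDeriv j f x : ℝ) : ℂ) * (-2 * Complex.I * momentum ħ A j u x) = s₂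
  generalize ∑ j, ((partialDeriv j (partialDeriv j f) x : ℝ) : ℂ) = s₃
  field_simp
  ring

/-- Fubini's theorem for the substitution `z = x - y`. -/
lemma integral_integral_comp_sub {g : EuclideanSpace ℝ (Fin d) → EuclideanSpace ℝ (Fin d) → ℝ}
    (hg : Continuous (Function.uncurry g)) {K L : Set (EuclideanSpace ℝ (Fin d))}
    (hK : IsCompact K) (hL : IsCompact L) (hgK : ∀ x ∉ K, ∀ z, g x z = 0)
    (hgL : ∀ x, ∀ z ∉ L, g x z = 0) :
    (Integrable fun y => ∫ x, g x (x - y)) ∧ (Integrable fun x => ∫ z, g x z) ∧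
      ∫ y, ∫ x, g x (x - y) = ∫ x, ∫ z, g x z := by
  have h1 : HasCompactSupport (Function.uncurry g) :=
    HasCompactSupport.intro (hK.prod hL) fun p hp => by
      by_cases hx : p.1 ∈ K
      · exact hgL _ _ fun hz => hp ⟨hx, hz⟩
      · exact hgK _ hx _
  set G : EuclideanSpace ℝ (Fin d) → EuclideanSpace ℝ (Fin d) → ℝ := fun y x => g x (x - y)
    with hG
  have hGc : Continuous (Function.uncurry G) :=
    hg.comp (continuous_snd.prodMk (continuous_snd.sub continuous_fst))
  have h2 : HasCompactSupport (Function.uncurry G) := by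
    refine HasCompactSupport.intro ((hK.prod hL).image
      ((continuous_fst.sub continuous_snd).prodMk continuous_fst)) fun p hp => ?_
    by_cases hx : p.2 ∈ K
    · refine hgL _ _ fun hz => hp ⟨(p.2, p.2 - p.1), ⟨hx, hz⟩, ?_⟩
      simp
    · exact hgK _ hx _
  refine ⟨?_, ?_, ?_⟩
  · exact ((hGc.integrable_of_hasCompactSupport (μ := volume.prod volume) h2).integral_prod_left)
  · exact ((hg.integrable_of_hasCompactSupport (μ := volume.prod volume) h1).integral_prod_left)
  · rw [integral_integral_swap_of_hasCompactSupport (f := G) hGc h2]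
    exact integral_congr_ae (.of_forall fun x => integral_sub_left_eq_self (g x) volume x)

/-- Superposition of estimates for the localized functions `ρ(· - y) u`. -/
lemma estimate_of_localized_estimates {A : Fin d → EuclideanSpace ℝ (Fin d) → ℝ}
    {V : EuclideanSpace ℝ (Fin d) → ℝ} (hA : ∀ j, ContDiff ℝ ∞ (A j)) (hV : ContDiff ℝ ∞ V)
    {u : EuclideanSpace ℝ (Fin d) → ℂ} (hu : ContDiff ℝ ∞ u) (huc : HasCompactSupport u)
    {ħ r c : ℝ} (hħ : 0 < ħ) {ρ : EuclideanSpace ℝ (Fin d) → ℝ} (hρ : IsCutoff c r ρ) (μ : ℝ)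
    {D₀ κ₀ κ₁ κ₂ : ℝ} (hκ₀ : 0 ≤ κ₀) (hκ₁ : 0 ≤ κ₁)
    (hloc : ∀ (y : EuclideanSpace ℝ (Fin d)) (v : EuclideanSpace ℝ (Fin d) → ℂ),
      v = (fun x => (ρ (x - y) : ℂ) * u x) →
      D₀ * ∫ x, ‖v x‖ ^ 2 ≤ κ₀ * (∫ x, ‖hamiltonian ħ A V v x / ħ - μ * v x‖ ^ 2) +
        κ₁ * (∑ j, ∫ x, ‖momentum ħ A j v x‖ ^ 2) + κ₂ * ∫ x, ‖v x‖ ^ 2) :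
    D₀ * ∫ x, ‖u x‖ ^ 2 ≤
      κ₀ * ((1 + ħ * (c / r ^ 2)) * (∫ x, ‖hamiltonian ħ A V u x / ħ - μ * u x‖ ^ 2) +
        8 * d * (c / r ^ 2) * (∑ j, ∫ x, ‖momentum ħ A j u x‖ ^ 2) +
        (ħ * (c / r ^ 2) + 2 * ħ ^ 2 * (c / r ^ 4)) * ∫ x, ‖u x‖ ^ 2) +
      κ₁ * (2 * (∑ j, ∫ x, ‖momentum ħ A j u x‖ ^ 2) +
        2 * d * ħ ^ 2 * (c / r ^ 2) * ∫ x, ‖u x‖ ^ 2) +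
      κ₂ * ∫ x, ‖u x‖ ^ 2 := by
  set F : EuclideanSpace ℝ (Fin d) → ℂ := fun x => hamiltonian ħ A V u x / ħ - μ * u x with hF
  have hFc : Continuous F :=
    ((continuous_hamiltonian ħ hA hV hu).div_const _).sub (continuous_const.mul hu.continuous)
  have hHs : HasCompactSupport fun x => hamiltonian ħ A V u x / (ħ : ℂ) :=
    (HasCompactSupport.hamiltonian huc ħ A V).comp_left (g := fun z : ℂ => z / ħ) (by simp)
  have hFs : HasCompactSupport F := hHs.sub huc.mul_left
  have hPc : ∀ j, Continuous (momentum ħ A j u) := fun j =>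
    (contDiff_momentum ħ (hA j) hu).continuous
  have hPs : ∀ j, HasCompactSupport (momentum ħ A j u) := fun j =>
    HasCompactSupport.momentum huc ħ A j
  have hu0 := hu.continuous
  have hρ0 := hρ.contDiff.continuous
  have hρ1 := hρ.continuous_partialDeriv
  have hρ2 := continuous_coordLaplacian hρ.contDiff
  have hx0 : ∀ x ∉ tsupport u, u x = 0 := fun x hx => image_eq_zero_of_notMem_tsupport hx
  have hP0 : ∀ j, ∀ x ∉ tsupport u, momentum ħ A j u x = 0 := fun j x hx =>
    momentum_eq_zero_of_notMem_tsupport ħ A j hx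
  have hPP0 : ∀ j, ∀ x ∉ tsupport u, momentum ħ A j (momentum ħ A j u) x = 0 := fun j x hx =>
    momentum_eq_zero_of_notMem_tsupport ħ A j fun h => hx
      (closure_minimal (fun y hy => by
        by_contra hy'
        exact hy (hP0 j y hy')) (isClosed_tsupport u) h)
  have hF0 : ∀ x ∉ tsupport u, F x = 0 := fun x hx => by
    simp [hF, hamiltonian, hx0 x hx, fun j => hPP0 j x hx]
  -- The densities of the localized functions are written in `x` and `z = x - y`. For fixed `x` the
  -- values of `u` and its momenta are then constants in the `z` integral, and only integrals of the
  -- cutoff remain.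
  set g₀ : EuclideanSpace ℝ (Fin d) → EuclideanSpace ℝ (Fin d) → ℝ := fun x z =>
    ‖(ρ z : ℂ) * F x + ∑ j, ((partialDeriv j ρ z : ℝ) : ℂ) *
      (-2 * Complex.I * momentum ħ A j u x) + (coordLaplacian ρ z : ℂ) * (-ħ * u x)‖ ^ 2 with hg₀
  set g₁ : Fin d → EuclideanSpace ℝ (Fin d) → EuclideanSpace ℝ (Fin d) → ℝ := fun j x z =>
    ‖(ρ z : ℂ) * momentum ħ A j u x + ħ / Complex.I * (partialDeriv j ρ z : ℝ) * u x‖ ^ 2 with hg₁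
  set g₂ : EuclideanSpace ℝ (Fin d) → EuclideanSpace ℝ (Fin d) → ℝ := fun x z =>
    ‖(ρ z : ℂ) * u x‖ ^ 2 with hg₂
  have hball := isCompact_closedBall (0 : EuclideanSpace ℝ (Fin d)) r
  have cρ : Continuous fun p : EuclideanSpace ℝ (Fin d) × EuclideanSpace ℝ (Fin d) =>
    (ρ p.2 : ℂ) := Complex.continuous_ofReal.comp (hρ0.comp continuous_snd)
  have cρ1 : ∀ j, Continuous fun p : EuclideanSpace ℝ (Fin d) × EuclideanSpace ℝ (Fin d) =>
    ((partialDeriv j ρ p.2 : ℝ) : ℂ) := fun j =>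
      Complex.continuous_ofReal.comp ((hρ1 j).comp continuous_snd)
  have cρ2 : Continuous fun p : EuclideanSpace ℝ (Fin d) × EuclideanSpace ℝ (Fin d) =>
    (coordLaplacian ρ p.2 : ℂ) := Complex.continuous_ofReal.comp (hρ2.comp continuous_snd)
  have cu : Continuous fun p : EuclideanSpace ℝ (Fin d) × EuclideanSpace ℝ (Fin d) => u p.1 :=
    hu0.comp continuous_fst
  have cF : Continuous fun p : EuclideanSpace ℝ (Fin d) × EuclideanSpace ℝ (Fin d) => F p.1 :=
    hFc.comp continuous_fst
  have cP : ∀ j, Continuous fun p : EuclideanSpace ℝ (Fin d) × EuclideanSpace ℝ (Fin d) =>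
    momentum ħ A j u p.1 := fun j => (hPc j).comp continuous_fst
  obtain ⟨a0, b0, e0⟩ := integral_integral_comp_sub (g := g₀) (K := tsupport u)
    (L := Metric.closedBall 0 r)
    ((((cρ.mul cF).add (continuous_finsetSum _ fun j _ =>
      (cρ1 j).mul (continuous_const.mul (cP j)))).add
      (cρ2.mul (continuous_const.mul cu))).norm.pow 2) huc hball
    (fun x hx z => by simp [hg₀, hx0 x hx, hF0 x hx, fun j => hP0 j x hx])
    (fun x z hz => by
      simp [hg₀, hρ.eq_zero hz, hρ.laplacian_eq_zero hz, fun j => hρ.partialDeriv_eq_zero j hz])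
  have h1 := fun j => integral_integral_comp_sub (g := g₁ j) (K := tsupport u)
    (L := Metric.closedBall 0 r)
    (((cρ.mul (cP j)).add ((continuous_const.mul (cρ1 j)).mul cu)).norm.pow 2) huc hball
    (fun x hx z => by simp [hg₁, hx0 x hx, hP0 j x hx])
    (fun x z hz => by simp [hg₁, hρ.eq_zero hz, hρ.partialDeriv_eq_zero j hz])
  obtain ⟨a2, b2, e2⟩ := integral_integral_comp_sub (g := g₂) (K := tsupport u)
    (L := Metric.closedBall 0 r) ((cρ.mul cu).norm.pow 2) huc hball
    (fun x hx z => by simp [hg₂, hx0 x hx]) (fun x z hz => by simp [hg₂, hρ.eq_zero hz])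
  have hineq : ∀ y, D₀ * ∫ x, g₂ x (x - y) ≤ κ₀ * (∫ x, g₀ x (x - y)) +
      κ₁ * (∑ j, ∫ x, g₁ j x (x - y)) + κ₂ * ∫ x, g₂ x (x - y) := by
    intro y
    have hs : ContDiff ℝ ∞ fun x => ρ (x - y) := hρ.contDiff.comp (contDiff_id.sub contDiff_const)
    have h := hloc y _ rfl
    have t1 : ∀ x, hamiltonian ħ A V (fun x => (ρ (x - y) : ℂ) * u x) x / ħ -
        μ * ((ρ (x - y) : ℂ) * u x) = (ρ (x - y) : ℂ) * F x +
          ∑ j, ((partialDeriv j ρ (x - y) : ℝ) : ℂ) * (-2 * Complex.I * momentum ħ A j u x) +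
          (coordLaplacian ρ (x - y) : ℂ) * (-ħ * u x) := by
      intro x
      have hd1 : ∀ j, partialDeriv j (fun x => ρ (x - y)) = fun x => partialDeriv j ρ (x - y) :=
        fun j => funext fun x => partialDeriv_comp_sub j ρ x y
      have hd2 : coordLaplacian (fun x => ρ (x - y)) x = coordLaplacian ρ (x - y) :=
        Finset.sum_congr rfl fun j _ => by rw [hd1, partialDeriv_comp_sub]
      rw [hamiltonian_ofReal_mul hħ.ne' V hA hs hu μ x, hd2]
      simp only [hd1, hF]
    have t2 : ∀ j x, momentum ħ A j (fun x => (ρ (x - y) : ℂ) * u x) x =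
        (ρ (x - y) : ℂ) * momentum ħ A j u x +
          ħ / Complex.I * (partialDeriv j ρ (x - y) : ℝ) * u x := by
      intro j x
      rw [momentum_ofReal_mul ħ A j (hs.differentiable (by simp) x)
        (hu.differentiable (by simp) x), partialDeriv_comp_sub]
    simp only [t1, t2] at h
    exact h
  have hmono := integral_mono (a2.const_mul D₀)
    (((a0.const_mul κ₀).add ((integrable_finsetSum Finset.univ fun j _ => (h1 j).1).const_mul
      κ₁)).add (a2.const_mul κ₂)) hineq
  have hR := integral_add' ((a0.const_mul κ₀).add ((integrable_finsetSum Finset.univ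
    fun j _ => (h1 j).1).const_mul κ₁)) (a2.const_mul κ₂)
  rw [integral_add' (a0.const_mul κ₀) ((integrable_finsetSum Finset.univ
    fun j _ => (h1 j).1).const_mul κ₁), integral_const_mul, integral_const_mul,
    integral_const_mul, integral_finsetSum _ fun j _ => (h1 j).1, e0, e2] at hR
  rw [hR, integral_const_mul, e2] at hmono
  simp only [fun j => (h1 j).2.2] at hmono
  have hg2 : ∫ x, ∫ z, g₂ x z = ∫ x, ‖u x‖ ^ 2 := by
    refine integral_congr_ae (.of_forall fun x => ?_)
    simp only [hg₂, norm_mul, mul_pow, Complex.norm_real, Real.norm_eq_abs, sq_abs]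
    rw [integral_mul_const, hρ.integral_sq, one_mul]
  have iu := integrable_norm_sq hu0 huc
  have iP := fun j => integrable_norm_sq (hPc j) (hPs j)
  have iS := integrable_finsetSum Finset.univ fun j _ => iP j
  have iF := integrable_norm_sq hFc hFs
  have hg0 : ∫ x, ∫ z, g₀ x z ≤ (1 + ħ * (c / r ^ 2)) * (∫ x, ‖F x‖ ^ 2) +
        8 * d * (c / r ^ 2) * (∑ j, ∫ x, ‖momentum ħ A j u x‖ ^ 2) +
        (ħ * (c / r ^ 2) + 2 * ħ ^ 2 * (c / r ^ 4)) * ∫ x, ‖u x‖ ^ 2 := by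
    refine (integral_mono b0 (((iF.const_mul _).add (iS.const_mul _)).add (iu.const_mul _))
      fun x => hρ.integral_norm_hamiltonian_le hħ (F x) (u x) _).trans (le_of_eq ?_)
    refine (integral_add' ((iF.const_mul _).add (iS.const_mul _)) (iu.const_mul _)).trans ?_
    rw [integral_add' (iF.const_mul _) (iS.const_mul _), integral_const_mul, integral_const_mul,
      integral_const_mul, integral_finsetSum _ fun j _ => iP j]
  have hg1 : ∑ j, ∫ x, ∫ z, g₁ j x z ≤ 2 * (∑ j, ∫ x, ‖momentum ħ A j u x‖ ^ 2) +
        2 * d * ħ ^ 2 * (c / r ^ 2) * ∫ x, ‖u x‖ ^ 2 := by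
    have : ∀ j, ∫ x, ∫ z, g₁ j x z ≤ 2 * (∫ x, ‖momentum ħ A j u x‖ ^ 2) +
        2 * ħ ^ 2 * (c / r ^ 2) * ∫ x, ‖u x‖ ^ 2 := by
      intro j
      refine (integral_mono (h1 j).2.1 (((iP j).const_mul _).add (iu.const_mul _))
        fun x => hρ.integral_norm_momentum_le ħ j _ (u x)).trans (le_of_eq ?_)
      refine (integral_add' ((iP j).const_mul _) (iu.const_mul _)).trans ?_
      rw [integral_const_mul, integral_const_mul]
    refine (Finset.sum_le_sum fun j _ => this j).trans (le_of_eq ?_)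
    rw [Finset.sum_add_distrib, ← Finset.mul_sum]
    simp only [Finset.sum_const, Finset.card_univ, Fintype.card_fin, nsmul_eq_mul]
    ring
  rw [hg2] at hmono
  refine hmono.trans ?_
  gcongr

end

/-! ### The energy estimate and the choice of scales -/

section

variable {d : ℕ}

/-- The energy estimate for the magnetic momenta. -/
lemma sum_integral_norm_momentum_sq_le {A : Fin d → EuclideanSpace ℝ (Fin d) → ℝ}
    {V : EuclideanSpace ℝ (Fin d) → ℝ} (hA : ∀ j, ContDiff ℝ ∞ (A j)) (hV : ContDiff ℝ ∞ V)
    {M : ℝ} (hM : ∀ x, |V x| ≤ M) {u : EuclideanSpace ℝ (Fin d) → ℂ} (hu : ContDiff ℝ ∞ u)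
    (huc : HasCompactSupport u) {ħ : ℝ} (hħ : 0 < ħ) (μ : ℝ) :
    ∑ j, ∫ x, ‖momentum ħ A j u x‖ ^ 2 ≤
      ħ * (1 / 2 * (∫ x, ‖hamiltonian ħ A V u x / ħ - μ * u x‖ ^ 2) +
        (1 / 2 + |μ| + M) * ∫ x, ‖u x‖ ^ 2) := by
  have hħ' : (ħ : ℂ) ≠ 0 := by exact_mod_cast hħ.ne'
  set F : EuclideanSpace ℝ (Fin d) → ℂ := fun x => hamiltonian ħ A V u x / ħ - μ * u x with hF
  have hFc : Continuous F :=
    ((continuous_hamiltonian ħ hA hV hu).div_const _).sub (continuous_const.mul hu.continuous)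
  have hHs : HasCompactSupport fun x => hamiltonian ħ A V u x / (ħ : ℂ) :=
    (HasCompactSupport.hamiltonian huc ħ A V).comp_left (g := fun z : ℂ => z / ħ) (by simp)
  have iF := integrable_norm_sq hFc (hHs.sub huc.mul_left)
  have iu := integrable_norm_sq hu.continuous huc
  have hP : ∀ j, ContDiff ℝ ∞ (momentum ħ A j u) := fun j => contDiff_momentum ħ (hA j) hu
  have hPP : ∀ j, Continuous (momentum ħ A j (momentum ħ A j u)) := fun j =>
    (contDiff_momentum ħ (hA j) (hP j)).continuous
  have hi : ∀ j, Integrable fun x => starRingEnd ℂ (u x) * momentum ħ A j (momentum ħ A j u) x :=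
    fun j => ((Complex.continuous_conj.comp hu.continuous).mul (hPP j)).integrable_of_hasCompactSupport
      ((HasCompactSupport.momentum (HasCompactSupport.momentum huc ħ A j) ħ A j).mul_left)
  have h1 : ∀ j, ∫ x, ‖momentum ħ A j u x‖ ^ 2 =
      ∫ x, (starRingEnd ℂ (u x) * momentum ħ A j (momentum ħ A j u) x).re := by
    intro j
    have h := integral_conj_mul_momentum_of_hasCompactSupport ħ (fun j => (hA j).continuous) j
      ((hP j).of_le (by simp)) (hu.of_le (by simp)) (HasCompactSupport.momentum huc ħ A j)
    have h2 : ∫ x, starRingEnd ℂ (momentum ħ A j u x) * momentum ħ A j u x =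
        ((∫ x, ‖momentum ħ A j u x‖ ^ 2 : ℝ) : ℂ) := by
      rw [← integral_complex_ofReal]
      refine integral_congr_ae (.of_forall fun x => ?_)
      simp only [Complex.conj_mul', Complex.ofReal_pow]
    rw [h2] at h
    have h3 := congrArg Complex.re h
    rw [Complex.ofReal_re] at h3
    rw [← h3]
    exact (integral_re (hi j)).symm
  have hire : ∀ j, Integrable fun x =>
      (starRingEnd ℂ (u x) * momentum ħ A j (momentum ħ A j u) x).re := fun j => (hi j).re
  simp only [h1]
  rw [← integral_finsetSum _ fun j _ => hire j]
  have h2 : ∀ x, ∑ j, (starRingEnd ℂ (u x) * momentum ħ A j (momentum ħ A j u) x).re ≤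
      ħ * (1 / 2) * ‖F x‖ ^ 2 + ħ * (1 / 2 + |μ| + M) * ‖u x‖ ^ 2 := by
    intro x
    -- The sum of squares is eliminated through the definition of `F`: it equals `ħ (F + (μ - V)
    -- u)`.
    have e1 : ∑ j, starRingEnd ℂ (u x) * momentum ħ A j (momentum ħ A j u) x =
        (ħ : ℂ) * (starRingEnd ℂ (u x) * F x + (μ - V x) * (starRingEnd ℂ (u x) * u x)) := by
      rw [← Finset.mul_sum]
      simp only [hF]
      unfold hamiltonian
      generalize ∑ j, momentum ħ A j (momentum ħ A j u) x = s
      field_simp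
      ring
    rw [← Complex.re_sum, e1]
    have e2 : ‖starRingEnd ℂ (u x) * F x + (μ - V x) * (starRingEnd ℂ (u x) * u x)‖ ≤
        ‖u x‖ * ‖F x‖ + (|μ| + M) * ‖u x‖ ^ 2 := by
      refine (norm_add_le _ _).trans ?_
      simp only [norm_mul, RCLike.norm_conj]
      rw [← pow_two]
      gcongr
      refine (norm_sub_le _ _).trans ?_
      simp only [Complex.norm_real, Real.norm_eq_abs]
      linarith [hM x]
    have e3 : ‖u x‖ * ‖F x‖ ≤ 1 / 2 * ‖F x‖ ^ 2 + 1 / 2 * ‖u x‖ ^ 2 := by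
      nlinarith [sq_nonneg (‖u x‖ - ‖F x‖)]
    rw [Complex.re_ofReal_mul]
    calc _ ≤ ħ * (1 / 2 * ‖F x‖ ^ 2 + 1 / 2 * ‖u x‖ ^ 2 + (|μ| + M) * ‖u x‖ ^ 2) := by
          gcongr
          exact (Complex.re_le_norm _).trans (e2.trans (by linarith))
      _ = _ := by ring
  refine (integral_mono (integrable_finsetSum _ fun j _ => hire j)
    ((iF.const_mul _).add (iu.const_mul _)) h2).trans (le_of_eq ?_)
  refine (integral_add' (iF.const_mul _) (iu.const_mul _)).trans ?_
  rw [integral_const_mul, integral_const_mul]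
  ring

/-- Bookkeeping of the errors in powers of `e = ħ^(1/4)`. -/
lemma localization_error_le {C c N m e Φ U S : ℝ} (hC : 0 ≤ C) (hc : 0 ≤ c) (hN : 0 ≤ N)
    (hm : 0 ≤ m) (he : 0 < e) (he1 : e ≤ 1) (hΦ : 0 ≤ Φ) (hU : 0 ≤ U)
    (hS : S ≤ e ^ 4 * (1 / 2 * Φ + m * U)) :
    (1 + e) * ((1 + e ^ 4 * (c / e ^ 3)) * Φ + 8 * N * (c / e ^ 3) * S +
        (e ^ 4 * (c / e ^ 3) + 2 * (e ^ 4) ^ 2 * (c / e ^ 6)) * U) +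
      (1 + 1 / e) * C * (e ^ 6 / (e ^ 4) ^ 2) * (2 * S + 2 * N * (e ^ 4) ^ 2 * (c / e ^ 3) * U) +
      (1 + 1 / e) * C * (e ^ 3 + e ^ 12 / (e ^ 4) ^ 2) * U ≤
    (1 + ((1 + 2 * (c + 4 * N * c) + 2 * C) +
        (2 * (8 * N * c * m + 3 * c) + 2 * C * (2 * m + 2 * N * c) + 4 * C)) * e) * Φ +
      ((1 + 2 * (c + 4 * N * c) + 2 * C) +
        (2 * (8 * N * c * m + 3 * c) + 2 * C * (2 * m + 2 * N * c) + 4 * C)) * e * U := by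
  set a₁ := 1 + 2 * (c + 4 * N * c) + 2 * C with ha₁
  set a₂ := 2 * (8 * N * c * m + 3 * c) + 2 * C * (2 * m + 2 * N * c) + 4 * C with ha₂
  have ha₁0 : 0 < a₁ := by positivity
  have ha₂0 : 0 ≤ a₂ := by positivity
  -- Here `e⁴ = ħ`, `e³ = r²` and `e = δ`. After the energy bound is inserted for `S`, all negative
  -- powers of `e` cancel and at least one factor `e` is left in each error term.
  calc _ ≤ (1 + e) * ((1 + e ^ 4 * (c / e ^ 3)) * Φ +
          8 * N * (c / e ^ 3) * (e ^ 4 * (1 / 2 * Φ + m * U)) +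
          (e ^ 4 * (c / e ^ 3) + 2 * (e ^ 4) ^ 2 * (c / e ^ 6)) * U) +
        (1 + 1 / e) * C * (e ^ 6 / (e ^ 4) ^ 2) * (2 * (e ^ 4 * (1 / 2 * Φ + m * U)) +
          2 * N * (e ^ 4) ^ 2 * (c / e ^ 3) * U) +
        (1 + 1 / e) * C * (e ^ 3 + e ^ 12 / (e ^ 4) ^ 2) * U := by gcongr
    _ = ((1 + e) * (1 + e * (c + 4 * N * c)) + C * (1 + e) * e) * Φ +
        ((1 + e) * e * (8 * N * c * m + c + 2 * c * e) + C * (1 + e) * e * (2 * m + 2 * N * c * e) +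
          C * (1 + e) * e * e * (1 + e)) * U := by
        field_simp
        ring
    _ ≤ (1 + a₁ * e) * Φ + a₂ * e * U := by
        have q1 : (1 + e) * (1 + e * (c + 4 * N * c)) + C * (1 + e) * e ≤ 1 + a₁ * e := by
          have z1 : e * (e * (c + 4 * N * c)) ≤ 1 * (e * (c + 4 * N * c)) := by gcongr
          have z2 : e * (C * e) ≤ 1 * (C * e) := by gcongr
          rw [ha₁]
          linarith
        have q2 : (1 + e) * e * (8 * N * c * m + c + 2 * c * e) +
            C * (1 + e) * e * (2 * m + 2 * N * c * e) + C * (1 + e) * e * e * (1 + e) ≤ a₂ * e := by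
          calc _ ≤ (1 + 1) * e * (8 * N * c * m + c + 2 * c * 1) +
                C * (1 + 1) * e * (2 * m + 2 * N * c * 1) + C * (1 + 1) * e * 1 * (1 + 1) := by
                gcongr
            _ = a₂ * e := by rw [ha₂]; ring
        gcongr
    _ ≤ (1 + (a₁ + a₂) * e) * Φ + (a₁ + a₂) * e * U := by
        gcongr <;> linarith

/-- The estimate at a fixed spectral parameter, at the scale `ħ = τ⁸`. -/
lemma exists_semiclassical_estimate {n : ℕ}
    {A : Fin (2 * n) → EuclideanSpace ℝ (Fin (2 * n)) → ℝ}
    {V : EuclideanSpace ℝ (Fin (2 * n)) → ℝ} (hA : ∀ j, ContDiff ℝ ∞ (A j))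
    (hV : ContDiff ℝ ∞ V) {K : ℝ} (hK : ∀ j k x, ‖fderiv ℝ (fun x => magneticField A x j k) x‖ ≤ K)
    (hKV : ∀ x, ‖fderiv ℝ V x‖ ≤ K) {M : ℝ} (hM : ∀ x, |V x| ≤ M)
    (hrank : ∀ x, (magneticField A x).rank = 2 * n) {D : ℝ} (hD : 0 ≤ D) (μ : ℝ) :
    ∃ C > 0, ∀ τ ∈ Set.Ioc (0 : ℝ) 1, ∀ u : EuclideanSpace ℝ (Fin (2 * n)) → ℂ,
      ContDiff ℝ ∞ u → HasCompactSupport u →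
      (∀ x ∈ tsupport u, ∀ Λ ∈ landauLevels A V x, D ≤ |Λ - μ|) →
      D ^ 2 * ∫ x, ‖u x‖ ^ 2 ≤
        (1 + C * τ ^ 2) * (∫ x, ‖hamiltonian (τ ^ 8) A V u x / ((τ ^ 8 : ℝ) : ℂ) - μ * u x‖ ^ 2) +
          C * τ ^ 2 * ∫ x, ‖u x‖ ^ 2 := by
  obtain ⟨C, hC, hloc⟩ := exists_local_estimate hA hV hK hKV hrank
  obtain ⟨c, hc, hcut⟩ := exists_isCutoff (2 * n)
  have hM0 : 0 ≤ M := (abs_nonneg _).trans (hM 0)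
  set N : ℝ := ((2 * n : ℕ) : ℝ) with hN
  have hN0 : 0 ≤ N := Nat.cast_nonneg _
  set m := 1 / 2 + |μ| + M with hm
  have hm0 : 0 ≤ m := by positivity
  refine ⟨(1 + 2 * (c + 4 * N * c) + 2 * C) +
    (2 * (8 * N * c * m + 3 * c) + 2 * C * (2 * m + 2 * N * c) + 4 * C), by positivity, fun τ hτ u hu huc hgap => ?_⟩
  obtain ⟨hτ0, hτ1⟩ := hτ
  obtain ⟨ρ, hρ⟩ := hcut (τ ^ 3) (by positivity)
  have hħ : 0 < τ ^ 8 := by positivity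
  have key := estimate_of_localized_estimates (D₀ := D ^ 2) (κ₀ := 1 + τ ^ 2)
    (κ₁ := (1 + 1 / τ ^ 2) * C * ((τ ^ 3) ^ 4 / (τ ^ 8) ^ 2))
    (κ₂ := (1 + 1 / τ ^ 2) * C * ((τ ^ 3) ^ 2 + (τ ^ 3) ^ 8 / (τ ^ 8) ^ 2))
    hA hV hu huc hħ hρ μ (by positivity) (by positivity) (by
      intro y v hv
      have hvs : ContDiff ℝ ∞ v := by
        rw [hv]
        exact (Complex.ofRealCLM.contDiff.comp
          (hρ.contDiff.comp (contDiff_id.sub contDiff_const))).mul hu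
      have hvc : HasCompactSupport v := by
        rw [hv]
        exact huc.mul_left
      by_cases h0 : ∃ x₀, v x₀ ≠ 0
      -- The model is taken at a point where `v` is nonzero and not at `y`, which may lie outside
      -- the support of `u`, where nothing is known about the levels. This doubles the radius.
      · obtain ⟨x₀, hx₀⟩ := h0
        have hx₁ : x₀ ∈ tsupport u := subset_tsupport u fun h => hx₀ (by rw [hv]; simp [h])
        have hball : ∀ x, v x ≠ 0 → ‖x - y‖ ≤ τ ^ 3 := by
          intro x hx
          by_contra hlt
          apply hx
          rw [hv]
          simp only
          rw [hρ.eq_zero (by simpa using hlt)]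
          simp
        have hsupp : tsupport v ⊆ Metric.closedBall x₀ (2 * τ ^ 3) := by
          refine closure_minimal (fun x hx => ?_) Metric.isClosed_closedBall
          rw [Metric.mem_closedBall, dist_eq_norm]
          calc ‖x - x₀‖ = ‖(x - y) - (x₀ - y)‖ := by congr 1; abel
            _ ≤ ‖x - y‖ + ‖x₀ - y‖ := norm_sub_le _ _
            _ ≤ 2 * τ ^ 3 := by linarith [hball x hx, hball x₀ hx₀]
        have h := hloc x₀ μ D hD (hgap x₀ hx₁) (τ ^ 8) hħ (τ ^ 3) (by positivity) (τ ^ 2)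
          (by positivity) v hvs hvc hsupp
        refine h.trans (le_of_eq ?_)
        ring
      · push Not at h0
        have hv0 : ∫ x, ‖v x‖ ^ 2 = 0 := by simp [h0]
        rw [hv0, mul_zero, mul_zero, add_zero]
        exact add_nonneg (mul_nonneg (by positivity) (integral_nonneg fun x => sq_nonneg _))
          (mul_nonneg (by positivity)
            (Finset.sum_nonneg fun j _ => integral_nonneg fun x => sq_nonneg _)))
  have henergy := sum_integral_norm_momentum_sq_le hA hV hM hu huc hħ μ
  have hS0 : 0 ≤ ∑ j, ∫ x, ‖momentum (τ ^ 8) A j u x‖ ^ 2 :=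
    Finset.sum_nonneg fun j _ => integral_nonneg fun x => sq_nonneg _
  have hU0 : 0 ≤ ∫ x, ‖u x‖ ^ 2 := integral_nonneg fun x => sq_nonneg _
  have hF0 : 0 ≤ ∫ x, ‖hamiltonian (τ ^ 8) A V u x / ((τ ^ 8 : ℝ) : ℂ) - μ * u x‖ ^ 2 :=
    integral_nonneg fun x => sq_nonneg _
  generalize ∑ j, ∫ x, ‖momentum (τ ^ 8) A j u x‖ ^ 2 = S at *
  generalize ∫ x, ‖u x‖ ^ 2 = U at *
  generalize ∫ x, ‖hamiltonian (τ ^ 8) A V u x / ((τ ^ 8 : ℝ) : ℂ) - μ * u x‖ ^ 2 = Φ at *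
  rw [← hm] at henergy
  refine key.trans ?_
  have hscale := localization_error_le hC.le hc.le hN0 hm0 (by positivity : 0 < τ ^ 2)
    (pow_le_one₀ hτ0.le hτ1) hF0 hU0 (S := S) (by
      refine henergy.trans (le_of_eq ?_)
      ring)
  refine le_trans (le_of_eq ?_) hscale
  ring

end

/-! ### Passage to norms and to all spectral parameters -/

section

variable {d : ℕ}

lemma l2Norm_nonneg (u : EuclideanSpace ℝ (Fin d) → ℂ) : 0 ≤ l2Norm u := ENNReal.toReal_nonneg

lemma l2Norm_sq {u : EuclideanSpace ℝ (Fin d) → ℂ} (hu : Continuous u)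
    (hc : HasCompactSupport u) : l2Norm u ^ 2 = ∫ x, ‖u x‖ ^ 2 := by
  have h : MemLp u 2 volume := hu.memLp_of_hasCompactSupport hc
  rw [← norm_toLp_sq h, Lp.norm_toLp]
  rfl

lemma l2Norm_add_const_mul_le {f u : EuclideanSpace ℝ (Fin d) → ℂ} (hf : MemLp f 2 volume)
    (hu : MemLp u 2 volume) (c : ℂ) :
    l2Norm (fun x => f x + c * u x) ≤ l2Norm f + ‖c‖ * l2Norm u := by
  have h1 : l2Norm (f + c • u) = ‖hf.toLp f + c • hu.toLp u‖ := by
    rw [← MemLp.toLp_const_smul, ← MemLp.toLp_add, Lp.norm_toLp]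
    rfl
  have h2 : l2Norm f = ‖hf.toLp f‖ := (Lp.norm_toLp f hf).symm
  have h3 : l2Norm u = ‖hu.toLp u‖ := (Lp.norm_toLp u hu).symm
  change l2Norm (f + c • u) ≤ _
  rw [h1, h2, h3, ← norm_smul]
  exact norm_add_le _ _

lemma IsSmoothBounded.exists_norm_fderiv_le {f : EuclideanSpace ℝ (Fin d) → ℝ}
    (hf : IsSmoothBounded f) : ∃ C, ∀ x, ‖fderiv ℝ f x‖ ≤ C := by
  obtain ⟨C, hC⟩ := hf.2 1
  exact ⟨C, fun x => by rw [← norm_iteratedFDeriv_one]; exact hC x⟩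

lemma IsSmoothBounded.exists_abs_le {f : EuclideanSpace ℝ (Fin d) → ℝ}
    (hf : IsSmoothBounded f) : ∃ C, ∀ x, |f x| ≤ C := by
  obtain ⟨C, hC⟩ := hf.2 0
  exact ⟨C, fun x => by
    have := hC x
    rwa [norm_iteratedFDeriv_zero, Real.norm_eq_abs] at this⟩

/-- The largest interval around `[a, b]` which avoids `S`, given by its centre `μ` and its half
length `D`. -/
lemma exists_gap_centre {S : Set ℝ} (hS : S.Nonempty) {a b : ℝ} (hab : a < b)
    (hdisj : ∀ s ∈ S, s < a ∨ b < s) :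
    ∃ μ D : ℝ, 0 < D ∧ (∀ s ∈ S, D ≤ |s - μ|) ∧
      ∀ t ∈ Set.Ioo a b, Metric.infDist t S ≤ D - |t - μ| := by
  -- `α` and `β` are the endpoints of the interval; `D - |t - μ|` is the smaller of `t - α` and `β -
  -- t`.
  suffices h : ∃ α β : ℝ, α ≤ a ∧ b ≤ β ∧ (∀ s ∈ S, s ≤ α ∨ β ≤ s) ∧
      ∀ t ∈ Set.Ioo a b, Metric.infDist t S ≤ t - α ∧ Metric.infDist t S ≤ β - t by
    obtain ⟨α, β, hα, hβ, h1, h2⟩ := h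
    refine ⟨(α + β) / 2, (β - α) / 2, by linarith, fun s hs => ?_, fun t ht => ?_⟩
    · rcases h1 s hs with h | h
      · rw [le_abs]; right; linarith
      · rw [le_abs]; left; linarith
    · obtain ⟨h3, h4⟩ := h2 t ht
      rcases abs_cases (t - (α + β) / 2) with ⟨h, _⟩ | ⟨h, _⟩ <;> rw [h] <;> linarith
  set L := {s ∈ S | s < a}
  set R := {s ∈ S | b < s}
  have hLb : BddAbove L := ⟨a, fun s hs => hs.2.le⟩
  have hRb : BddBelow R := ⟨b, fun s hs => hs.2.le⟩
  have hL : L.Nonempty → sSup L ≤ a ∧ ∀ t ∈ Set.Ioo a b, Metric.infDist t S ≤ t - sSup L := by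
    intro hne
    refine ⟨csSup_le hne fun s hs => hs.2.le, fun t ht => ?_⟩
    have : sSup L ≤ t - Metric.infDist t S := csSup_le hne fun s hs => by
      have h := Metric.infDist_le_dist_of_mem (x := t) hs.1
      rw [Real.dist_eq, abs_of_pos (by linarith [hs.2, ht.1])] at h
      linarith
    linarith
  have hR : R.Nonempty → b ≤ sInf R ∧ ∀ t ∈ Set.Ioo a b, Metric.infDist t S ≤ sInf R - t := by
    intro hne
    refine ⟨le_csInf hne fun s hs => hs.2.le, fun t ht => ?_⟩
    have : t + Metric.infDist t S ≤ sInf R := le_csInf hne fun s hs => by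
      have h := Metric.infDist_le_dist_of_mem (x := t) hs.1
      rw [Real.dist_eq, abs_of_neg (by linarith [hs.2, ht.2])] at h
      linarith
    linarith
  have hmem : ∀ s ∈ S, s ∈ L ∨ s ∈ R := fun s hs => (hdisj s hs).imp (⟨hs, ·⟩) (⟨hs, ·⟩)
  rcases L.eq_empty_or_nonempty with hLe | hLne
  · have hRne : R.Nonempty := by
      obtain ⟨s, hs⟩ := hS
      rcases hmem s hs with h | h
      · exact absurd h (hLe ▸ Set.notMem_empty s)
      · exact ⟨s, h⟩
    obtain ⟨hb, hd⟩ := hR hRne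
    -- With nothing of `S` on the left, the left endpoint is the reflection of `sInf R` in `a`:
    -- every `t > a` is then farther from it than from `sInf R`.
    refine ⟨2 * a - sInf R, sInf R, by linarith, hb, fun s hs => Or.inr ?_,
      fun t ht => ⟨by linarith [hd t ht, ht.1], hd t ht⟩⟩
    rcases hmem s hs with h | h
    · exact absurd h (hLe ▸ Set.notMem_empty s)
    · exact csInf_le hRb h
  · obtain ⟨ha, hd⟩ := hL hLne
    rcases R.eq_empty_or_nonempty with hRe | hRne
    · refine ⟨sSup L, 2 * b - sSup L, ha, by linarith, fun s hs => Or.inl ?_,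
        fun t ht => ⟨hd t ht, by linarith [hd t ht, ht.2]⟩⟩
      rcases hmem s hs with h | h
      · exact le_csSup hLb h
      · exact absurd h (hRe ▸ Set.notMem_empty s)
    · obtain ⟨hb, hd'⟩ := hR hRne
      exact ⟨sSup L, sInf R, ha, hb, fun s hs => (hmem s hs).imp (le_csSup hLb) (csInf_le hRb),
        fun t ht => ⟨hd t ht, hd' t ht⟩⟩

/-- The lower bound at a fixed spectral parameter. -/
lemma exists_l2Norm_estimate {n : ℕ}
    {A : Fin (2 * n) → EuclideanSpace ℝ (Fin (2 * n)) → ℝ}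
    {V : EuclideanSpace ℝ (Fin (2 * n)) → ℝ} (hA : ∀ j, ContDiff ℝ ∞ (A j))
    (hB : ∀ j k, IsSmoothBounded fun x => magneticField A x j k) (hV : IsSmoothBounded V)
    (hrank : ∀ x, (magneticField A x).rank = 2 * n) {D : ℝ} (hD : 0 < D) (μ : ℝ) :
    ∃ C > 0, ∀ ħ ∈ Set.Ioc (0 : ℝ) 1, ∀ u : EuclideanSpace ℝ (Fin (2 * n)) → ℂ,
      ContDiff ℝ ∞ u → HasCompactSupport u →
      (∀ x ∈ tsupport u, ∀ Λ ∈ landauLevels A V x, D ≤ |Λ - μ|) →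
      (D - C * ħ ^ (1 / 4 : ℝ)) * l2Norm u ≤
        l2Norm fun x => hamiltonian ħ A V u x / (ħ : ℂ) - (μ : ℂ) * u x := by
  choose K hK using fun j k => (hB j k).exists_norm_fderiv_le
  obtain ⟨K', hK'⟩ := hV.exists_norm_fderiv_le
  obtain ⟨M, hM⟩ := hV.exists_abs_le
  have hKle : ∀ j k, K j k ≤ (∑ j, ∑ k, |K j k|) + |K'| := by
    intro j k
    have h1 : |K j k| ≤ ∑ k, |K j k| :=
      Finset.single_le_sum (f := fun k => |K j k|) (fun _ _ => abs_nonneg _) (Finset.mem_univ k)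
    have h2 : ∑ k, |K j k| ≤ ∑ j, ∑ k, |K j k| :=
      Finset.single_le_sum (f := fun j => ∑ k, |K j k|)
        (fun _ _ => Finset.sum_nonneg fun _ _ => abs_nonneg _) (Finset.mem_univ j)
    linarith [le_abs_self (K j k), abs_nonneg K']
  have hKle' : K' ≤ (∑ j, ∑ k, |K j k|) + |K'| := by
    have : 0 ≤ ∑ j, ∑ k, |K j k| :=
      Finset.sum_nonneg fun _ _ => Finset.sum_nonneg fun _ _ => abs_nonneg _
    linarith [le_abs_self K']
  obtain ⟨C, hC, hest⟩ := exists_semiclassical_estimate hA hV.1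
    (fun j k x => (hK j k x).trans (hKle j k)) (fun x => (hK' x).trans hKle') hM hrank hD.le μ
  -- Dividing by `D` accounts for taking a square root in the quadratic estimate; this is where `D >
  -- 0` is used.
  refine ⟨C * (D ^ 2 + 1) / D, by positivity, fun ħ hħ u hu huc hgap => ?_⟩
  set τ := ħ ^ (1 / 8 : ℝ) with hτ
  have hτ0 : 0 < τ := Real.rpow_pos_of_pos hħ.1 _
  have hτ1 : τ ≤ 1 := Real.rpow_le_one hħ.1.le hħ.2 (by norm_num)
  have hτ8 : τ ^ 8 = ħ := by
    rw [hτ, ← Real.rpow_natCast, ← Real.rpow_mul hħ.1.le]; norm_num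
  have hτ2 : ħ ^ (1 / 4 : ℝ) = τ ^ 2 := by
    rw [hτ, ← Real.rpow_natCast (ħ ^ (1 / 8 : ℝ)), ← Real.rpow_mul hħ.1.le]; norm_num
  have h := hest τ ⟨hτ0, hτ1⟩ u hu huc hgap
  rw [hτ8] at h
  rw [hτ2]
  set F : EuclideanSpace ℝ (Fin (2 * n)) → ℂ := fun x => hamiltonian ħ A V u x / ħ - μ * u x
    with hF
  have hFc : Continuous F :=
    ((continuous_hamiltonian ħ hA hV.1 hu).div_const _).sub (continuous_const.mul hu.continuous)
  have hHs : HasCompactSupport fun x => hamiltonian ħ A V u x / (ħ : ℂ) :=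
    (HasCompactSupport.hamiltonian huc ħ A V).comp_left (g := fun z : ℂ => z / ħ) (by simp)
  have hFs : HasCompactSupport F := hHs.sub huc.mul_left
  rw [← l2Norm_sq hu.continuous huc, ← l2Norm_sq hFc hFs] at h
  have hf0 := l2Norm_nonneg F
  have hu0 := l2Norm_nonneg u
  generalize l2Norm F = y at *
  generalize l2Norm u = z at *
  by_contra hlt
  push Not at hlt
  -- If the claim fails, `y ≤ D z`, so the error proportional to `y²` can be charged to `z²`, and
  -- `y² ≤ y D z` contradicts the quadratic estimate.
  have hyD : y ≤ D * z := by
    have : 0 ≤ C * (D ^ 2 + 1) / D * τ ^ 2 * z := by positivity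
    linarith
  have hz : 0 < z := by
    rcases hu0.eq_or_lt with h0 | h0
    · rw [← h0] at hlt; linarith
    · exact h0
  have h1 : y ^ 2 ≤ D ^ 2 * z ^ 2 := by
    rw [← mul_pow]; gcongr
  have h2 : D ^ 2 * z ^ 2 ≤ y ^ 2 + C * τ ^ 2 * (D ^ 2 + 1) * z ^ 2 := by
    have : C * τ ^ 2 * y ^ 2 ≤ C * τ ^ 2 * (D ^ 2 * z ^ 2) := by gcongr
    linarith
  have h3 : y * y ≤ y * (D * z) := by gcongr
  have h4 : y * (D * z) < (D - C * (D ^ 2 + 1) / D * τ ^ 2) * z * (D * z) := by gcongr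
  have h5 : (D - C * (D ^ 2 + 1) / D * τ ^ 2) * z * (D * z) =
      D ^ 2 * z ^ 2 - C * τ ^ 2 * (D ^ 2 + 1) * z ^ 2 := by
    field_simp
  linarith [pow_two y]

/-- The lower bound for functions supported in the gap region. -/
theorem exists_lower_bound_of_tsupport_subset_gapRegion {n : ℕ}
    {A : Fin (2 * n) → EuclideanSpace ℝ (Fin (2 * n)) → ℝ}
    {V : EuclideanSpace ℝ (Fin (2 * n)) → ℝ}
    (hA : ∀ j, ContDiff ℝ ∞ (A j))
    (hB : ∀ j k, IsSmoothBounded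
      fun x => magneticField A x j k)
    (hV : IsSmoothBounded V)
    (hrank : ∀ x, (magneticField A x).rank = 2 * n)
    (a b : ℝ) :
    ∃ C > 0, ∃ ħ₀ > 0, ∀ lam ∈ Set.Ioo a b, ∀ ħ ∈ Set.Ioc 0 ħ₀,
      ∀ u : EuclideanSpace ℝ (Fin (2 * n)) → ℂ, ContDiff ℝ ∞ u → HasCompactSupport u →
        tsupport u ⊆ gapRegion A V a b →
        (Metric.infDist lam (allLandauLevels A V)
            - C * ħ ^ (1 / 4 : ℝ)) * l2Norm u ≤
          l2Norm fun x =>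
            hamiltonian ħ A V u x / (ħ : ℂ) - (lam : ℂ) * u x := by
  rcases lt_or_ge a b with hab | hab
  swap
  · exact ⟨1, one_pos, 1, one_pos, fun lam hl => absurd (hl.1.trans hl.2) hab.not_gt⟩
  rcases (gapRegion A V a b).eq_empty_or_nonempty with hΩ | ⟨x₀, hx₀⟩
  · refine ⟨1, one_pos, 1, one_pos, fun lam _ ħ _ u _ _ hsupp => ?_⟩
    have hu : u = 0 := by
      rw [hΩ, Set.subset_empty_iff] at hsupp
      exact tsupport_eq_empty_iff.mp hsupp
    have hu0 : l2Norm u = 0 := by rw [hu]; simp [l2Norm]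
    rw [hu0, mul_zero]
    exact l2Norm_nonneg _
  -- Only the levels over the gap region are used: they avoid `[a, b]`, while `Σ` itself may meet
  -- it.
  set S : Set ℝ := ⋃ x ∈ gapRegion A V a b, landauLevels A V x with hS
  have hSne : S.Nonempty := by
    obtain ⟨θ, -, -, hθ, -⟩ := exists_frequencies (magneticField_transpose A x₀) (hrank x₀)
    exact ⟨_, Set.mem_biUnion hx₀ ⟨θ, hθ, fun _ => 0, rfl⟩⟩
  have hdisj : ∀ s ∈ S, s < a ∨ b < s := by
    intro s hs
    obtain ⟨x, hx, hsx⟩ := Set.mem_iUnion₂.mp hs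
    by_contra hcon
    push Not at hcon
    have : s ∈ landauLevels A V x ∩ Set.Icc a b := ⟨hsx, hcon⟩
    rw [show landauLevels A V x ∩ Set.Icc a b = ∅ from hx] at this
    exact this
  obtain ⟨μ, D, hD, hgap, hdist⟩ := exists_gap_centre hSne hab hdisj
  obtain ⟨C, hC, hest⟩ := exists_l2Norm_estimate hA hB hV hrank hD μ
  refine ⟨C, hC, 1, one_pos, fun lam hlam ħ hħ u hu huc hsupp => ?_⟩
  have h1 := hest ħ hħ u hu huc fun x hx Λ hΛ =>
    hgap Λ (Set.mem_biUnion (hsupp hx) hΛ)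
  -- Enlarging the set from `S` to `Σ` can only decrease the distance.
  have h2 : Metric.infDist lam (allLandauLevels A V) ≤ D - |lam - μ| :=
    (Metric.infDist_le_infDist_of_subset
      (Set.iUnion₂_subset fun x _ => Set.subset_iUnion _ x) hSne).trans (hdist lam hlam)
  have hHs : HasCompactSupport fun x => hamiltonian ħ A V u x / (ħ : ℂ) :=
    (HasCompactSupport.hamiltonian huc ħ A V).comp_left (g := fun z : ℂ => z / ħ) (by simp)
  have hFc : Continuous fun x => hamiltonian ħ A V u x / (ħ : ℂ) - (lam : ℂ) * u x :=
    ((continuous_hamiltonian ħ hA hV.1 hu).div_const _).sub (continuous_const.mul hu.continuous)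
  have hFs : HasCompactSupport fun x => hamiltonian ħ A V u x / (ħ : ℂ) - (lam : ℂ) * u x :=
    hHs.sub huc.mul_left
  have h3 := l2Norm_add_const_mul_le (hFc.memLp_of_hasCompactSupport hFs)
    (hu.continuous.memLp_of_hasCompactSupport huc) ((lam - μ : ℝ) : ℂ)
  rw [Complex.norm_real, Real.norm_eq_abs] at h3
  have h4 : (fun x => hamiltonian ħ A V u x / (ħ : ℂ) - (lam : ℂ) * u x +
      ((lam - μ : ℝ) : ℂ) * u x) = fun x => hamiltonian ħ A V u x / (ħ : ℂ) - (μ : ℂ) * u x := by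
    funext x
    push_cast
    ring
  rw [h4] at h3
  have h5 : (Metric.infDist lam (allLandauLevels A V) - C * ħ ^ (1 / 4 : ℝ)) * l2Norm u ≤
      (D - |lam - μ| - C * ħ ^ (1 / 4 : ℝ)) * l2Norm u := by
    gcongr
    exact l2Norm_nonneg u
  linarith

end

end MagneticSchrodinger

end

theorem proposition7 (n : ℕ)
    (A : Fin (2 * n) → EuclideanSpace ℝ (Fin (2 * n)) → ℝ)
    (V : EuclideanSpace ℝ (Fin (2 * n)) → ℝ)
    (hA : ∀ j, ContDiff ℝ ∞ (A j))
    (hB : ∀ j k, MagneticSchrodinger.IsSmoothBounded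
      fun x => MagneticSchrodinger.magneticField A x j k)
    (hV : MagneticSchrodinger.IsSmoothBounded V)
    (hrank : ∀ x, (MagneticSchrodinger.magneticField A x).rank = 2 * n)
    (a b : ℝ) :
    ∃ C > 0, ∃ ħ₀ > 0, ∀ lam ∈ Set.Ioo a b, ∀ ħ ∈ Set.Ioc 0 ħ₀,
      ∀ u : EuclideanSpace ℝ (Fin (2 * n)) → ℂ, ContDiff ℝ ∞ u → HasCompactSupport u →
        tsupport u ⊆ MagneticSchrodinger.gapRegion A V a b →
        (Metric.infDist lam (MagneticSchrodinger.allLandauLevels A V)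
            - C * ħ ^ (1 / 4 : ℝ)) * MagneticSchrodinger.l2Norm u ≤
          MagneticSchrodinger.l2Norm fun x =>
            MagneticSchrodinger.hamiltonian ħ A V u x / (ħ : ℂ) - (lam : ℂ) * u x :=
  MagneticSchrodinger.exists_lower_bound_of_tsupport_subset_gapRegion hA hB hV hrank a b
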